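/- **Notation.** For $x>0$ put $\operatorname{Log} x=\max\{1,\log x\}$ and $\operatorname{Log}_2x=\operatorname{Log}(\operatorname{Log}x)$. For a natural number $n\ge 1$ let $\omega(n)$ be the number of distinct prime factors of $n$ and $$\Delta(n)=\max_{u\in\mathbb R}\#\{d\mid n:\ e^u<d\le e^{u+1}\}.$$ For each prime $p$ let $n_p$ be a random variable equal to $1$ with probability $\frac p{p+1}$ and to $p$ with probability $\frac1{p+1}$, independently in $p$, and let $n_{<x}=\prod_{p<x}n_p$. For a finite set $A$ of natural numbers let $m(A)$ be the largest $m$ such that there are distinct subsets $A_1,\dots,A_m$ of $A$ with $\sum_{a\in A_1}a=\dots=\sum_{a\in A_m}a$. Let $\mathbf A$ be a random set of positive integers that contains each $a\ge1$ independently with probability $1/a$. For $k\in\mathbb N$ let $\beta_k$ be the supremum of all $c<1$ such that $\lim_{D\to\infty}\mathbb P\big(m(\mathbf A\cap[D^c,D])\ge k\big)=1$, and let $$\eta_*=\liminf_{k\to\infty}\frac{\log k}{\log(1/\beta_k)}.$$ **Theorem.** For every $\varepsilon>0$ there is a constant $C_\varepsilon>0$ such that the following holds for all real $x>0$ and all integers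 $r$ with $(1+\varepsilon)\operatorname{Log}_2x\le r\le(2-\varepsilon)\operatorname{Log}_2x$: $$\mathbb E\big[\Delta(n_{<x})\,\mathbf 1\{\omega(n_{<x})=r\}\big]\ \ge\ C_\varepsilon\,(\operatorname{Log}_2x)^{\eta_*-\varepsilon}.$$ Moreover, for every $\varepsilon>0$ there is a constant $C'_\varepsilon>0$ such that for all real $x>0$ $$\mathbb E\big[\Delta(n_{<x})\big]\ \ge\ C'_\varepsilon\,(\operatorname{Log}_2x)^{1+\eta_*-\varepsilon}.$$ -/

import Mathlib

open MeasureTheory Filter Topology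

noncomputable section

namespace ErdosHooley

/-- `Log x = max {1, log x}`. -/
def Log (x : ℝ) : ℝ := max 1 (Real.log x)

/-- `Log₂ x = Log (Log x)`. -/
def Log2 (x : ℝ) : ℝ := Log (Log x)

/-- The divisors `d` of `n` with `e ^ u < d ≤ e ^ (u + 1)`. -/
def divisorsInWindow (n : ℕ) (u : ℝ) : Finset ℕ :=
  n.divisors.filter (fun d => Real.exp u < (d : ℝ) ∧ (d : ℝ) ≤ Real.exp (u + 1))

/-- The Erdős–Hooley Delta function: the maximum over real `u` of the number of divisors `d` of `n`
with `e ^ u < d ≤ e ^ (u + 1)`. -/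
def hooleyDelta (n : ℕ) : ℕ := ⨆ u : ℝ, (divisorsInWindow n u).card

/-- The supremum in the definition of `hooleyDelta` is a maximum. -/
theorem hooleyDelta_isGreatest (n : ℕ) :
    IsGreatest (Set.range fun u : ℝ => (divisorsInWindow n u).card) (hooleyDelta n) := by
  have hb : BddAbove (Set.range fun u : ℝ => (divisorsInWindow n u).card) := by
    refine ⟨n.divisors.card, ?_⟩
    rintro _ ⟨u, rfl⟩
    exact Finset.card_le_card (Finset.filter_subset _ _)
  exact ⟨Nat.sSup_mem (Set.range_nonempty _) hb, fun m hm => le_csSup hb hm⟩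

/-- The numbers `m` such that `A` has `m` distinct (finite) subsets with a common sum. -/
def equalSubsumCounts (A : Set ℕ) : Set ℕ :=
  {m | ∃ F : Finset (Finset ℕ), F.card = m ∧ (∀ S ∈ F, (S : Set ℕ) ⊆ A) ∧
    ∃ s : ℕ, ∀ S ∈ F, ∑ a ∈ S, a = s}

/-- The subsum multiplicity `m(A)` of a finite set `A` of natural numbers: the largest `m` such that
`A` has `m` distinct subsets with a common sum. -/
def subsumMultiplicity (A : Set ℕ) : ℕ := sSup (equalSubsumCounts A)

/-- For a finite set the supremum in the definition of `subsumMultiplicity` is a maximum. -/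
theorem subsumMultiplicity_isGreatest {A : Set ℕ} (hA : A.Finite) :
    IsGreatest (equalSubsumCounts A) (subsumMultiplicity A) := by
  have hb : BddAbove (equalSubsumCounts A) := by
    refine ⟨hA.toFinset.powerset.card, ?_⟩
    rintro _ ⟨F, rfl, hF, -⟩
    refine Finset.card_le_card fun S hS => ?_
    rw [Finset.mem_powerset]
    intro a ha
    rw [Set.Finite.mem_toFinset]
    exact hF S hS ha
  have hne : (equalSubsumCounts A).Nonempty := ⟨0, ∅, by simp⟩
  exact ⟨Nat.sSup_mem hne hb, fun m hm => le_csSup hb hm⟩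

/-- The law of the truth value of `a ∈ 𝐀`: true with probability `1 / a`, false with probability
`1 - 1 / a`. (At `a = 0` the convention `1 / 0 = 0` makes it false almost surely, so that the random
set consists of positive integers.) -/
def membershipLaw (a : ℕ) : Measure Prop :=
  ENNReal.ofReal (1 / (a : ℝ)) • Measure.dirac True +
    ENNReal.ofReal (1 - 1 / (a : ℝ)) • Measure.dirac False

instance membershipLaw_isProbabilityMeasure (a : ℕ) : IsProbabilityMeasure (membershipLaw a) := by
  refine ⟨?_⟩
  have h1 : (0 : ℝ) ≤ 1 / (a : ℝ) := by positivity
  have h2 : (0 : ℝ) ≤ 1 - 1 / (a : ℝ) := by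
    rcases Nat.eq_zero_or_pos a with rfl | ha
    · simp
    · have : (1 : ℝ) ≤ a := by exact_mod_cast ha
      rw [sub_nonneg, div_le_one (by linarith)]
      exact this
  simp only [membershipLaw, Measure.coe_add, Measure.coe_smul, Pi.add_apply, Pi.smul_apply,
    measure_univ, smul_eq_mul, mul_one]
  rw [← ENNReal.ofReal_add h1 h2]
  simp

/-- The law of the random set `𝐀` of natural numbers in which each `a ≥ 1` lies with independent
probability `1 / a`. -/
def randomSetLaw : Measure (Set ℕ) :=
  (Measure.infinitePi membershipLaw).map (fun P : ℕ → Prop => {a : ℕ | P a})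

instance randomSetLaw_isProbabilityMeasure : IsProbabilityMeasure randomSetLaw :=
  Measure.isProbabilityMeasure_map MeasurableEquiv.setOfPred.measurable.aemeasurable

/-- `β_k`: the supremum of all `c < 1` such that `ℙ(m(𝐀 ∩ [D ^ c, D]) ≥ k) → 1` as `D → ∞`. -/
def beta (k : ℕ) : ℝ :=
  sSup {c : ℝ | c < 1 ∧
    Tendsto (fun D : ℝ => randomSetLaw
      {A : Set ℕ | k ≤ subsumMultiplicity (A ∩ {a : ℕ | D ^ c ≤ (a : ℝ) ∧ (a : ℝ) ≤ D})})
      atTop (𝓝 1)}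

/-- `η_* = liminf_{k → ∞} log k / log (1 / β_k)`. -/
def etaStar : ℝ :=
  liminf (fun k : ℕ => Real.log k / Real.log (1 / beta k)) atTop

/-- The law of `n_p`: `1` with probability `p / (p + 1)` and `p` with probability `1 / (p + 1)`. -/
def primeLaw (p : Nat.Primes) : Measure ℕ :=
  ENNReal.ofReal (((p : ℕ) : ℝ) / (((p : ℕ) : ℝ) + 1)) • Measure.dirac 1 +
    ENNReal.ofReal (1 / (((p : ℕ) : ℝ) + 1)) • Measure.dirac (p : ℕ)

instance primeLaw_isProbabilityMeasure (p : Nat.Primes) : IsProbabilityMeasure (primeLaw p) := by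
  refine ⟨?_⟩
  have h : (0 : ℝ) < ((p : ℕ) : ℝ) + 1 := by positivity
  simp only [primeLaw, Measure.coe_add, Measure.coe_smul, Pi.add_apply, Pi.smul_apply,
    measure_univ, smul_eq_mul, mul_one]
  rw [← ENNReal.ofReal_add (by positivity) (by positivity), ← add_div, div_self h.ne']
  simp

/-- The joint law of the independent random variables `n_p`, one for each prime `p`; the `n_p` are
the coordinates of a sample point. -/
def sampleLaw : Measure (Nat.Primes → ℕ) := Measure.infinitePi primeLaw

instance sampleLaw_isProbabilityMeasure : IsProbabilityMeasure sampleLaw :=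
  inferInstanceAs (IsProbabilityMeasure (Measure.infinitePi primeLaw))

theorem finite_primes_lt (x : ℝ) : {p : Nat.Primes | ((p : ℕ) : ℝ) < x}.Finite := by
  refine Set.Finite.of_finite_image (f := fun p : Nat.Primes => (p : ℕ)) ?_ ?_
  · refine (Set.finite_lt_nat ⌈x⌉₊).subset ?_
    rintro _ ⟨p, hp, rfl⟩
    exact Nat.lt_ceil.mpr hp
  · intro p _ q _ h
    exact Nat.Primes.coe_nat_injective h

/-- The finite set of primes `p < x`. -/
def primesLT (x : ℝ) : Finset Nat.Primes := (finite_primes_lt x).toFinset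

/-- The random integer `n_{<x} = ∏_{p < x} n_p`. -/
def randomInt (x : ℝ) (n : Nat.Primes → ℕ) : ℕ := ∏ p ∈ primesLT x, n p

end ErdosHooley

end

/-! Put T = Log₂ x, so that x = exp(exp T) as soon as T > 1. For 0 ≤ t ≤ T cut the primes at y =
exp(exp t). Suppose that the primes of n in [y, x) have M subproducts whose logarithms agree up to
O(log y), and that the part of n below y has logarithm at most log T · log y. Multiplying these M
subproducts by all divisors of the small part puts M · 2^ω(n_{<y}) divisors into a logarithmic
window of length O(log T · log y). By pigeonhole Δ(n) ≫ M · 2^ω(n_{<y}) / (log T · log y); this is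
`mul_two_pow_le_mul_hooleyDelta`.

The clusters come from the random set 𝐀. With s = log y / (2T), Mertens' theorem shows that some
prime of n has ⌊log p / s⌋ = a with probability close to 1/a, independently in a, so up to small
total variation the occupied blocks form 𝐀 (`exists_pr_cluster_ge_sub`). Equal subsums of 𝐀 become
sums of log p that agree up to s|S| ≤ log y when |S| ≤ 2T. For c slightly below β_k, the set 𝐀 ∩
[D^c, D] has k equal subsums with high probability. About log T / log(1/c) disjoint such windows are
available, and multiplicities multiply, so M = T^(log k / log(1/c) - o(1))
(`exists_pr_equalSums_natsIn_ge`). A suitable k gives M = T^κ with κ as close to η_* as desired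
(`exists_cluster_exponent`).

The factor 2^ω(n_{<y}) / log y is absorbed by a change of measure (`exists_bern_two_pow_ge`): primes
below y receive weight 2/(p+2), the others keep 1/(p+1). Under the tilted measure ω(n) has mean near
2t + (T - t) = T + t, so for t = r - T + O(√T) the event ω(n) = r still has probability ≫ 1/√T
(`exists_pr_tiltedWeight_ge`).

A single t therefore loses a factor √T. This is recovered up to a logarithm by summing over a grid
of about √T / log T values of t near r - T. The sum is legitimate because the contributions can be
restricted to disjoint events: under the tilt at t the score t' ↦ ω(n_{<exp exp t'}) log 2 - t'
drifts upwards before t and downwards after t, since 2 log 2 > 1 > log 2, so with high probability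
its strict maximum over the grid is at t. The outcome is T^κ / (log T)², proved in
`exists_bern_hooleyDelta_ge`. The second claim follows by adding this over ≫ T values of r. -/

namespace ErdosHooley

/-! ### Random subsets of a finite set with independent memberships -/

section RandomSubset

variable {α β : Type*} [DecidableEq α] [DecidableEq β]

/-- The expectation of `f S`, where `S` is the random subset of `U` that contains each `a ∈ U`
independently with probability `q a`. -/
noncomputable def bern (U : Finset α) (q : α → ℝ) (f : Finset α → ℝ) : ℝ :=
  ∑ S ∈ U.powerset, ((∏ a ∈ S, q a) * ∏ a ∈ U \ S, (1 - q a)) * f S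

open Classical in
/-- The probability that the random subset of `U` satisfies `P`. -/
noncomputable def pr (U : Finset α) (q : α → ℝ) (P : Finset α → Prop) : ℝ :=
  bern U q (fun S => if P S then 1 else 0)

theorem bern_empty (q : α → ℝ) (f : Finset α → ℝ) : bern ∅ q f = f ∅ := by
  simp [bern]

/-- Conditioning on whether `a` is chosen. This recursion drives the inductions over the ground set.
-/
theorem bern_insert {U : Finset α} {a : α} (ha : a ∉ U) (q : α → ℝ) (f : Finset α → ℝ) :
    bern (insert a U) q f =
      (1 - q a) * bern U q f + q a * bern U q (fun S => f (insert a S)) := by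
  unfold bern
  rw [Finset.sum_powerset_insert ha, Finset.mul_sum, Finset.mul_sum]
  congr 1
  · refine Finset.sum_congr rfl fun S hS => ?_
    have haS : a ∉ S := fun h => ha (Finset.mem_powerset.1 hS h)
    rw [Finset.insert_sdiff_of_notMem _ haS, Finset.prod_insert (by simp [ha])]
    ring
  · refine Finset.sum_congr rfl fun S hS => ?_
    have haS : a ∉ S := fun h => ha (Finset.mem_powerset.1 hS h)
    rw [Finset.insert_sdiff_insert, Finset.prod_insert haS,
      Finset.sdiff_insert_of_notMem ha]
    ring

theorem bern_congr {U : Finset α} {q : α → ℝ} {f g : Finset α → ℝ}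
    (h : ∀ S ⊆ U, f S = g S) : bern U q f = bern U q g :=
  Finset.sum_congr rfl fun S hS => by rw [h S (Finset.mem_powerset.1 hS)]

theorem bern_congr_weight {U : Finset α} {q q' : α → ℝ} (f : Finset α → ℝ)
    (h : ∀ a ∈ U, q a = q' a) : bern U q f = bern U q' f := by
  refine Finset.sum_congr rfl fun S hS => ?_
  have e1 : ∏ a ∈ S, q a = ∏ a ∈ S, q' a :=
    Finset.prod_congr rfl fun a ha => h a (Finset.mem_powerset.1 hS ha)
  have e2 : ∏ a ∈ U \ S, (1 - q a) = ∏ a ∈ U \ S, (1 - q' a) :=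
    Finset.prod_congr rfl fun a ha => by rw [h a (Finset.sdiff_subset ha)]
  rw [e1, e2]

theorem bern_add (U : Finset α) (q : α → ℝ) (f g : Finset α → ℝ) :
    bern U q (fun S => f S + g S) = bern U q f + bern U q g := by
  simp only [bern, mul_add, Finset.sum_add_distrib]

theorem bern_sub (U : Finset α) (q : α → ℝ) (f g : Finset α → ℝ) :
    bern U q (fun S => f S - g S) = bern U q f - bern U q g := by
  simp only [bern, mul_sub, Finset.sum_sub_distrib]

theorem bern_const_mul (U : Finset α) (q : α → ℝ) (c : ℝ) (f : Finset α → ℝ) :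
    bern U q (fun S => c * f S) = c * bern U q f := by
  simp only [bern, Finset.mul_sum]
  exact Finset.sum_congr rfl fun S _ => by ring

theorem bern_sum {ι : Type*} (s : Finset ι) (U : Finset α) (q : α → ℝ)
    (f : ι → Finset α → ℝ) :
    bern U q (fun S => ∑ i ∈ s, f i S) = ∑ i ∈ s, bern U q (f i) := by
  simp only [bern, Finset.mul_sum]
  exact Finset.sum_comm

/-- The moment generating function of an additive statistic. -/
theorem bern_prod (U : Finset α) (q g : α → ℝ) :
    bern U q (fun S => ∏ a ∈ S, g a) = ∏ a ∈ U, (1 - q a + q a * g a) := by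
  induction U using Finset.induction_on with
  | empty => simp [bern_empty]
  | insert a U ha ih =>
    rw [bern_insert ha, Finset.prod_insert ha, ← ih, add_mul, mul_assoc, ← bern_const_mul (c := g a)]
    congr 2
    refine bern_congr fun S hS => ?_
    rw [Finset.prod_insert fun h => ha (hS h)]

theorem bern_one (U : Finset α) (q : α → ℝ) : bern U q (fun _ => 1) = 1 := by
  have := bern_prod U q (fun _ => 1)
  simpa using this

theorem bern_const (U : Finset α) (q : α → ℝ) (c : ℝ) : bern U q (fun _ => c) = c := by
  have := bern_const_mul U q c (fun _ => 1)
  simpa [bern_one] using this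

theorem bern_mono {U : Finset α} {q : α → ℝ} (h0 : ∀ a ∈ U, 0 ≤ q a) (h1 : ∀ a ∈ U, q a ≤ 1)
    {f g : Finset α → ℝ} (h : ∀ S ⊆ U, f S ≤ g S) : bern U q f ≤ bern U q g := by
  refine Finset.sum_le_sum fun S hS => ?_
  have hS := Finset.mem_powerset.1 hS
  refine mul_le_mul_of_nonneg_left (h S hS) (mul_nonneg ?_ ?_)
  · exact Finset.prod_nonneg fun a ha => h0 a (hS ha)
  · exact Finset.prod_nonneg fun a ha => sub_nonneg.2 (h1 a (Finset.sdiff_subset ha))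

theorem bern_nonneg {U : Finset α} {q : α → ℝ} (h0 : ∀ a ∈ U, 0 ≤ q a) (h1 : ∀ a ∈ U, q a ≤ 1)
    {f : Finset α → ℝ} (h : ∀ S ⊆ U, 0 ≤ f S) : 0 ≤ bern U q f := by
  rw [← bern_const U q 0]
  exact bern_mono h0 h1 h

/-- Independence of the traces on disjoint sets, in the form of Fubini's theorem. -/
theorem bern_union {U V : Finset α} (h : Disjoint U V) (q : α → ℝ) (f : Finset α → ℝ) :
    bern (U ∪ V) q f = bern U q (fun S => bern V q (fun S' => f (S ∪ S'))) := by
  induction U using Finset.induction_on generalizing f with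
  | empty => simp [bern_empty]
  | insert a U ha ih =>
    rw [Finset.disjoint_insert_left] at h
    rw [Finset.insert_union, bern_insert (by simp [ha, h.1]), bern_insert ha, ih h.2, ih h.2]
    simp only [Finset.insert_union]

/-- The restriction of a random subset to `W` is a random subset of `W`. -/
theorem bern_inter {U W : Finset α} (h : W ⊆ U) (q : α → ℝ) (f : Finset α → ℝ) :
    bern U q (fun S => f (S ∩ W)) = bern W q f := by
  conv_lhs => rw [← Finset.union_sdiff_of_subset h]
  rw [bern_union Finset.disjoint_sdiff]
  refine bern_congr fun S hS => ?_
  rw [← bern_const (U \ W) q (f S)]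
  refine bern_congr fun S' hS' => ?_
  congr 1
  ext x
  simp only [Finset.mem_inter, Finset.mem_union]
  constructor
  · rintro ⟨h | h, hW⟩
    · exact h
    · exact absurd hW (Finset.mem_sdiff.1 (hS' h)).2
  · exact fun hx => ⟨Or.inl hx, hS hx⟩

/-- Exponential tilting. -/
theorem bern_tilt (U : Finset α) (q g : α → ℝ) (hne : ∀ a ∈ U, 1 - q a + q a * g a ≠ 0)
    (f : Finset α → ℝ) :
    bern U q (fun S => (∏ a ∈ S, g a) * f S) = (∏ a ∈ U, (1 - q a + q a * g a)) *
      bern U (fun a => q a * g a / (1 - q a + q a * g a)) f := by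
  induction U using Finset.induction_on generalizing f with
  | empty => simp [bern_empty]
  | insert a U ha ih =>
    have hne' : ∀ b ∈ U, 1 - q b + q b * g b ≠ 0 := fun b hb =>
      hne b (Finset.mem_insert_of_mem hb)
    have hna := hne a (Finset.mem_insert_self _ _)
    rw [bern_insert ha, bern_insert ha, Finset.prod_insert ha, ih hne']
    have : bern U q (fun S => (∏ b ∈ insert a S, g b) * f (insert a S)) =
        g a * bern U q (fun S => (∏ b ∈ S, g b) * f (insert a S)) := by
      rw [← bern_const_mul]
      refine bern_congr fun S hS => ?_
      rw [Finset.prod_insert fun h => ha (hS h)]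
      ring
    rw [this, ih hne']
    field_simp
    ring

/-- Total variation bound for two random subsets. -/
theorem abs_bern_sub_bern_le (U : Finset α) {q q' : α → ℝ} (h0 : ∀ a ∈ U, 0 ≤ q a)
    (h1 : ∀ a ∈ U, q a ≤ 1) (h0' : ∀ a ∈ U, 0 ≤ q' a) (h1' : ∀ a ∈ U, q' a ≤ 1)
    (f : Finset α → ℝ) (hf0 : ∀ S, 0 ≤ f S) (hf1 : ∀ S, f S ≤ 1) :
    |bern U q f - bern U q' f| ≤ ∑ a ∈ U, |q a - q' a| := by
  induction U using Finset.induction_on generalizing f with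
  | empty => simp [bern_empty]
  | insert a U ha ih =>
    simp only [Finset.mem_insert, forall_eq_or_imp] at h0 h1 h0' h1'
    have i1 := ih h0.2 h1.2 h0'.2 h1'.2 f hf0 hf1
    have i2 := ih h0.2 h1.2 h0'.2 h1'.2 (fun S => f (insert a S)) (fun S => hf0 _) (fun S => hf1 _)
    have b1 : 0 ≤ bern U q' f := bern_nonneg h0'.2 h1'.2 fun S _ => hf0 S
    have b2 : 0 ≤ bern U q' (fun S => f (insert a S)) := bern_nonneg h0'.2 h1'.2 fun S _ => hf0 _
    have b3 : bern U q' f ≤ 1 := by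
      rw [← bern_const U q' 1]; exact bern_mono h0'.2 h1'.2 fun S _ => hf1 S
    have b4 : bern U q' (fun S => f (insert a S)) ≤ 1 := by
      rw [← bern_const U q' 1]; exact bern_mono h0'.2 h1'.2 fun S _ => hf1 _
    rw [bern_insert ha, bern_insert ha, Finset.sum_insert ha]
    set X := bern U q f
    set Y := bern U q (fun S => f (insert a S))
    set X' := bern U q' f
    set Y' := bern U q' (fun S => f (insert a S))
    -- The first two terms average the inductive differences. The last pays for changing the law of
    -- `a` alone, at most `|q a - q' a|` because `X'` and `Y'` lie in [0, 1].
    have e : (1 - q a) * X + q a * Y - ((1 - q' a) * X' + q' a * Y') =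
        (1 - q a) * (X - X') + q a * (Y - Y') + (q a - q' a) * (Y' - X') := by ring
    rw [e]
    have t1 : |(1 - q a) * (X - X')| ≤ (1 - q a) * ∑ a ∈ U, |q a - q' a| := by
      rw [abs_mul, abs_of_nonneg (sub_nonneg.2 h1.1)]
      exact mul_le_mul_of_nonneg_left i1 (sub_nonneg.2 h1.1)
    have t2 : |q a * (Y - Y')| ≤ q a * ∑ a ∈ U, |q a - q' a| := by
      rw [abs_mul, abs_of_nonneg h0.1]
      exact mul_le_mul_of_nonneg_left i2 h0.1
    have t3 : |(q a - q' a) * (Y' - X')| ≤ |q a - q' a| := by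
      rw [abs_mul]
      exact mul_le_of_le_one_right (abs_nonneg _) (abs_le.2 ⟨by linarith, by linarith⟩)
    have t4 := abs_add_three ((1 - q a) * (X - X')) (q a * (Y - Y')) ((q a - q' a) * (Y' - X'))
    linarith

theorem bern_nonempty (U : Finset α) (q : α → ℝ) (X Y : ℝ) :
    bern U q (fun S => if S.Nonempty then Y else X) =
      (1 - (1 - ∏ a ∈ U, (1 - q a))) * X + (1 - ∏ a ∈ U, (1 - q a)) * Y := by
  -- `0 ^ |S|` is the indicator of the empty set, so `bern_prod` evaluates its expectation.
  have h : ∀ S ⊆ U, (if S.Nonempty then Y else X) = Y + (X - Y) * ∏ _a ∈ S, (0 : ℝ) := by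
    intro S _
    rcases S.eq_empty_or_nonempty with rfl | hS
    · simp
    · rw [Finset.prod_const, zero_pow (by simpa using hS.ne_empty)]
      simp [hS]
  rw [bern_congr h, bern_add, bern_const, bern_const_mul, bern_prod]
  simp only [mul_zero, add_zero]
  ring

/-- The set of blocks `I b` that meet a random subset is itself a random subset. -/
theorem bern_biUnion (J : Finset β) (I : β → Finset α)
    (hI : (J : Set β).PairwiseDisjoint I) (q : α → ℝ) (f : Finset β → ℝ) :
    bern (J.biUnion I) q (fun S => f (J.filter fun b => (S ∩ I b).Nonempty)) =
      bern J (fun b => 1 - ∏ a ∈ I b, (1 - q a)) f := by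
  induction J using Finset.induction_on generalizing f with
  | empty => simp [bern_empty]
  | insert b J hb ih =>
    rw [Finset.coe_insert, Set.pairwiseDisjoint_insert_of_notMem (by simpa using hb)] at hI
    have hd : Disjoint (I b) (J.biUnion I) := by
      rw [Finset.disjoint_biUnion_right]
      exact fun c hc => hI.2 c hc
    rw [Finset.biUnion_insert, bern_union hd, bern_insert hb, ← ih hI.1, ← ih hI.1,
      ← bern_nonempty]
    refine bern_congr fun S hS => ?_
    have key : ∀ S' ⊆ J.biUnion I,
        ((insert b J).filter fun c => ((S ∪ S') ∩ I c).Nonempty) =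
          if S.Nonempty then insert b (J.filter fun c => (S' ∩ I c).Nonempty)
          else J.filter fun c => (S' ∩ I c).Nonempty := by
      intro S' hS'
      have e1 : (S ∪ S') ∩ I b = S := by
        rw [Finset.union_inter_distrib_right, Finset.inter_eq_left.2 hS,
          (Finset.disjoint_iff_inter_eq_empty.1 (hd.mono_right hS').symm), Finset.union_empty]
      have e2 : J.filter (fun c => ((S ∪ S') ∩ I c).Nonempty) =
          J.filter fun c => (S' ∩ I c).Nonempty := by
        refine Finset.filter_congr fun c hc => ?_
        rw [Finset.union_inter_distrib_right, (Finset.disjoint_iff_inter_eq_empty.1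
          ((hI.2 c hc).mono_left hS)), Finset.empty_union]
      rw [Finset.filter_insert, e1, e2]
    split_ifs with hne
    · refine bern_congr fun S' hS' => ?_
      rw [key S' hS', if_pos hne]
    · refine bern_congr fun S' hS' => ?_
      rw [key S' hS', if_neg hne]

/-- The variance of the cardinality of a random subset. -/
theorem bern_card_sub_sq (U : Finset α) (q : α → ℝ) :
    bern U q (fun S => ((S.card : ℝ) - ∑ a ∈ U, q a) ^ 2) = ∑ a ∈ U, q a * (1 - q a) := by
  induction U using Finset.induction_on with
  | empty => simp [bern_empty]
  | insert a U ha ih =>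
    -- For `z = |S| - ∑ q` and `q = q a` one has `(1 - q)(z - q)² + q(z + 1 - q)² = z² + q(1 - q)`:
    -- the cross terms cancel pointwise.
    rw [bern_insert ha, Finset.sum_insert ha, Finset.sum_insert ha, ← ih,
      ← bern_const_mul, ← bern_const_mul, ← bern_add,
      ← bern_const U q (q a * (1 - q a)), ← bern_add]
    refine bern_congr fun S hS => ?_
    rw [Finset.card_insert_of_notMem fun h => ha (hS h)]
    push_cast
    ring

theorem bern_map (U : Finset α) (e : α ↪ β) (q : β → ℝ) (f : Finset β → ℝ) :
    bern (U.map e) q f = bern U (fun a => q (e a)) (fun S => f (S.map e)) := by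
  induction U using Finset.induction_on generalizing f with
  | empty => simp [bern_empty]
  | insert a U ha ih =>
    rw [Finset.map_insert, bern_insert (by simpa using ha), bern_insert ha, ih, ih]
    simp only [Finset.map_insert]

variable {U : Finset α} {q : α → ℝ}

theorem pr_mono (h0 : ∀ a ∈ U, 0 ≤ q a) (h1 : ∀ a ∈ U, q a ≤ 1) {P Q : Finset α → Prop}
    (h : ∀ S ⊆ U, P S → Q S) : pr U q P ≤ pr U q Q := by
  refine bern_mono h0 h1 fun S hS => ?_
  by_cases hP : P S
  · rw [if_pos hP, if_pos (h S hS hP)]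
  · rw [if_neg hP]; split_ifs <;> norm_num

theorem pr_not (P : Finset α → Prop) : pr U q (fun S => ¬ P S) = 1 - pr U q P := by
  classical
  have h := bern_sub U q (fun _ => 1) (fun S => if P S then 1 else 0)
  rw [bern_const] at h
  rw [pr, pr, ← h]
  refine bern_congr fun S _ => ?_
  by_cases hP : P S <;> simp [hP]

theorem pr_or_le (h0 : ∀ a ∈ U, 0 ≤ q a) (h1 : ∀ a ∈ U, q a ≤ 1) (P Q : Finset α → Prop) :
    pr U q (fun S => P S ∨ Q S) ≤ pr U q P + pr U q Q := by
  rw [pr, pr, pr, ← bern_add]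
  refine bern_mono h0 h1 fun S _ => ?_
  by_cases hP : P S <;> by_cases hQ : Q S <;> simp [hP, hQ]

theorem pr_exists_le {ι : Type*} (s : Finset ι) (h0 : ∀ a ∈ U, 0 ≤ q a) (h1 : ∀ a ∈ U, q a ≤ 1)
    (P : ι → Finset α → Prop) :
    pr U q (fun S => ∃ i ∈ s, P i S) ≤ ∑ i ∈ s, pr U q (P i) := by
  classical
  simp only [pr]
  rw [← bern_sum]
  refine bern_mono h0 h1 fun S _ => ?_
  have hn : ∀ i ∈ s, (0 : ℝ) ≤ if P i S then 1 else 0 := fun i _ => by split_ifs <;> norm_num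
  split_ifs with h
  · obtain ⟨i, hi, hP⟩ := h
    have := Finset.single_le_sum hn hi
    rwa [if_pos hP] at this
  · exact Finset.sum_nonneg hn

theorem pr_sub_le_pr_and_not (h0 : ∀ a ∈ U, 0 ≤ q a) (h1 : ∀ a ∈ U, q a ≤ 1)
    (P Q : Finset α → Prop) :
    pr U q P - pr U q Q ≤ pr U q (fun S => P S ∧ ¬ Q S) := by
  rw [pr, pr, pr, ← bern_sub]
  refine bern_mono h0 h1 fun S _ => ?_
  by_cases hP : P S <;> by_cases hQ : Q S <;> simp [hP, hQ]

/-- Markov's inequality. -/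
theorem pr_le_bern_div (h0 : ∀ a ∈ U, 0 ≤ q a) (h1 : ∀ a ∈ U, q a ≤ 1) {P : Finset α → Prop}
    {f : Finset α → ℝ} (hf : ∀ S ⊆ U, 0 ≤ f S) {t : ℝ} (ht : 0 < t) (h : ∀ S ⊆ U, P S → t ≤ f S) :
    pr U q P ≤ bern U q f / t := by
  rw [div_eq_inv_mul, ← bern_const_mul]
  refine bern_mono h0 h1 fun S hS => ?_
  by_cases hP : P S
  · rw [if_pos hP, inv_mul_eq_div, one_le_div ht]
    exact h S hS hP
  · rw [if_neg hP]
    exact mul_nonneg (inv_nonneg.2 ht.le) (hf S hS)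

end RandomSubset

/-! ### Mertens' theorems for sums over primes -/

section Mertens

open Nat (primesLE)

theorem log_factorial_eq_sum_primesLE (n : ℕ) : Real.log (n.factorial : ℝ) =
    ∑ p ∈ primesLE n, (n.factorial.factorization p : ℝ) * Real.log p := by
  rw [Real.log_nat_eq_sum_factorization, Finsupp.sum]
  refine Finset.sum_subset ?_ ?_
  · intro p hp
    rw [Nat.support_factorization, Nat.mem_primeFactors] at hp
    rw [Nat.mem_primesLE]
    exact ⟨(hp.1.dvd_factorial).1 hp.2.1, hp.1⟩
  · intro p _ hp
    rw [Finsupp.notMem_support_iff.1 hp]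
    simp

theorem div_le_factorization_factorial {p n : ℕ} (hp : p.Prime) (hpn : p ≤ n) :
    n / p ≤ n.factorial.factorization p := by
  rw [Nat.factorization_factorial hp (Nat.lt_succ_self _)]
  have h1 : 1 ∈ Finset.Ico 1 (Nat.log p n).succ := by
    rw [Finset.mem_Ico]
    exact ⟨le_rfl, Nat.succ_lt_succ (Nat.log_pos hp.one_lt hpn)⟩
  simpa using Finset.single_le_sum (f := fun i => n / p ^ i) (fun i _ => Nat.zero_le _) h1

/-- Upper half of Mertens' first theorem: compare `n! ≤ n ^ n` with the first term ⌊n/p⌋ of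
Legendre's formula. Rounding costs at most θ(n) ≤ n log 4 in total. -/
theorem sum_log_div_primesLE_le {n : ℕ} (hn : 1 ≤ n) :
    ∑ p ∈ primesLE n, Real.log p / p ≤ Real.log n + Real.log 4 := by
  have hn0 : (0 : ℝ) < n := by exact_mod_cast hn
  have h1 : ∑ p ∈ primesLE n, ((n : ℝ) / p - 1) * Real.log p ≤ n * Real.log n := by
    calc ∑ p ∈ primesLE n, ((n : ℝ) / p - 1) * Real.log p
        ≤ ∑ p ∈ primesLE n, (n.factorial.factorization p : ℝ) * Real.log p := by
          refine Finset.sum_le_sum fun p hp => ?_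
          rw [Nat.mem_primesLE] at hp
          refine mul_le_mul_of_nonneg_right ?_ (Real.log_natCast_nonneg p)
          have h2 : ((n / p : ℕ) : ℝ) ≤ n.factorial.factorization p := by
            exact_mod_cast div_le_factorization_factorial hp.2 hp.1
          have h3 : (n : ℝ) / p < ((n / p : ℕ) : ℝ) + 1 := by
            rw [← Nat.floor_div_eq_div (K := ℝ)]
            exact Nat.lt_floor_add_one _
          linarith
      _ = Real.log (n.factorial : ℝ) := (log_factorial_eq_sum_primesLE n).symm
      _ ≤ Real.log ((n : ℝ) ^ n) := by
          refine Real.log_le_log (by exact_mod_cast n.factorial_pos) ?_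
          exact_mod_cast n.factorial_le_pow
      _ = n * Real.log n := by rw [Real.log_pow]
  have h2 : ∑ p ∈ primesLE n, Real.log p ≤ Real.log 4 * n := by
    rw [← Chebyshev.theta_eq_sum_primesLE_log]
    exact Chebyshev.theta_le_log4_mul_x hn0.le
  have h3 : ∑ p ∈ primesLE n, ((n : ℝ) / p - 1) * Real.log p =
      n * (∑ p ∈ primesLE n, Real.log p / p) - ∑ p ∈ primesLE n, Real.log p := by
    rw [Finset.mul_sum, ← Finset.sum_sub_distrib]
    exact Finset.sum_congr rfl fun p _ => by ring
  refine le_of_mul_le_mul_left ?_ hn0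
  linarith

/-- Lower half of Mertens' first theorem: Stirling bounds log n! below by n log n - n, and
Legendre's formula bounds the exponent of p by n/(p - 1). The excess over n/p is O(n/p²), and log p
/ p² is summable after log p ≪ √p. -/
theorem exists_le_sum_log_div_primesLE : ∃ C : ℝ, 0 ≤ C ∧ ∀ n : ℕ, 1 ≤ n →
    Real.log n - C ≤ ∑ p ∈ primesLE n, Real.log p / p := by
  have hs : Summable fun n : ℕ => 1 / (n : ℝ) ^ (3 / 2 : ℝ) :=
    Real.summable_one_div_nat_rpow.2 (by norm_num)
  refine ⟨1 + 4 * ∑' n : ℕ, 1 / (n : ℝ) ^ (3 / 2 : ℝ), ?_, fun n hn => ?_⟩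
  · have : 0 ≤ ∑' n : ℕ, 1 / (n : ℝ) ^ (3 / 2 : ℝ) := tsum_nonneg fun n => by positivity
    linarith
  have hn0 : (0 : ℝ) < n := by exact_mod_cast hn
  have h1 : (n : ℝ) * Real.log n - n ≤ Real.log (n.factorial : ℝ) := by
    have := Stirling.le_log_factorial_stirling (n := n) (by omega)
    have h2 := Real.log_natCast_nonneg n
    have h3 : 0 ≤ Real.log (2 * Real.pi) := Real.log_nonneg (by linarith [Real.pi_gt_three])
    linarith
  have h2 : Real.log (n.factorial : ℝ) ≤
      ∑ p ∈ primesLE n, (n * (Real.log p / p) + n * (4 * (1 / (p : ℝ) ^ (3 / 2 : ℝ)))) := by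
    rw [log_factorial_eq_sum_primesLE]
    refine Finset.sum_le_sum fun p hp => ?_
    rw [Nat.mem_primesLE] at hp
    have hp2 : (2 : ℝ) ≤ p := by exact_mod_cast hp.2.two_le
    have hp0 : (0 : ℝ) < p := by linarith
    have h3 : (n.factorial.factorization p : ℝ) ≤ n / ((p : ℝ) - 1) := by
      have h4 := Nat.factorization_factorial_le_div_pred hp.2 n
      have h5 : ((n / (p - 1) : ℕ) : ℝ) ≤ (n : ℝ) / ((p - 1 : ℕ) : ℝ) := Nat.cast_div_le
      rw [Nat.cast_sub hp.2.one_lt.le, Nat.cast_one] at h5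
      exact le_trans (by exact_mod_cast h4) h5
    have h4 : (n : ℝ) / ((p : ℝ) - 1) ≤ n * (1 / p + 2 / (p : ℝ) ^ 2) := by
      rw [div_eq_mul_one_div]
      refine mul_le_mul_of_nonneg_left ?_ hn0.le
      rw [div_add_div _ _ hp0.ne' (by positivity), div_le_div_iff₀ (by linarith) (by positivity)]
      nlinarith
    have h5 : Real.log p ≤ 2 * (p : ℝ) ^ (1 / 2 : ℝ) := by
      have := Real.log_le_rpow_div hp0.le (show (0 : ℝ) < 1 / 2 by norm_num)
      linarith
    have h6 : (p : ℝ) ^ (1 / 2 : ℝ) / (p : ℝ) ^ 2 = 1 / (p : ℝ) ^ (3 / 2 : ℝ) := by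
      rw [← Real.rpow_natCast, ← Real.rpow_sub hp0, one_div ((p : ℝ) ^ (3 / 2 : ℝ)),
        ← Real.rpow_neg hp0.le]
      norm_num
    calc (n.factorial.factorization p : ℝ) * Real.log p
        ≤ (n * (1 / p + 2 / (p : ℝ) ^ 2)) * Real.log p :=
          mul_le_mul_of_nonneg_right (h3.trans h4) (Real.log_natCast_nonneg p)
      _ = n * (Real.log p / p) + n * (2 / (p : ℝ) ^ 2) * Real.log p := by ring
      _ ≤ n * (Real.log p / p) + n * (2 / (p : ℝ) ^ 2) * (2 * (p : ℝ) ^ (1 / 2 : ℝ)) := by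
          gcongr
      _ = _ := by rw [← h6]; ring
  rw [Finset.sum_add_distrib, ← Finset.mul_sum, ← Finset.mul_sum, ← Finset.mul_sum] at h2
  have h3 : ∑ p ∈ primesLE n, 1 / (p : ℝ) ^ (3 / 2 : ℝ) ≤ ∑' n : ℕ, 1 / (n : ℝ) ^ (3 / 2 : ℝ) :=
    hs.sum_le_tsum _ fun n _ => by positivity
  refine le_of_mul_le_mul_left ?_ hn0
  nlinarith

theorem sum_primesLE_succ (f : ℕ → ℝ) (n : ℕ) : ∑ p ∈ primesLE (n + 1), f p =
    ∑ p ∈ primesLE n, f p + if (n + 1).Prime then f (n + 1) else 0 := by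
  rw [Nat.primesLE_succ]
  split_ifs with h
  · rw [Finset.sum_insert (Nat.notMem_primesLE n), add_comm]
  · rw [add_zero]

/-- Mertens' second theorem for differences, with integer endpoints. -/
theorem exists_abs_sum_inv_primesLE_sub_le : ∃ C : ℝ, 0 ≤ C ∧ ∀ a n : ℕ, 2 ≤ a → a ≤ n →
    |∑ p ∈ primesLE n, 1 / (p : ℝ) - ∑ p ∈ primesLE a, 1 / (p : ℝ) -
      (Real.log (Real.log n) - Real.log (Real.log a))| ≤ C / Real.log a := by
  obtain ⟨C₁, hC₁, hlow⟩ := exists_le_sum_log_div_primesLE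
  set C := C₁ + Real.log 4 with hC
  have hl4 : 0 < Real.log 4 := Real.log_pos (by norm_num)
  have hC0 : 0 ≤ C := by linarith
  set E : ℕ → ℝ := fun n => ∑ p ∈ primesLE n, Real.log p / p - Real.log n with hE
  have hEb : ∀ n, 1 ≤ n → |E n| ≤ C := fun n hn => by
    have h1 := hlow n hn
    have h2 := sum_log_div_primesLE_le hn
    rw [abs_le]
    constructor <;> simp only [hE] <;> linarith
  refine ⟨2 * (C + 1) + C, by linarith, fun a n ha han => ?_⟩
  have hla : 0 < Real.log a := Real.log_pos (by exact_mod_cast ha)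
  -- Abel summation carried out as an induction on n, with a telescoping error. In the constant, `C`
  -- bounds `E n` times the decrement of 1/log, and 1 pays for replacing the increment of log log by
  -- `(y - x) / y`.
  have key : |∑ p ∈ primesLE n, 1 / (p : ℝ) - ∑ p ∈ primesLE a, 1 / (p : ℝ) -
      (Real.log (Real.log n) - Real.log (Real.log a)) - (E n / Real.log n - E a / Real.log a)| ≤
      (C + 1) * (1 / Real.log a - 1 / Real.log n) := by
    induction n, han using Nat.le_induction with
    | base => simp
    | succ n han ih =>
      have hn2 : 2 ≤ n := ha.trans han
      have hn0 : (0 : ℝ) < n := by exact_mod_cast (by omega : 0 < n)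
      have hln : 0 < Real.log n := Real.log_pos (by exact_mod_cast hn2)
      have hlt : Real.log n < Real.log ((n + 1 : ℕ) : ℝ) :=
        Real.log_lt_log hn0 (by push_cast; linarith)
      set x := Real.log n
      set y := Real.log ((n + 1 : ℕ) : ℝ) with hy
      have hy0 : 0 < y := hln.trans hlt
      have hd : E (n + 1) - E n = (if (n + 1).Prime then 1 / ((n + 1 : ℕ) : ℝ) else 0) * y -
          (y - x) := by
        simp only [hE, sum_primesLE_succ (fun p => Real.log p / p)]
        split_ifs
        · rw [← hy]; ring
        · rw [← hy]; ring
      have hl1 : Real.log y - Real.log x ≤ (y - x) / x := by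
        rw [← Real.log_div hy0.ne' hln.ne']
        refine (Real.log_le_sub_one_of_pos (div_pos hy0 hln)).trans_eq ?_
        field_simp
      have hl2 : (y - x) / y ≤ Real.log y - Real.log x := by
        have := Real.log_le_sub_one_of_pos (div_pos hln hy0)
        rw [Real.log_div hln.ne' hy0.ne'] at this
        have h3 : (y - x) / y = 1 - x / y := by field_simp
        linarith
      have hxy : (y - x) / x - (y - x) / y ≤ 1 / x - 1 / y := by
        have e : (y - x) / x - (y - x) / y = (y - x) * (1 / x - 1 / y) := by ring
        rw [e]
        refine mul_le_of_le_one_left (sub_nonneg.2 (one_div_le_one_div_of_le hln hlt.le)) ?_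
        have e2 : y - x = Real.log (((n + 1 : ℕ) : ℝ) / n) := by
          rw [Real.log_div (by positivity) hn0.ne']
        rw [e2]
        refine (Real.log_le_sub_one_of_pos (by positivity)).trans ?_
        have : (1 : ℝ) ≤ n := by exact_mod_cast (by omega : 1 ≤ n)
        rw [sub_le_iff_le_add, div_le_iff₀ hn0]
        push_cast
        linarith
      have hEn := hEb n (by omega)
      rw [sum_primesLE_succ (fun p => 1 / (p : ℝ))]
      set w := (if (n + 1).Prime then 1 / ((n + 1 : ℕ) : ℝ) else 0)
      have hE1 : E (n + 1) / y = E n / y + w - (y - x) / y := by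
        have : E (n + 1) = E n + w * y - (y - x) := by linarith
        rw [this]
        field_simp
      rw [hE1]
      have hm : 0 ≤ 1 / x - 1 / y := sub_nonneg.2 (one_div_le_one_div_of_le hln hlt.le)
      have hEn' : |E n * (1 / x - 1 / y)| ≤ C * (1 / x - 1 / y) := by
        rw [abs_mul, abs_of_nonneg hm]
        exact mul_le_mul_of_nonneg_right hEn hm
      rw [abs_le] at ih hEn' ⊢
      have e3 : E n * (1 / x - 1 / y) = E n / x - E n / y := by ring
      rw [e3] at hEn'
      constructor <;> linarith [ih.1, ih.2, hEn'.1, hEn'.2]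
  have hn2 : 2 ≤ n := ha.trans han
  have hn0 : (0 : ℝ) < n := by exact_mod_cast (by omega : 0 < n)
  have hln : 0 < Real.log n := Real.log_pos (by exact_mod_cast hn2)
  have hle : Real.log a ≤ Real.log n :=
    Real.log_le_log (by exact_mod_cast (by omega : 0 < a)) (by exact_mod_cast han)
  have h1 : |E n / Real.log n| ≤ C * (1 / Real.log a) := by
    rw [abs_div, abs_of_pos hln, div_eq_mul_one_div]
    exact mul_le_mul (hEb n (by omega)) (one_div_le_one_div_of_le hla hle) (by positivity) hC0
  have h2 : |E a / Real.log a| ≤ C * (1 / Real.log a) := by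
    rw [abs_div, abs_of_pos hla, div_eq_mul_one_div]
    exact mul_le_mul_of_nonneg_right (hEb a (by omega)) (by positivity)
  have h3 : 0 ≤ 1 / Real.log n := by positivity
  have h4 : 0 ≤ 1 / Real.log a := by positivity
  rw [abs_le] at key h1 h2 ⊢
  have e : (2 * (C + 1) + C) / Real.log a = (2 * (C + 1) + C) * (1 / Real.log a) := by ring
  rw [e]
  constructor <;> nlinarith [key.1, key.2, h1.1, h1.2, h2.1, h2.2]

/-- The primes `p` with `u ≤ p < v`. -/
noncomputable def primesIn (u v : ℝ) : Finset ℕ :=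
  (Finset.range ⌈v⌉₊).filter fun p => p.Prime ∧ u ≤ (p : ℝ)

theorem mem_primesIn {u v : ℝ} {p : ℕ} :
    p ∈ primesIn u v ↔ p.Prime ∧ u ≤ (p : ℝ) ∧ (p : ℝ) < v := by
  rw [primesIn, Finset.mem_filter, Finset.mem_range, Nat.lt_ceil]
  tauto

theorem sum_primesIn_eq {u v : ℝ} (hu : 1 ≤ u) (huv : u ≤ v) (f : ℕ → ℝ) :
    ∑ p ∈ primesIn u v, f p =
      ∑ p ∈ primesLE (⌈v⌉₊ - 1), f p - ∑ p ∈ primesLE (⌈u⌉₊ - 1), f p := by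
  have hu0 : 0 < ⌈u⌉₊ := Nat.ceil_pos.2 (by linarith)
  have hv0 : 0 < ⌈v⌉₊ := Nat.ceil_pos.2 (by linarith)
  have hsub : primesLE (⌈u⌉₊ - 1) ⊆ primesLE (⌈v⌉₊ - 1) :=
    Nat.primesLE_mono (Nat.sub_le_sub_right (Nat.ceil_mono huv) 1)
  rw [← Finset.sum_sdiff hsub, add_sub_cancel_right]
  refine Finset.sum_congr ?_ fun _ _ => rfl
  ext p
  rw [mem_primesIn, Finset.mem_sdiff, Nat.mem_primesLE, Nat.mem_primesLE, ← Nat.lt_ceil,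
    ← Nat.ceil_le]
  constructor
  · rintro ⟨h1, h2, h3⟩
    exact ⟨⟨by omega, h1⟩, fun h => by omega⟩
  · rintro ⟨⟨h1, h2⟩, h3⟩
    refine ⟨h2, ?_, by omega⟩
    by_contra h
    exact h3 ⟨by omega, h2⟩

/-- The cost of moving a real endpoint `u` to the largest integer strictly below it, which is what
the condition p < u requires. -/
theorem abs_log_log_sub_log_log_ceil_le {u : ℝ} (hu : 3 ≤ u) :
    |Real.log (Real.log u) - Real.log (Real.log ((⌈u⌉₊ - 1 : ℕ) : ℝ))| ≤ 1 / Real.log u ∧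
      1 / Real.log ((⌈u⌉₊ - 1 : ℕ) : ℝ) ≤ 2 / Real.log u := by
  have hA3 : 3 ≤ ⌈u⌉₊ := by
    have := Nat.ceil_mono hu
    simpa using this
  set A := ⌈u⌉₊ - 1 with hA
  have hA2 : (2 : ℝ) ≤ A := by exact_mod_cast (by omega : 2 ≤ A)
  have hAu : (A : ℝ) < u := by rw [← Nat.lt_ceil]; omega
  have huA : u ≤ A + 1 := by
    have := Nat.le_ceil u
    have h2 : ⌈u⌉₊ = A + 1 := by omega
    rw [h2] at this
    exact_mod_cast this
  have hlA : 0 < Real.log A := Real.log_pos (by linarith)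
  have hlu : Real.log A ≤ Real.log u := Real.log_le_log (by linarith) hAu.le
  have hl0 : 0 < Real.log u := by linarith
  have h2 : Real.log u ≤ 2 * Real.log A := by
    have : Real.log u ≤ Real.log ((A : ℝ) ^ 2) := Real.log_le_log (by linarith) (by nlinarith)
    rwa [Real.log_pow] at this
  have h3 : 1 / Real.log (A : ℝ) ≤ 2 / Real.log u := by
    rw [div_le_div_iff₀ hlA hl0]; linarith
  refine ⟨?_, h3⟩
  rw [abs_of_nonneg (sub_nonneg.2 (Real.log_le_log hlA hlu)), ← Real.log_div hl0.ne' hlA.ne']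
  refine (Real.log_le_sub_one_of_pos (div_pos hl0 hlA)).trans ?_
  have h4 : Real.log u - Real.log A ≤ 1 / 2 := by
    rw [← Real.log_div (by linarith) (by linarith)]
    refine (Real.log_le_sub_one_of_pos (by positivity)).trans ?_
    rw [sub_le_iff_le_add, div_le_iff₀ (by linarith)]
    linarith
  calc Real.log u / Real.log A - 1 = (Real.log u - Real.log A) * (1 / Real.log A) := by
        field_simp
    _ ≤ 1 / 2 * (2 / Real.log u) :=
        mul_le_mul h4 h3 (by positivity) (by norm_num)
    _ = 1 / Real.log u := by ring

/-- Mertens' second theorem for differences. -/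
theorem exists_abs_sum_inv_primesIn_sub_le : ∃ C : ℝ, 1 ≤ C ∧ ∀ u v : ℝ, 3 ≤ u → u ≤ v →
    |∑ p ∈ primesIn u v, 1 / (p : ℝ) - (Real.log (Real.log v) - Real.log (Real.log u))| ≤
      C / Real.log u := by
  obtain ⟨C, hC, h⟩ := exists_abs_sum_inv_primesLE_sub_le
  refine ⟨2 * C + 2, by linarith, fun u v hu huv => ?_⟩
  have hu3 : 3 ≤ ⌈u⌉₊ := by simpa using Nat.ceil_mono hu
  have huv' := Nat.ceil_mono huv
  have h1 := h (⌈u⌉₊ - 1) (⌈v⌉₊ - 1) (by omega) (by omega)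
  obtain ⟨h2, h3⟩ := abs_log_log_sub_log_log_ceil_le hu
  obtain ⟨h4, -⟩ := abs_log_log_sub_log_log_ceil_le (hu.trans huv)
  have hlu : 0 < Real.log u := Real.log_pos (by linarith)
  have h5 : 1 / Real.log v ≤ 1 / Real.log u :=
    one_div_le_one_div_of_le hlu (Real.log_le_log (by linarith) huv)
  have h6 : C / Real.log ((⌈u⌉₊ - 1 : ℕ) : ℝ) ≤ 2 * C * (1 / Real.log u) := by
    rw [div_eq_mul_one_div]
    have := mul_le_mul_of_nonneg_left h3 hC
    calc _ ≤ _ := this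
      _ = _ := by ring
  have e : (2 * C + 2) / Real.log u = 2 * C * (1 / Real.log u) + 2 * (1 / Real.log u) := by ring
  rw [sum_primesIn_eq (by linarith) huv, e]
  rw [abs_le] at *
  constructor <;> linarith [h1.1, h1.2, h2.1, h2.2, h4.1, h4.2]

theorem sum_inv_sq_primesIn_le {u : ℝ} (hu : 2 ≤ u) (v : ℝ) :
    ∑ p ∈ primesIn u v, 1 / (p : ℝ) ^ 2 ≤ 1 / (u - 1) := by
  have key : ∀ k n : ℕ, 2 ≤ k → k ≤ n → ∑ p ∈ Finset.Ico k n, 1 / (p : ℝ) ^ 2 ≤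
      1 / ((k : ℝ) - 1) - 1 / ((n : ℝ) - 1) := by
    intro k n hk hkn
    induction n, hkn using Nat.le_induction with
    | base => simp
    | succ n hn ih =>
      rw [Finset.sum_Ico_succ_top hn]
      have h2 : (2 : ℝ) ≤ n := by exact_mod_cast hk.trans hn
      have : 1 / (n : ℝ) ^ 2 ≤ 1 / ((n : ℝ) - 1) - 1 / (((n + 1 : ℕ) : ℝ) - 1) := by
        push_cast
        rw [add_sub_cancel_right, div_sub_div _ _ (by linarith) (by linarith),
          div_le_div_iff₀ (by positivity) (by nlinarith)]
        nlinarith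
      linarith
  have hc2 : 2 ≤ ⌈u⌉₊ := by simpa using Nat.ceil_mono hu
  have hcu := Nat.le_ceil u
  rcases le_total ⌈u⌉₊ ⌈v⌉₊ with h | h
  · have h2 : (2 : ℝ) ≤ (⌈v⌉₊ : ℝ) := by exact_mod_cast hc2.trans h
    calc ∑ p ∈ primesIn u v, 1 / (p : ℝ) ^ 2
        ≤ ∑ p ∈ Finset.Ico ⌈u⌉₊ ⌈v⌉₊, 1 / (p : ℝ) ^ 2 := by
          refine Finset.sum_le_sum_of_subset_of_nonneg (fun p hp => ?_) fun _ _ _ => by positivity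
          rw [mem_primesIn] at hp
          rw [Finset.mem_Ico, Nat.ceil_le, Nat.lt_ceil]
          exact hp.2
      _ ≤ 1 / ((⌈u⌉₊ : ℝ) - 1) - 1 / ((⌈v⌉₊ : ℝ) - 1) := key _ _ hc2 h
      _ ≤ 1 / ((⌈u⌉₊ : ℝ) - 1) := by
          have : 0 ≤ 1 / ((⌈v⌉₊ : ℝ) - 1) := div_nonneg zero_le_one (by linarith)
          linarith
      _ ≤ 1 / (u - 1) := one_div_le_one_div_of_le (by linarith) (by linarith)
  · have : primesIn u v = ∅ := by
      rw [Finset.eq_empty_iff_forall_notMem]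
      intro p hp
      rw [mem_primesIn] at hp
      have h1 := Nat.ceil_le.2 hp.2.1
      have h2 := Nat.lt_ceil.2 hp.2.2
      omega
    rw [this, Finset.sum_empty]
    exact div_nonneg zero_le_one (by linarith)

theorem sum_log_div_primesIn_le {u v : ℝ} (hv : 2 ≤ v) :
    ∑ p ∈ primesIn u v, Real.log p / p ≤ Real.log v + Real.log 4 := by
  have hv2 : 2 ≤ ⌈v⌉₊ := by simpa using Nat.ceil_mono hv
  calc ∑ p ∈ primesIn u v, Real.log p / p ≤ ∑ p ∈ primesLE (⌈v⌉₊ - 1), Real.log p / p := by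
        refine Finset.sum_le_sum_of_subset_of_nonneg (fun p hp => ?_) fun p _ _ =>
          div_nonneg (Real.log_natCast_nonneg p) (Nat.cast_nonneg p)
        rw [mem_primesIn, ← Nat.lt_ceil] at hp
        rw [Nat.mem_primesLE]
        exact ⟨by omega, hp.1⟩
    _ ≤ Real.log ((⌈v⌉₊ - 1 : ℕ) : ℝ) + Real.log 4 := sum_log_div_primesLE_le (by omega)
    _ ≤ Real.log v + Real.log 4 := by
        gcongr
        · exact_mod_cast (by omega : 0 < ⌈v⌉₊ - 1)
        · exact (Nat.lt_ceil.1 (by omega)).le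

theorem primesIn_union {u v w : ℝ} (huv : u ≤ v) (hvw : v ≤ w) :
    primesIn u v ∪ primesIn v w = primesIn u w := by
  ext p
  simp only [Finset.mem_union, mem_primesIn]
  constructor
  · rintro (⟨h1, h2, h3⟩ | ⟨h1, h2, h3⟩)
    · exact ⟨h1, h2, h3.trans_le hvw⟩
    · exact ⟨h1, huv.trans h2, h3⟩
  · rintro ⟨h1, h2, h3⟩
    rcases lt_or_ge (p : ℝ) v with h | h
    · exact Or.inl ⟨h1, h2, h⟩
    · exact Or.inr ⟨h1, h, h3⟩

theorem disjoint_primesIn (u : ℝ) {v v' : ℝ} (h : v ≤ v') (w : ℝ) :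
    Disjoint (primesIn u v) (primesIn v' w) := by
  rw [Finset.disjoint_left]
  intro p h1 h2
  rw [mem_primesIn] at h1 h2
  linarith [h1.2.2, h2.2.1]

theorem primesIn_subset {u v u' v' : ℝ} (h1 : u' ≤ u) (h2 : v ≤ v') :
    primesIn u v ⊆ primesIn u' v' := by
  intro p hp
  rw [mem_primesIn] at hp ⊢
  exact ⟨hp.1, h1.trans hp.2.1, hp.2.2.trans_le h2⟩

end Mertens

/-! ### From infinite product measures to finite expectations -/

section Bridge

open Classical in
theorem integral_comp_finset {Ω α : Type*} [MeasurableSpace Ω] (μ : Measure Ω)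
    [IsProbabilityMeasure μ] (U : Finset α) (X : Ω → Finset α) (hX : ∀ ω, X ω ⊆ U)
    (hm : ∀ S, MeasurableSet {ω | X ω = S}) (f : Finset α → ℝ) :
    ∫ ω, f (X ω) ∂μ = ∑ S ∈ U.powerset, μ.real {ω | X ω = S} * f S := by
  have h : ∀ ω, f (X ω) = ∑ S ∈ U.powerset, {ω | X ω = S}.indicator (fun _ => f S) ω := by
    intro ω
    rw [Finset.sum_eq_single_of_mem (X ω) (Finset.mem_powerset.2 (hX ω))]
    · simp
    · intro S _ hS
      rw [Set.indicator_of_notMem]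
      exact fun h => hS h.symm
  simp only [h]
  rw [integral_finsetSum]
  · refine Finset.sum_congr rfl fun S _ => ?_
    rw [integral_indicator_const _ (hm S), smul_eq_mul]
  · exact fun S _ => (integrable_const _).indicator (hm S)

open Classical in
/-- The set of indices in `U` at which independent events occur is a random subset of `U`. -/
theorem integral_infinitePi_filter {ι : Type*} [DecidableEq ι] {X : ι → Type*} [∀ i, MeasurableSpace (X i)]
    (μ : ∀ i, Measure (X i)) [∀ i, IsProbabilityMeasure (μ i)] (E : ∀ i, Set (X i))
    (hE : ∀ i, MeasurableSet (E i)) (U : Finset ι) (f : Finset ι → ℝ) :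
    ∫ ω, f (U.filter fun i => ω i ∈ E i) ∂(Measure.infinitePi μ) =
      bern U (fun i => (μ i).real (E i)) f := by
  -- Each fibre of the trace on `U` is a box in finitely many coordinates, so its measure is a
  -- product.
  have hfib : ∀ S ⊆ U, {ω : ∀ i, X i | (U.filter fun i => ω i ∈ E i) = S} =
      Set.pi U fun i => if i ∈ S then E i else (E i)ᶜ := by
    intro S hS
    ext ω
    simp only [Set.mem_ofPred_eq, Set.mem_pi, Finset.mem_coe, Finset.ext_iff, Finset.mem_filter]
    constructor
    · intro h i hi
      split_ifs with hiS
      · exact ((h i).2 hiS).2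
      · exact fun hω => hiS ((h i).1 ⟨hi, hω⟩)
    · intro h i
      constructor
      · rintro ⟨hi, hω⟩
        have := h i hi
        by_contra hiS
        rw [if_neg hiS] at this
        exact this hω
      · intro hiS
        have := h i (hS hiS)
        rw [if_pos hiS] at this
        exact ⟨hS hiS, this⟩
  have hmeas : ∀ (S : Finset ι) (i : ι), MeasurableSet (if i ∈ S then E i else (E i)ᶜ) := by
    intro S i
    split_ifs
    · exact hE i
    · exact (hE i).compl
  rw [integral_comp_finset _ U _ (fun ω => Finset.filter_subset _ _)]
  · refine Finset.sum_congr rfl fun S hS => ?_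
    have hS := Finset.mem_powerset.1 hS
    congr 1
    rw [hfib S hS, measureReal_def, Measure.infinitePi_pi _ (fun i _ => hmeas S i),
      ENNReal.toReal_prod, ← Finset.prod_sdiff hS, mul_comm]
    congr 1
    · exact Finset.prod_congr rfl fun i hi => by rw [if_pos hi]; rfl
    · refine Finset.prod_congr rfl fun i hi => ?_
      rw [if_neg (Finset.mem_sdiff.1 hi).2, ← measureReal_def, probReal_compl_eq_one_sub (hE i)]
  · intro S
    by_cases hS : S ⊆ U
    · rw [hfib S hS]
      exact MeasurableSet.pi (Finset.countable_toSet U) fun i _ => hmeas S i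
    · convert MeasurableSet.empty
      rw [Set.eq_empty_iff_forall_notMem]
      intro ω hω
      exact hS (hω ▸ Finset.filter_subset _ _)

theorem primeLaw_real_ne_one (p : Nat.Primes) :
    (primeLaw p).real {m | m ≠ 1} = 1 / (((p : ℕ) : ℝ) + 1) := by
  have h : (0 : ℝ) ≤ 1 / (((p : ℕ) : ℝ) + 1) := by positivity
  rw [measureReal_def, primeLaw, Measure.add_apply, Measure.smul_apply, Measure.smul_apply,
    Measure.dirac_apply, Measure.dirac_apply]
  simp [p.prop.ne_one, Set.indicator]
  positivity

theorem ae_sampleLaw_eq_one_or (p : Nat.Primes) :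
    ∀ᵐ n ∂sampleLaw, n p = 1 ∨ n p = (p : ℕ) := by
  have h : ∀ᵐ m ∂(primeLaw p), m = 1 ∨ m = (p : ℕ) := by
    rw [primeLaw, ae_add_measure_iff]
    constructor
    · refine Measure.ae_smul_measure ?_ _
      rw [ae_dirac_eq]
      exact Or.inl rfl
    · refine Measure.ae_smul_measure ?_ _
      rw [ae_dirac_eq]
      exact Or.inr rfl
  exact (measurePreserving_eval_infinitePi primeLaw p).quasiMeasurePreserving.ae h

theorem primesLT_map (x : ℝ) :
    (primesLT x).map ⟨fun p : Nat.Primes => (p : ℕ), Nat.Primes.coe_nat_injective⟩ =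
      primesIn 0 x := by
  ext p
  simp only [primesLT, Finset.mem_map, Set.Finite.mem_toFinset, Set.mem_ofPred_eq,
    mem_primesIn, Nat.cast_nonneg, true_and]
  constructor
  · rintro ⟨q, hq, rfl⟩
    exact ⟨q.prop, hq⟩
  · rintro ⟨h1, h2⟩
    exact ⟨⟨p, h1⟩, h2, rfl⟩

/-- Almost surely each `n p` is 1 or p, so the integer is the product of the primes where `n p ≠ 1`,
and these events are independent with probability 1/(p+1). -/
theorem integral_sampleLaw_randomInt (x : ℝ) (g : ℕ → ℝ) :
    ∫ n, g (randomInt x n) ∂sampleLaw =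
      bern (primesIn 0 x) (fun p => 1 / ((p : ℝ) + 1)) (fun S => g (∏ p ∈ S, p)) := by
  classical
  have h1 : ∀ᵐ n ∂sampleLaw, g (randomInt x n) =
      g (∏ p ∈ (primesLT x).filter (fun p => n p ∈ {m : ℕ | m ≠ 1}), (p : ℕ)) := by
    have : ∀ᵐ n ∂sampleLaw, ∀ p ∈ primesLT x, n p = 1 ∨ n p = (p : ℕ) :=
      (Finset.eventually_all _).2 fun p _ => ae_sampleLaw_eq_one_or p
    filter_upwards [this] with n hn
    rw [randomInt, Finset.prod_filter]
    congr 1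
    refine Finset.prod_congr rfl fun p hp => ?_
    rcases hn p hp with h | h
    · simp [h]
    · rw [if_pos]
      · exact h
      · simp [h, p.prop.ne_one]
  rw [integral_congr_ae h1, ← primesLT_map, bern_map]
  have := integral_infinitePi_filter primeLaw (fun _ => {m : ℕ | m ≠ 1})
    (fun _ => MeasurableSet.of_discrete) (primesLT x)
    (fun S => g (∏ p ∈ S, (p : ℕ)))
  simp only [primeLaw_real_ne_one] at this
  refine (Eq.trans ?_ this).trans (bern_congr fun S _ => ?_)
  · rw [sampleLaw]
    convert rfl
  · rw [Finset.prod_map]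
    rfl

theorem membershipLaw_real (a : ℕ) : (membershipLaw a).real {P | P} = 1 / (a : ℝ) := by
  have h : (0 : ℝ) ≤ 1 / (a : ℝ) := by positivity
  rw [measureReal_def, membershipLaw, Measure.add_apply, Measure.smul_apply, Measure.smul_apply,
    Measure.dirac_apply, Measure.dirac_apply]
  simp [ENNReal.toReal_ofReal, Set.indicator]

/-- The event depends on finitely many memberships only. It is thus a finite union of cylinders, and
measurable for arbitrary `Q`. -/
theorem randomSetLaw_real (U : Finset ℕ) (Q : Set ℕ → Prop) :
    randomSetLaw.real {A | Q (A ∩ U)} = pr U (fun a => 1 / (a : ℝ)) (fun S => Q S) := by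
  classical
  have hset : ∀ P : ℕ → Prop,
      ((U.filter fun a => P a : Finset ℕ) : Set ℕ) = {a | P a} ∩ U := by
    intro P
    ext a
    simp [and_comm]
  have hmeas : MeasurableSet {A : Set ℕ | Q (A ∩ U)} := by
    have h2 : {A : Set ℕ | Q (A ∩ U)} =
        ⋃ S ∈ U.powerset.filter (fun S : Finset ℕ => Q (S : Set ℕ)), {A : Set ℕ | A ∩ U = S} := by
      ext A
      simp only [Set.mem_ofPred_eq, Set.mem_iUnion, Finset.mem_filter, Finset.mem_powerset]
      constructor
      · intro h
        refine ⟨U.filter (· ∈ A), ⟨Finset.filter_subset _ _, ?_⟩, ?_⟩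
        · convert h
          ext a; simp [and_comm]
        · ext a; simp [and_comm]
      · rintro ⟨S, ⟨_, h⟩, h'⟩
        rwa [h']
    rw [h2]
    refine Finset.measurableSet_biUnion _ fun S _ => ?_
    have h3 : {A : Set ℕ | A ∩ U = S} = ⋂ a : ℕ, {A : Set ℕ | a ∈ A ∩ U ↔ a ∈ S} := by
      ext A
      simp [Set.ext_iff]
    rw [h3]
    refine MeasurableSet.iInter fun a => ?_
    by_cases ha : a ∈ U <;> by_cases hS : a ∈ S
    · simpa [ha, hS] using measurableSet_setOfPred.2 (measurable_set_mem a)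
    · simpa [ha, hS] using measurableSet_setOfPred.2 (measurable_set_notMem a)
    · simp [ha, hS]
    · simp [ha, hS]
  rw [← integral_indicator_one hmeas, randomSetLaw]
  refine (integral_map MeasurableEquiv.setOfPred.measurable.aemeasurable
    ((measurable_const.indicator hmeas).aestronglyMeasurable)).trans ?_
  have := integral_infinitePi_filter membershipLaw (fun _ => {P : Prop | P})
    (fun _ => MeasurableSet.of_discrete) U (fun S => if Q (S : Set ℕ) then 1 else 0)
  simp only [membershipLaw_real] at this
  rw [pr]
  refine Eq.trans ?_ (this.trans ?_)
  · refine integral_congr_ae (Eventually.of_forall fun P => ?_)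
    simp only [Set.indicator, Set.mem_ofPred_eq]
    rw [hset]
    rfl
  · convert rfl

end Bridge

/-! ### Equal subsums of a random set of integers, combined over many scales -/

section EqualSums

/-- `A` has at least `k` distinct subsets with a common sum. -/
def EqualSums (A : Finset ℕ) (k : ℕ) : Prop :=
  ∃ F : Finset (Finset ℕ), k ≤ F.card ∧ (∀ B ∈ F, B ⊆ A) ∧ ∃ s : ℕ, ∀ B ∈ F, ∑ a ∈ B, a = s

theorem EqualSums.mono {A A' : Finset ℕ} {k k' : ℕ} (h : EqualSums A k) (hA : A ⊆ A')
    (hk : k' ≤ k) : EqualSums A' k' := by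
  obtain ⟨F, h1, h2, h3⟩ := h
  exact ⟨F, hk.trans h1, fun B hB => (h2 B hB).trans hA, h3⟩

theorem equalSums_of_le_subsumMultiplicity {A : Finset ℕ} {k : ℕ}
    (h : k ≤ subsumMultiplicity (A : Set ℕ)) : EqualSums A k := by
  obtain ⟨F, h1, h2, h3⟩ := (subsumMultiplicity_isGreatest A.finite_toSet).1
  exact ⟨F, h1 ▸ h, fun B hB => by exact_mod_cast h2 B hB, h3⟩

/-- Unions of one subset from each family all have sum `s + t`, and intersecting with `A` and `B`
recovers the two pieces, so the counts multiply. -/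
theorem EqualSums.union {A B : Finset ℕ} (hAB : Disjoint A B) {k l : ℕ} (hA : EqualSums A k)
    (hB : EqualSums B l) : EqualSums (A ∪ B) (k * l) := by
  obtain ⟨F, hF1, hF2, s, hF3⟩ := hA
  obtain ⟨G, hG1, hG2, t, hG3⟩ := hB
  have hd : ∀ S ∈ F, ∀ S' ∈ G, Disjoint S S' := fun S hS S' hS' =>
    hAB.mono (hF2 S hS) (hG2 S' hS')
  refine ⟨(F ×ˢ G).image fun x => x.1 ∪ x.2, ?_, ?_, s + t, ?_⟩
  · rw [Finset.card_image_of_injOn, Finset.card_product]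
    · exact Nat.mul_le_mul hF1 hG1
    · rintro ⟨S, S'⟩ h ⟨R, R'⟩ h' e
      simp only [Finset.coe_product, Set.mem_prod, Finset.mem_coe] at h h' e
      have e1 : ∀ {X Y : Finset ℕ}, X ∈ F → Y ∈ G → (X ∪ Y) ∩ A = X := by
        intro X Y hX hY
        rw [Finset.union_inter_distrib_right, Finset.inter_eq_left.2 (hF2 X hX),
          Finset.disjoint_iff_inter_eq_empty.1 (hAB.symm.mono_left (hG2 Y hY)),
          Finset.union_empty]
      have e2 : ∀ {X Y : Finset ℕ}, X ∈ F → Y ∈ G → (X ∪ Y) ∩ B = Y := by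
        intro X Y hX hY
        rw [Finset.union_inter_distrib_right, Finset.inter_eq_left.2 (hG2 Y hY),
          Finset.disjoint_iff_inter_eq_empty.1 (hAB.mono_left (hF2 X hX)),
          Finset.empty_union]
      rw [Prod.mk.injEq]
      exact ⟨by rw [← e1 h.1 h.2, e, e1 h'.1 h'.2], by rw [← e2 h.1 h.2, e, e2 h'.1 h'.2]⟩
  · intro S hS
    obtain ⟨⟨X, Y⟩, hX, rfl⟩ := Finset.mem_image.1 hS
    rw [Finset.mem_product] at hX
    exact Finset.union_subset_union (hF2 X hX.1) (hG2 Y hX.2)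
  · intro S hS
    obtain ⟨⟨X, Y⟩, hX, rfl⟩ := Finset.mem_image.1 hS
    rw [Finset.mem_product] at hX
    rw [Finset.sum_union (hd X hX.1 Y hX.2), hF3 X hX.1, hG3 Y hX.2]

theorem equalSums_biUnion {ι : Type*} [DecidableEq ι] (I : Finset ι) (W : ι → Finset ℕ)
    (hW : (I : Set ι).PairwiseDisjoint W) (A : Finset ℕ) {k : ℕ}
    (h : ∀ i ∈ I, EqualSums (A ∩ W i) k) : EqualSums (A ∩ I.biUnion W) (k ^ I.card) := by
  induction I using Finset.induction_on with
  | empty => exact ⟨{∅}, by simp, by simp, 0, by simp⟩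
  | insert i I hi ih =>
    rw [Finset.coe_insert, Set.pairwiseDisjoint_insert_of_notMem (by simpa using hi)] at hW
    have h1 := ih hW.1 fun j hj => h j (Finset.mem_insert_of_mem hj)
    have h2 := h i (Finset.mem_insert_self _ _)
    rw [Finset.biUnion_insert, Finset.inter_union_distrib_left, Finset.card_insert_of_notMem hi,
      pow_succ']
    refine h2.union (Disjoint.mono Finset.inter_subset_right Finset.inter_subset_right ?_) h1
    rw [Finset.disjoint_biUnion_right]
    exact fun j hj => hW.2 j hj

theorem one_div_natCast_le_one (a : ℕ) : 1 / (a : ℝ) ≤ 1 := by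
  rcases Nat.eq_zero_or_pos a with rfl | ha
  · simp
  · exact div_le_one_of_le₀ (by exact_mod_cast ha) (by positivity)

/-- If each of `m` disjoint blocks has `k` equal subsums with probability close to one, then with
high probability most of them do, and the union has correspondingly many equal subsums. -/
theorem pr_equalSums_pow_ge {J : Finset ℕ} {m n k : ℕ} (hm : 0 < m) (hk : 0 < k)
    (W : ℕ → Finset ℕ) (hWJ : ∀ i < m, W i ⊆ J)
    (hW : (Finset.range m : Set ℕ).PairwiseDisjoint W) {δ : ℝ} (hδ : 0 < δ)
    (hpr : ∀ i < m, 1 - δ ≤ pr (W i) (fun a => 1 / (a : ℝ)) fun A => EqualSums A k)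
    (hn : (n : ℝ) ≤ m - 8 * δ * m) :
    7 / 8 ≤ pr J (fun a => 1 / (a : ℝ)) fun A => EqualSums A (k ^ n) := by
  classical
  have hm0 : (0 : ℝ) < m := by exact_mod_cast hm
  have h0 : ∀ U : Finset ℕ, ∀ a ∈ U, (0 : ℝ) ≤ 1 / (a : ℝ) := fun _ a _ => by positivity
  have h1 : ∀ U : Finset ℕ, ∀ a ∈ U, 1 / (a : ℝ) ≤ 1 := fun _ a _ => one_div_natCast_le_one a
  set f : Finset ℕ → ℝ := fun A => ∑ i ∈ Finset.range m, if ¬ EqualSums (A ∩ W i) k then 1 else 0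
  have hf : bern J (fun a => 1 / (a : ℝ)) f ≤ m * δ := by
    rw [bern_sum]
    calc _ ≤ ∑ i ∈ Finset.range m, δ := by
          refine Finset.sum_le_sum fun i hi => ?_
          rw [Finset.mem_range] at hi
          rw [bern_inter (hWJ i hi) _ (fun A => if ¬ EqualSums A k then 1 else 0)]
          have := pr_not (U := W i) (q := fun a => 1 / (a : ℝ)) fun A => EqualSums A k
          rw [pr] at this
          have h2 := hpr i hi
          have h3 : bern (W i) (fun a => 1 / (a : ℝ)) (fun A => if ¬ EqualSums A k then 1 else 0) =
            1 - pr (W i) (fun a => 1 / (a : ℝ)) fun A => EqualSums A k := by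
            rw [← this]; exact bern_congr fun S _ => by congr
          linarith
      _ = m * δ := by simp
  -- Markov's inequality: `f` counts the failing blocks and has mean at most `δ m`, while fewer than
  -- `n` good blocks force at least `8 δ m` failures. The failure probability is thus at most 1/8.
  have hfail : pr J (fun a => 1 / (a : ℝ)) (fun A => ¬ EqualSums A (k ^ n)) ≤
      bern J (fun a => 1 / (a : ℝ)) f / (8 * δ * m) := by
    refine pr_le_bern_div (h0 J) (h1 J)
      (fun S _ => Finset.sum_nonneg fun i _ => by split_ifs <;> norm_num) (by positivity) ?_
    intro A _ hA
    set I := (Finset.range m).filter fun i => EqualSums (A ∩ W i) k with hI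
    have h2 : I.card < n := by
      by_contra h3
      rw [not_lt] at h3
      refine hA ((equalSums_biUnion I W (hW.subset ?_) A fun i hi => (Finset.mem_filter.1 hi).2).mono
        Finset.inter_subset_left (Nat.pow_le_pow_right hk h3))
      exact_mod_cast Finset.filter_subset _ _
    have h3 : f A = m - I.card := by
      have h4 := Finset.card_filter_add_card_filter_not (s := Finset.range m)
        (fun i => EqualSums (A ∩ W i) k)
      have h5 : f A = ((Finset.range m).filter fun i => ¬ EqualSums (A ∩ W i) k).card := by
        simp only [f]
        rw [Finset.sum_boole]
      rw [h5, eq_sub_iff_add_eq, add_comm]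
      rw [Finset.card_range] at h4
      exact_mod_cast h4
    have h4 : (I.card : ℝ) ≤ n := by exact_mod_cast h2.le
    change _ ≤ f A
    rw [h3]
    linarith
  rw [pr_not] at hfail
  have h5 : bern J (fun a => 1 / (a : ℝ)) f / (8 * δ * m) ≤ 1 / 8 := by
    rw [div_le_iff₀ (by positivity)]
    linarith
  linarith

/-- The natural numbers in `[u, v]`. -/
noncomputable def natsIn (u v : ℝ) : Finset ℕ :=
  (Finset.range (⌊v⌋₊ + 1)).filter fun a => u ≤ (a : ℝ)

theorem mem_natsIn {u v : ℝ} (hv : 0 ≤ v) {a : ℕ} : a ∈ natsIn u v ↔ u ≤ (a : ℝ) ∧ (a : ℝ) ≤ v := by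
  rw [natsIn, Finset.mem_filter, Finset.mem_range, Nat.lt_succ_iff, Nat.le_floor_iff hv, and_comm]

theorem exists_pr_natsIn_ge {k : ℕ} {c : ℝ} (h : Tendsto (fun D : ℝ => randomSetLaw
      {A : Set ℕ | k ≤ subsumMultiplicity (A ∩ {a : ℕ | D ^ c ≤ (a : ℝ) ∧ (a : ℝ) ≤ D})})
      atTop (𝓝 1)) {δ : ℝ} (hδ : 0 < δ) :
    ∃ D₀ : ℝ, ∀ D ≥ D₀, 1 - δ ≤ pr (natsIn (D ^ c) D) (fun a => 1 / (a : ℝ)) fun A => EqualSums A k := by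
  have h1 : Tendsto (fun D : ℝ => randomSetLaw.real
      {A : Set ℕ | k ≤ subsumMultiplicity (A ∩ {a : ℕ | D ^ c ≤ (a : ℝ) ∧ (a : ℝ) ≤ D})})
      atTop (𝓝 1) := by
    have := (ENNReal.tendsto_toReal ENNReal.one_ne_top).comp h
    rwa [ENNReal.toReal_one] at this
  obtain ⟨D₀, hD₀⟩ := eventually_atTop.1
    ((h1.eventually (lt_mem_nhds (by linarith : 1 - δ < 1))).and (eventually_ge_atTop 0))
  refine ⟨D₀, fun D hD => ?_⟩
  obtain ⟨h2, h3⟩ := hD₀ D hD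
  have h4 : {a : ℕ | D ^ c ≤ (a : ℝ) ∧ (a : ℝ) ≤ D} = (natsIn (D ^ c) D : Set ℕ) := by
    ext a
    exact (mem_natsIn h3).symm
  rw [h4, randomSetLaw_real (natsIn (D ^ c) D) (fun B => k ≤ subsumMultiplicity B)] at h2
  refine h2.le.trans (pr_mono (fun a _ => by positivity) (fun a _ => one_div_natCast_le_one a) ?_)
  exact fun S _ hS => equalSums_of_le_subsumMultiplicity hS

/-- Many equal subsums at all scales up to `e ^ τ`. -/
theorem exists_pr_equalSums_natsIn_ge {k : ℕ} (hk : 2 ≤ k) {c c' : ℝ} (hc' : 0 < c') (hcc : c' < c)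
    (hc1 : c < 1)
    (h : Tendsto (fun D : ℝ => randomSetLaw
      {A : Set ℕ | k ≤ subsumMultiplicity (A ∩ {a : ℕ | D ^ c ≤ (a : ℝ) ∧ (a : ℝ) ≤ D})})
      atTop (𝓝 1)) {α ε : ℝ} (hα : 0 < α) (hε : 0 < ε) (hε1 : ε < 1) :
    ∀ᶠ T : ℝ in atTop, ∀ τ : ℝ, α * T ≤ τ → ∃ K : ℕ,
      T ^ (Real.log k / Real.log (1 / c') * (1 - ε)) ≤ K ∧
      7 / 8 ≤ pr (natsIn (2 * T) (Real.exp τ)) (fun a => 1 / (a : ℝ)) fun A => EqualSums A K := by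
  have hk0 : 0 < k := by omega
  have hlk : 0 < Real.log k := Real.log_pos (by exact_mod_cast hk)
  set L := Real.log (1 / c') with hL
  have hL0 : 0 < L := Real.log_pos (by rw [lt_div_iff₀ hc']; linarith)
  have hlc : Real.log c' = -L := by rw [hL, one_div, Real.log_inv, neg_neg]
  -- With δ = ε/32 the tolerated proportion of failures is 8δ = ε/4, matching the definition of `n`
  -- below.
  obtain ⟨D₀, hD₀⟩ := exists_pr_natsIn_ge h (show 0 < ε / 32 by linarith)
  have e1 : ∀ᶠ T : ℝ in atTop, Real.log (2 * T) ≤ c * (α * T ^ (ε / 2)) := by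
    have h1 := (isLittleO_log_rpow_atTop (show 0 < ε / 2 by linarith)).bound
      (show 0 < c * α / 2 by have := hc'.trans hcc; positivity)
    have h2 : Tendsto (fun T : ℝ => T ^ (ε / 2)) atTop atTop := tendsto_rpow_atTop (by linarith)
    filter_upwards [h1, eventually_ge_atTop 2, h2.eventually_ge_atTop (2 * Real.log 2 / (c * α))]
      with T hT hT2 hT3
    rw [Real.norm_of_nonneg (Real.log_nonneg (by linarith)),
      Real.norm_of_nonneg (by positivity)] at hT
    have hca : 0 < c * α := mul_pos (hc'.trans hcc) hα
    rw [div_le_iff₀ hca] at hT3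
    rw [Real.log_mul (by norm_num) (by linarith)]
    nlinarith
  have e2 : ∀ᶠ T : ℝ in atTop, D₀ ≤ α * T ^ (ε / 2) :=
    ((tendsto_rpow_atTop (show 0 < ε / 2 by linarith)).const_mul_atTop hα).eventually_ge_atTop D₀
  have e3 : ∀ᶠ T : ℝ in atTop, 8 * L / ε ≤ Real.log T :=
    Real.tendsto_log_atTop.eventually_ge_atTop _
  filter_upwards [e1, e2, e3, eventually_gt_atTop 1] with T h1 h2 h3 hT1 τ hτ
  have hT0 : 0 < T := by linarith
  have hlT : 0 < Real.log T := Real.log_pos hT1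
  rw [div_le_iff₀ hε] at h3
  -- The number of scales is chosen so that `T * c' ^ i ≥ T ^ (ε / 2)` for all `i ≤ m`; even the
  -- lowest window then lies above `2 * T`.
  set m := ⌊(1 - ε / 2) * Real.log T / L⌋₊ with hm
  set n := ⌊(1 - ε / 4) * (m : ℝ)⌋₊ with hn
  have hm1 : (m : ℝ) ≤ (1 - ε / 2) * Real.log T / L :=
    Nat.floor_le (div_nonneg (mul_nonneg (by linarith) hlT.le) hL0.le)
  have hm2 : (1 - ε / 2) * Real.log T / L < m + 1 := Nat.lt_floor_add_one _
  have hm3 : 1 ≤ m := by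
    rw [hm, Nat.one_le_floor_iff, le_div_iff₀ hL0]
    nlinarith
  have hn1 : (n : ℝ) ≤ (1 - ε / 4) * m := Nat.floor_le (mul_nonneg (by linarith) (by positivity))
  have hn2 : (1 - ε / 4) * (m : ℝ) < n + 1 := Nat.lt_floor_add_one _
  have hpow : ∀ i ≤ m, T ^ (ε / 2) ≤ T * c' ^ i := by
    intro i hi
    rw [← Real.exp_log hc', ← Real.exp_nat_mul, Real.rpow_def_of_pos hT0, hlc]
    nth_rewrite 2 [← Real.exp_log hT0]
    rw [← Real.exp_add, Real.exp_le_exp]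
    have hi' : (i : ℝ) ≤ m := by exact_mod_cast hi
    have : (i : ℝ) * L ≤ (1 - ε / 2) * Real.log T := by
      rw [← le_div_iff₀ hL0]
      exact hi'.trans hm1
    linarith
  have hτ0 : 0 < τ := lt_of_lt_of_le (by positivity) hτ
  -- Here `D (i + 1) = D i ^ c'`, which is less than `D i ^ c` because `c' < c`. The gap between the
  -- exponents makes the windows `[D i ^ c, D i]` disjoint.
  set D : ℕ → ℝ := fun i => Real.exp (τ * c' ^ i) with hD
  have hDc : ∀ i, D i ^ c = Real.exp (τ * c' ^ i * c) := fun i => by rw [hD, ← Real.exp_mul]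
  have hαi : ∀ i ≤ m, α * T ^ (ε / 2) ≤ τ * c' ^ i := by
    intro i hi
    calc α * T ^ (ε / 2) ≤ α * (T * c' ^ i) := mul_le_mul_of_nonneg_left (hpow i hi) hα.le
      _ = α * T * c' ^ i := by ring
      _ ≤ τ * c' ^ i := mul_le_mul_of_nonneg_right hτ (by positivity)
  have hDanti : ∀ i, D (i + 1) < D i ^ c := by
    intro i
    rw [hDc, hD, Real.exp_lt_exp, pow_succ, ← mul_assoc]
    exact mul_lt_mul_of_pos_left hcc (by positivity)
  have hDmono : Antitone D := by
    refine antitone_nat_of_succ_le fun i => ?_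
    rw [hD, Real.exp_le_exp, pow_succ, ← mul_assoc]
    exact mul_le_of_le_one_right (by positivity) (by linarith)
  have hlt : ∀ {i j : ℕ}, i < j → Disjoint (natsIn (D i ^ c) (D i)) (natsIn (D j ^ c) (D j)) := by
    intro i j hij
    rw [Finset.disjoint_left]
    intro a ha ha'
    rw [mem_natsIn (Real.exp_pos _).le] at ha ha'
    have := hDmono (Nat.succ_le_of_lt hij)
    have h5 := hDanti i
    simp only [Nat.succ_eq_add_one] at this
    linarith [ha.1, ha'.2]
  refine ⟨k ^ n, ?_, ?_⟩
  · rw [Real.rpow_def_of_pos hT0]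
    push_cast
    nth_rewrite 2 [← Real.exp_log (show (0 : ℝ) < k by exact_mod_cast hk0)]
    rw [← Real.exp_nat_mul, Real.exp_le_exp]
    have h5 : Real.log T * (1 - ε) ≤ n * L := by
      rw [div_lt_iff₀ hL0] at hm2
      have h6 : (1 - ε / 4) * ((1 - ε / 2) * Real.log T) ≤ (1 - ε / 4) * ((m + 1) * L) :=
        mul_le_mul_of_nonneg_left hm2.le (by linarith)
      have h7 : (1 - ε / 4) * (m : ℝ) * L ≤ (n + 1) * L :=
        mul_le_mul_of_nonneg_right hn2.le hL0.le
      nlinarith [mul_pos hε hL0, mul_pos hε hlT, mul_pos (mul_pos hε hε) hlT]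
    calc Real.log T * (Real.log k / L * (1 - ε)) = Real.log k / L * (Real.log T * (1 - ε)) := by ring
      _ ≤ Real.log k / L * (n * L) := mul_le_mul_of_nonneg_left h5 (by positivity)
      _ = n * Real.log k := by field_simp
  · refine pr_equalSums_pow_ge (m := m) (δ := ε / 32) hm3 hk0 (fun i => natsIn (D i ^ c) (D i)) ?_ ?_ (by linarith)
      ?_ ?_
    · intro i hi a ha
      rw [mem_natsIn (Real.exp_pos _).le] at ha ⊢
      refine ⟨le_trans ?_ ha.1, ha.2.trans ?_⟩
      · rw [hDc, ← Real.log_le_iff_le_exp (by linarith)]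
        refine h1.trans ?_
        rw [mul_comm c]
        exact mul_le_mul_of_nonneg_right (hαi i hi.le) (by linarith)
      · simpa [hD] using hDmono (Nat.zero_le i)
    · intro i _ j _ hij
      rcases lt_or_gt_of_ne hij with h' | h'
      · exact hlt h'
      · exact (hlt h').symm
    · intro i hi
      refine hD₀ (D i) (h2.trans ((hαi i hi.le).trans ?_))
      have := Real.add_one_le_exp (τ * c' ^ i)
      simp only [hD]
      linarith
    · linarith

end EqualSums

/-! ### Clusters of products of random primes -/

section PrimeClusters

/-- `S` has at least `M` subsets whose sums of logarithms lie in a common interval of length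
`s * |S|`. -/
def Cluster (s M : ℝ) (S : Finset ℕ) : Prop :=
  ∃ F : Finset (Finset ℕ), M ≤ F.card ∧ (∀ B ∈ F, B ⊆ S) ∧
    ∃ u : ℝ, ∀ B ∈ F, u ≤ ∑ p ∈ B, Real.log p ∧ ∑ p ∈ B, Real.log p ≤ u + s * S.card

theorem Cluster.mono {s M : ℝ} (hs : 0 ≤ s) {S S' : Finset ℕ} (h : Cluster s M S) (hS : S ⊆ S') :
    Cluster s M S' := by
  obtain ⟨F, h1, h2, u, h3⟩ := h
  refine ⟨F, h1, fun B hB => (h2 B hB).trans hS, u, fun B hB => ⟨(h3 B hB).1, ?_⟩⟩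
  refine (h3 B hB).2.trans ?_
  have : (S.card : ℝ) ≤ S'.card := by exact_mod_cast Finset.card_le_card hS
  nlinarith

/-- The empty subset suffices. This covers the case where the exponent to be reached is not
positive. -/
theorem cluster_one {s : ℝ} (hs : 0 ≤ s) (S : Finset ℕ) : Cluster s 1 S :=
  ⟨{∅}, by simp, by simp, 0, by simpa using by positivity⟩

/-- The primes whose logarithm lies in `[a s, (a + 1) s)`. -/
noncomputable def logBlock (s : ℝ) (a : ℕ) : Finset ℕ :=
  primesIn (Real.exp (a * s)) (Real.exp ((a + 1) * s))

theorem mem_logBlock {s : ℝ} {a p : ℕ} :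
    p ∈ logBlock s a ↔ p.Prime ∧ a * s ≤ Real.log p ∧ Real.log p < (a + 1) * s := by
  rw [logBlock, mem_primesIn]
  constructor
  · rintro ⟨h1, h2, h3⟩
    have : (0 : ℝ) < p := by exact_mod_cast h1.pos
    exact ⟨h1, (Real.le_log_iff_exp_le this).2 h2, (Real.log_lt_iff_lt_exp this).2 h3⟩
  · rintro ⟨h1, h2, h3⟩
    have : (0 : ℝ) < p := by exact_mod_cast h1.pos
    exact ⟨h1, (Real.le_log_iff_exp_le this).1 h2, (Real.log_lt_iff_lt_exp this).1 h3⟩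

theorem disjoint_logBlock {s : ℝ} (hs : 0 ≤ s) {a b : ℕ} (hab : a ≠ b) :
    Disjoint (logBlock s a) (logBlock s b) := by
  have key : ∀ {a b : ℕ}, a < b → Disjoint (logBlock s a) (logBlock s b) := by
    intro a b h
    refine disjoint_primesIn _ ?_ _
    rw [Real.exp_le_exp]
    refine mul_le_mul_of_nonneg_right ?_ hs
    exact_mod_cast h
  rcases lt_or_gt_of_ne hab with h | h
  · exact key h
  · exact (key h).symm

/-- Choose a prime of `S` in each block indexed by `A`. Disjointness of the blocks makes the choice
injective, and each log p exceeds `s * a` by at most `s`, so a common subsum σ becomes the interval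
[sσ, sσ + s|S|]. -/
theorem cluster_of_equalSums {s : ℝ} (hs : 0 ≤ s) {S A : Finset ℕ} {K : ℕ}
    (hA : ∀ a ∈ A, (S ∩ logBlock s a).Nonempty) (h : EqualSums A K) : Cluster s K S := by
  classical
  obtain ⟨F, hF1, hF2, σ, hF3⟩ := h
  choose! π hπ using hA
  have hS : ∀ a ∈ A, π a ∈ S := fun a ha => (Finset.mem_inter.1 (hπ a ha)).1
  have hB : ∀ a ∈ A, π a ∈ logBlock s a := fun a ha => (Finset.mem_inter.1 (hπ a ha)).2
  have hinj : Set.InjOn π A := by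
    intro a ha b hb hab
    by_contra hne
    have := Finset.disjoint_left.1 (disjoint_logBlock hs hne) (hB a ha)
    exact this (hab ▸ hB b hb)
  have hinjB : ∀ B ∈ F, Set.InjOn π B := fun B hB => hinj.mono (by exact_mod_cast hF2 B hB)
  refine ⟨F.image (Finset.image π), ?_, ?_, s * σ, ?_⟩
  · rw [Finset.card_image_of_injOn]
    · exact_mod_cast hF1
    · intro B hB B' hB' e
      ext a
      have aux : ∀ {B B' : Finset ℕ}, B ∈ F → B' ∈ F → B.image π = B'.image π → a ∈ B → a ∈ B' := by
        intro B B' hB hB' e ha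
        have : π a ∈ B'.image π := e ▸ Finset.mem_image_of_mem π ha
        obtain ⟨b, hb, hab⟩ := Finset.mem_image.1 this
        rwa [← hinj (hF2 B' hB' hb) (hF2 B hB ha) hab]
      exact ⟨aux hB hB' e, aux hB' hB e.symm⟩
  · intro B' hB'
    obtain ⟨B, hB, rfl⟩ := Finset.mem_image.1 hB'
    exact Finset.image_subset_iff.2 fun a ha => hS a (hF2 B hB ha)
  · intro B' hB'
    obtain ⟨B, hBF, rfl⟩ := Finset.mem_image.1 hB'
    rw [Finset.sum_image (hinjB B hBF)]
    have hsum : (∑ a ∈ B, (a : ℝ)) = σ := by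
      rw [← hF3 B hBF]
      push_cast
      rfl
    have hcard : (B.card : ℝ) ≤ S.card := by
      rw [← Finset.card_image_of_injOn (hinjB B hBF)]
      exact_mod_cast Finset.card_le_card
        (Finset.image_subset_iff.2 fun a ha => hS a (hF2 B hBF ha))
    constructor
    · rw [← hsum, Finset.mul_sum]
      refine Finset.sum_le_sum fun a ha => ?_
      have := (mem_logBlock.1 (hB a (hF2 B hBF ha))).2.1
      linarith
    · calc ∑ a ∈ B, Real.log (π a) ≤ ∑ a ∈ B, (s * a + s) := by
            refine Finset.sum_le_sum fun a ha => ?_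
            have := (mem_logBlock.1 (hB a (hF2 B hBF ha))).2.2
            linarith
        _ = s * σ + s * B.card := by
            rw [Finset.sum_add_distrib, ← Finset.mul_sum, hsum, Finset.sum_const, nsmul_eq_mul]
            ring
        _ ≤ s * σ + s * S.card := by gcongr

theorem one_sub_sum_le_prod {α : Type*} [DecidableEq α] (U : Finset α) (q : α → ℝ)
    (h0 : ∀ a ∈ U, 0 ≤ q a) (h1 : ∀ a ∈ U, q a ≤ 1) :
    1 - ∑ a ∈ U, q a ≤ ∏ a ∈ U, (1 - q a) := by
  induction U using Finset.induction_on with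
  | empty => simp
  | insert a U ha ih =>
    simp only [Finset.mem_insert, forall_eq_or_imp] at h0 h1
    rw [Finset.sum_insert ha, Finset.prod_insert ha]
    have h2 := ih h0.2 h1.2
    have h3 : 0 ≤ ∑ a ∈ U, q a := Finset.sum_nonneg h0.2
    nlinarith [h0.1, h1.1, mul_le_mul_of_nonneg_left h2 (sub_nonneg.2 h1.1),
      mul_nonneg h0.1 h3]

theorem prod_one_sub_le_exp {α : Type*} (U : Finset α) (q : α → ℝ) (h1 : ∀ a ∈ U, q a ≤ 1) :
    ∏ a ∈ U, (1 - q a) ≤ Real.exp (-∑ a ∈ U, q a) := by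
  rw [← Finset.sum_neg_distrib, Real.exp_sum]
  refine Finset.prod_le_prod (fun a ha => sub_nonneg.2 (h1 a ha)) fun a _ => ?_
  have := Real.add_one_le_exp (-q a)
  linarith

theorem sum_inv_succ_le_sum_inv (U : Finset ℕ) (hU : ∀ p ∈ U, 0 < p) :
    ∑ p ∈ U, 1 / ((p : ℝ) + 1) ≤ ∑ p ∈ U, 1 / (p : ℝ) := by
  refine Finset.sum_le_sum fun p hp => ?_
  have : (0 : ℝ) < p := by exact_mod_cast hU p hp
  exact one_div_le_one_div_of_le this (by linarith)

theorem sum_inv_sub_sum_inv_sq_le (U : Finset ℕ) (hU : ∀ p ∈ U, 0 < p) :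
    ∑ p ∈ U, 1 / (p : ℝ) - ∑ p ∈ U, 1 / (p : ℝ) ^ 2 ≤ ∑ p ∈ U, 1 / ((p : ℝ) + 1) := by
  rw [← Finset.sum_sub_distrib]
  refine Finset.sum_le_sum fun p hp => ?_
  have h : (0 : ℝ) < p := by exact_mod_cast hU p hp
  rw [div_sub_div _ _ h.ne' (by positivity), div_le_div_iff₀ (by positivity) (by positivity)]
  nlinarith

/-- A random set of primes meets the block `logBlock s a` with probability about `1 / a`. -/
theorem exists_abs_one_sub_prod_logBlock_sub_le : ∃ C : ℝ, 0 ≤ C ∧ ∀ (s : ℝ) (a : ℕ), 0 < s →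
    0 < a → 2 ≤ a * s → |(1 - ∏ p ∈ logBlock s a, (1 - 1 / ((p : ℝ) + 1))) - 1 / a| ≤
      3 / (a : ℝ) ^ 2 + C / (a * s) := by
  obtain ⟨C, hC, h⟩ := exists_abs_sum_inv_primesIn_sub_le
  refine ⟨C + 1 + 2 * C ^ 2, by positivity, fun s a hs ha has => ?_⟩
  have ha0 : (0 : ℝ) < a := by exact_mod_cast ha
  have hexp : a * s + 1 ≤ Real.exp (a * s) := Real.add_one_le_exp _
  -- At these endpoints the main term of Mertens' theorem is log((a+1)s) - log(as) = log(1 + 1/a),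
  -- which is 1/a + O(1/a²).
  have h1 := h (Real.exp (a * s)) (Real.exp ((a + 1) * s)) (by linarith)
    (Real.exp_le_exp.2 (by nlinarith))
  rw [Real.log_exp, Real.log_exp, Real.log_mul (by positivity) hs.ne',
    Real.log_mul (by positivity) hs.ne', add_sub_add_right_eq_sub] at h1
  have hsq : ∑ p ∈ logBlock s a, 1 / (p : ℝ) ^ 2 ≤ 1 / (a * s) := by
    refine (sum_inv_sq_primesIn_le (by linarith) _).trans ?_
    exact one_div_le_one_div_of_le (by linarith) (by linarith)
  have hpos : ∀ p ∈ logBlock s a, 0 < p := fun p hp => (mem_logBlock.1 hp).1.pos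
  have hq1 : ∀ p ∈ logBlock s a, 1 / ((p : ℝ) + 1) ≤ 1 := fun p _ =>
    div_le_one_of_le₀ (by linarith [Nat.cast_nonneg (α := ℝ) p]) (by positivity)
  have h2 := sum_inv_succ_le_sum_inv _ hpos
  have h3 := sum_inv_sub_sum_inv_sq_le _ hpos
  have h4 := one_sub_sum_le_prod (logBlock s a) (fun p => 1 / ((p : ℝ) + 1))
    (fun p _ => by positivity) hq1
  have h5 := prod_one_sub_le_exp (logBlock s a) (fun p => 1 / ((p : ℝ) + 1)) hq1
  have h6 : 0 ≤ ∑ p ∈ logBlock s a, 1 / ((p : ℝ) + 1) := Finset.sum_nonneg fun p _ => by positivity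
  change |∑ p ∈ logBlock s a, 1 / (p : ℝ) - _| ≤ _ at h1
  set Λ := ∑ p ∈ logBlock s a, 1 / (p : ℝ)
  set Λ' := ∑ p ∈ logBlock s a, 1 / ((p : ℝ) + 1)
  set P := ∏ p ∈ logBlock s a, (1 - 1 / ((p : ℝ) + 1))
  have hdl : Real.log (a + 1) - Real.log a = Real.log (1 + 1 / a) := by
    rw [← Real.log_div (by positivity) ha0.ne']
    congr 1
    field_simp
  rw [hdl] at h1
  set w := 1 / (a : ℝ) with hw
  have hw0 : 0 < w := by positivity
  have hw1 : w ≤ 1 := one_div_natCast_le_one a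
  have h7 : Real.log (1 + w) ≤ w := by
    have := Real.log_le_sub_one_of_pos (show 0 < 1 + w by linarith)
    linarith
  have h8 : w - w ^ 2 ≤ Real.log (1 + w) := by
    have := Real.one_sub_inv_le_log_of_pos (show 0 < 1 + w by linarith)
    refine le_trans ?_ this
    rw [← sub_nonneg]
    have : 1 - (1 + w)⁻¹ - (w - w ^ 2) = w ^ 3 / (1 + w) := by field_simp; ring
    rw [this]
    positivity
  set g := 1 / ((a : ℝ) * s) with hg
  have hg0 : 0 < g := by positivity
  have hg1 : g ≤ 1 := div_le_one_of_le₀ (by linarith) (by positivity)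
  have hCg : C / (a * s) = C * g := by rw [hg]; ring
  rw [hCg, abs_le] at h1
  -- Together with the union bound `h4`, this traps the probability of meeting the block between `Λ'
  -- - Λ' ^ 2` and `Λ'`.
  have h9 : Λ' - Λ' ^ 2 ≤ 1 - Real.exp (-Λ') := by
    have : Real.exp (-Λ') ≤ 1 / (1 + Λ') := by
      rw [Real.exp_neg, ← one_div]
      exact one_div_le_one_div_of_le (by linarith) (by linarith [Real.add_one_le_exp Λ'])
    have h10 : 1 / (1 + Λ') ≤ 1 - Λ' + Λ' ^ 2 := by
      rw [div_le_iff₀ (by linarith)]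
      nlinarith [pow_nonneg h6 3]
    linarith
  have hΛ : Λ ≤ w + C * g := by linarith
  have hΛ2 : Λ' ^ 2 ≤ 2 * w ^ 2 + 2 * C ^ 2 * g := by
    have e1 : Λ' ^ 2 ≤ (w + C * g) ^ 2 := by gcongr; linarith
    have e2 : g ^ 2 ≤ g := by nlinarith
    have e3 : C ^ 2 * g ^ 2 ≤ C ^ 2 * g := mul_le_mul_of_nonneg_left e2 (by positivity)
    nlinarith [sq_nonneg (w - C * g)]
  have e1 : 3 / (a : ℝ) ^ 2 = 3 * w ^ 2 := by rw [hw]; ring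
  have e2 : (C + 1 + 2 * C ^ 2) / ((a : ℝ) * s) = (C + 1 + 2 * C ^ 2) * g := by rw [hg]; ring
  rw [e1, e2, abs_le]
  constructor
  · nlinarith
  · nlinarith [mul_nonneg (sq_nonneg C) hg0.le, sq_nonneg w]

theorem inv_succ_le_one (p : ℕ) : 1 / ((p : ℝ) + 1) ≤ 1 :=
  div_le_one_of_le₀ (by linarith [Nat.cast_nonneg (α := ℝ) p]) (by positivity)

/-- Transfer of equal subsums from random integers to clusters of products of random primes. -/
theorem exists_pr_cluster_ge_sub : ∃ C : ℝ, 0 ≤ C ∧ ∀ (s u v : ℝ) (K : ℕ) (y x : ℝ), 0 < s →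
    2 ≤ u → 2 ≤ u * s → 1 ≤ v → y ≤ Real.exp (u * s) → Real.exp ((v + 1) * s) ≤ x →
    pr (natsIn u v) (fun a => 1 / (a : ℝ)) (fun A => EqualSums A K) - 6 / u -
        C * (1 + Real.log v) / s ≤
      pr (primesIn y x) (fun p => 1 / ((p : ℝ) + 1)) (Cluster s K) := by
  classical
  obtain ⟨C, hC, hq⟩ := exists_abs_one_sub_prod_logBlock_sub_le
  refine ⟨C, hC, fun s u v K y x hs hu hus hv hy hx => ?_⟩
  have hv0 : 0 ≤ v := by linarith
  have h0 : ∀ U : Finset ℕ, ∀ a ∈ U, (0 : ℝ) ≤ 1 / ((a : ℝ) + 1) := fun _ a _ => by positivity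
  have h1 : ∀ U : Finset ℕ, ∀ a ∈ U, 1 / ((a : ℝ) + 1) ≤ 1 := fun _ a _ => inv_succ_le_one a
  set J := natsIn u v with hJ
  set q : ℕ → ℝ := fun a => 1 - ∏ p ∈ logBlock s a, (1 - 1 / ((p : ℝ) + 1)) with hqdef
  have hdisj : (J : Set ℕ).PairwiseDisjoint (logBlock s) := fun a _ b _ hab =>
    disjoint_logBlock hs.le hab
  have hsub : J.biUnion (logBlock s) ⊆ primesIn y x := by
    intro p hp
    obtain ⟨a, ha, hp⟩ := Finset.mem_biUnion.1 hp
    rw [mem_natsIn hv0] at ha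
    refine primesIn_subset (hy.trans ?_) (le_trans ?_ hx) hp
    · exact Real.exp_le_exp.2 (mul_le_mul_of_nonneg_right ha.1 hs.le)
    · exact Real.exp_le_exp.2 (mul_le_mul_of_nonneg_right (by linarith) hs.le)
  have hq0 : ∀ a ∈ J, 0 ≤ q a := fun a _ => by
    have : ∏ p ∈ logBlock s a, (1 - 1 / ((p : ℝ) + 1)) ≤ 1 :=
      Finset.prod_le_one (fun p _ => sub_nonneg.2 (inv_succ_le_one p)) fun p _ => by
        have : 0 ≤ 1 / ((p : ℝ) + 1) := by positivity
        linarith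
    simp only [hqdef]
    linarith
  have hq1 : ∀ a ∈ J, q a ≤ 1 := fun a _ => by
    have : 0 ≤ ∏ p ∈ logBlock s a, (1 - 1 / ((p : ℝ) + 1)) :=
      Finset.prod_nonneg fun p _ => sub_nonneg.2 (inv_succ_le_one p)
    simp only [hqdef]
    linarith
  -- The set of occupied blocks is itself a random subset of `J`, with weights `q`, by
  -- `bern_biUnion`. Equal subsums among its elements yield a cluster.
  have step1 : pr J q (fun A => EqualSums A K) ≤
      pr (primesIn y x) (fun p => 1 / ((p : ℝ) + 1)) (Cluster s K) := by
    calc pr J q (fun A => EqualSums A K)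
        = pr (J.biUnion (logBlock s)) (fun p => 1 / ((p : ℝ) + 1))
          (fun S => EqualSums (J.filter fun a => (S ∩ logBlock s a).Nonempty) K) :=
          (bern_biUnion J (logBlock s) hdisj (fun p => 1 / ((p : ℝ) + 1))
            (fun A => if EqualSums A K then 1 else 0)).symm
      _ ≤ pr (J.biUnion (logBlock s)) (fun p => 1 / ((p : ℝ) + 1)) (Cluster s K) :=
          pr_mono (h0 _) (h1 _) fun S _ h =>
            cluster_of_equalSums hs.le (fun a ha => (Finset.mem_filter.1 ha).2) h
      _ = pr (primesIn y x) (fun p => 1 / ((p : ℝ) + 1))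
          (fun S => Cluster s K (S ∩ J.biUnion (logBlock s))) :=
          (bern_inter hsub _ (fun S => if Cluster s K S then 1 else 0)).symm
      _ ≤ _ := pr_mono (h0 _) (h1 _) fun S _ h => h.mono hs.le Finset.inter_subset_left
  -- The weights `q a` are now exchanged for `1 / a` at the price of the total variation distance.
  have step2 : |pr J q (fun A => EqualSums A K) -
      pr J (fun a => 1 / (a : ℝ)) (fun A => EqualSums A K)| ≤ ∑ a ∈ J, |q a - 1 / (a : ℝ)| :=
    abs_bern_sub_bern_le J hq0 hq1 (fun a _ => by positivity) (fun a _ => one_div_natCast_le_one a)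
      _ (fun S => by split_ifs <;> norm_num) (fun S => by split_ifs <;> norm_num)
  have step3 : ∑ a ∈ J, |q a - 1 / (a : ℝ)| ≤ 6 / u + C * (1 + Real.log v) / s := by
    have hJpos : ∀ a ∈ J, u ≤ a := fun a ha => ((mem_natsIn hv0).1 ha).1
    have e1 : ∑ a ∈ J, ((a : ℝ) ^ 2)⁻¹ ≤ 2 / u := by
      have hc : 0 < ⌈u⌉₊ := Nat.ceil_pos.2 (by linarith)
      calc ∑ a ∈ J, ((a : ℝ) ^ 2)⁻¹ ≤ ∑ a ∈ Finset.Ioo (⌈u⌉₊ - 1) (⌊v⌋₊ + 1), ((a : ℝ) ^ 2)⁻¹ := by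
            refine Finset.sum_le_sum_of_subset_of_nonneg (fun a ha => ?_) fun _ _ _ => by positivity
            have h2 := (mem_natsIn hv0).1 ha
            have h3 := Nat.ceil_le.2 h2.1
            have h4 := Nat.le_floor h2.2
            rw [Finset.mem_Ioo]
            omega
        _ ≤ 2 / (((⌈u⌉₊ - 1 : ℕ) : ℝ) + 1) := sum_Ioo_inv_sq_le _ _
        _ ≤ 2 / u := by
            rw [Nat.cast_sub hc, Nat.cast_one, sub_add_cancel]
            exact div_le_div_of_nonneg_left (by norm_num) (by linarith) (Nat.le_ceil u)
    have e2 : ∑ a ∈ J, (a : ℝ)⁻¹ ≤ 1 + Real.log v := by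
      calc ∑ a ∈ J, (a : ℝ)⁻¹ ≤ ∑ a ∈ Finset.Icc 1 ⌊v⌋₊, (a : ℝ)⁻¹ := by
            refine Finset.sum_le_sum_of_subset_of_nonneg (fun a ha => ?_) fun _ _ _ => by positivity
            have h2 := (mem_natsIn hv0).1 ha
            rw [Finset.mem_Icc]
            refine ⟨?_, Nat.le_floor h2.2⟩
            have : (1 : ℝ) ≤ a := by linarith
            exact_mod_cast this
        _ = ((harmonic ⌊v⌋₊ : ℚ) : ℝ) := by
            rw [harmonic_eq_sum_Icc]
            push_cast
            rfl
        _ ≤ 1 + Real.log v := harmonic_floor_le_one_add_log v hv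
    calc ∑ a ∈ J, |q a - 1 / (a : ℝ)|
        ≤ ∑ a ∈ J, (3 * ((a : ℝ) ^ 2)⁻¹ + C / s * (a : ℝ)⁻¹) := by
          refine Finset.sum_le_sum fun a ha => ?_
          have hua := hJpos a ha
          have ha0 : (0 : ℝ) < a := by linarith
          have := hq s a hs (by exact_mod_cast ha0)
            (hus.trans (mul_le_mul_of_nonneg_right hua hs.le))
          refine this.trans_eq ?_
          field_simp
      _ = 3 * ∑ a ∈ J, ((a : ℝ) ^ 2)⁻¹ + C / s * ∑ a ∈ J, (a : ℝ)⁻¹ := by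
          rw [Finset.sum_add_distrib, Finset.mul_sum, Finset.mul_sum]
      _ ≤ 3 * (2 / u) + C / s * (1 + Real.log v) := by gcongr
      _ = _ := by ring
  have := (abs_le.1 step2).1
  linarith

/-- The set of primes in `[exp (exp t), exp (exp T))` in a random integer contains a large cluster
at the scale `exp t` with high probability. -/
theorem exists_pr_cluster_ge {k : ℕ} (hk : 2 ≤ k) {c c' : ℝ} (hc' : 0 < c') (hcc : c' < c)
    (hc1 : c < 1)
    (h : Tendsto (fun D : ℝ => randomSetLaw
      {A : Set ℕ | k ≤ subsumMultiplicity (A ∩ {a : ℕ | D ^ c ≤ (a : ℝ) ∧ (a : ℝ) ≤ D})})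
      atTop (𝓝 1)) {α ε : ℝ} (hα : 0 < α) (hε : 0 < ε) (hε1 : ε < 1) :
    ∀ᶠ T : ℝ in atTop, ∀ t : ℝ, α * T ≤ t → α * T ≤ T - t →
      3 / 4 ≤ pr (primesIn (Real.exp (Real.exp t)) (Real.exp (Real.exp T)))
        (fun p => 1 / ((p : ℝ) + 1))
        (Cluster (Real.exp t / (2 * T)) (T ^ (Real.log k / Real.log (1 / c') * (1 - ε)))) := by
  obtain ⟨C, hC, hcl⟩ := exists_pr_cluster_ge_sub
  have e1 : Tendsto (fun T : ℝ => C * (1 + T) * (2 * T) / Real.exp (α * T)) atTop (𝓝 0) := by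
    have h1 : Tendsto (fun T : ℝ => T ^ (1 : ℝ) * Real.exp (-α * T)) atTop (𝓝 0) :=
      tendsto_rpow_mul_exp_neg_mul_atTop_nhds_zero _ _ hα
    have h2 : Tendsto (fun T : ℝ => T ^ (2 : ℝ) * Real.exp (-α * T)) atTop (𝓝 0) :=
      tendsto_rpow_mul_exp_neg_mul_atTop_nhds_zero _ _ hα
    have h3 := (h1.const_mul (2 * C)).add (h2.const_mul (2 * C))
    simp only [mul_zero, add_zero] at h3
    refine h3.congr fun T => ?_
    rw [Real.rpow_one, Real.rpow_two, neg_mul, Real.exp_neg]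
    field_simp
  have e2 : ∀ᶠ T : ℝ in atTop, 2 ≤ Real.exp (α * T) :=
    (Real.tendsto_exp_atTop.comp (tendsto_id.const_mul_atTop hα)).eventually_ge_atTop 2
  filter_upwards [exists_pr_equalSums_natsIn_ge hk hc' hcc hc1 h hα hε hε1, eventually_ge_atTop 48,
    e1.eventually (gt_mem_nhds (show (0 : ℝ) < 1 / 16 by norm_num)), e2]
    with T hT hT48 hT1 hT2 t ht hτ
  have hT0 : 0 < T := by linarith
  obtain ⟨K, hK1, hK2⟩ := hT (T - t) hτ
  have het : Real.exp (α * T) ≤ Real.exp t := Real.exp_le_exp.2 ht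
  have hus : 2 * T * (Real.exp t / (2 * T)) = Real.exp t := by field_simp
  have hτ0 : 0 ≤ T - t := by nlinarith
  have hv1 : 1 ≤ Real.exp (T - t) := Real.one_le_exp hτ0
  -- The scale is s = e^t/(2T). Then u = 2T starts the blocks at log p = e^t, and v = e^(T-t) keeps
  -- them below e^T. The two errors are at most 1/16 each, and 7/8 - 1/16 - 1/16 = 3/4.
  have main := hcl (Real.exp t / (2 * T)) (2 * T) (Real.exp (T - t)) K (Real.exp (Real.exp t))
    (Real.exp (Real.exp T)) (by positivity) (by linarith) (by rw [hus]; linarith) hv1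
    (by rw [hus]) (by
      rw [Real.exp_le_exp]
      have : Real.exp T = Real.exp (T - t) * Real.exp t := by rw [← Real.exp_add]; ring_nf
      rw [this, ← mul_div_assoc, div_le_iff₀ (by linarith)]
      nlinarith [Real.exp_pos t, Real.exp_pos (T - t), mul_pos (Real.exp_pos t) (Real.exp_pos (T - t))])
  have e3 : 6 / (2 * T) ≤ 1 / 16 := by
    rw [div_le_div_iff₀ (by linarith) (by norm_num)]
    linarith
  have e4 : C * (1 + Real.log (Real.exp (T - t))) / (Real.exp t / (2 * T)) ≤ 1 / 16 := by
    rw [Real.log_exp, div_div_eq_mul_div]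
    refine le_trans ?_ hT1.le
    have ht0 : 0 ≤ t := le_trans (by positivity) ht
    gcongr
    linarith
  refine le_trans ?_ (pr_mono (fun a _ => by positivity) (fun a _ => inv_succ_le_one a)
    (P := Cluster (Real.exp t / (2 * T)) K) ?_)
  · linarith
  · rintro S _ ⟨F, h1, h2⟩
    exact ⟨F, hK1.trans h1, h2⟩

end PrimeClusters

/-! ### Poisson-type lower bounds for the cardinality of a random set -/

section CardinalityDistribution

/-- Second-order Taylor bound with the remainder evaluated at the right end `x + w`. That form lets
the remainder be cancelled in the induction of `le_factorial_mul_pr_card`. -/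
theorem add_pow_le_taylor {x w : ℝ} (hx : 0 ≤ x) (hw : 0 ≤ w) (n : ℕ) :
    (x + w) ^ (n + 2) ≤
      x ^ (n + 2) + (n + 2) * w * x ^ (n + 1) + (n + 2) * (n + 1) / 2 * w ^ 2 * (x + w) ^ n := by
  induction n with
  | zero => simp; nlinarith
  | succ n ih =>
    have h1 : x ^ (n + 1) ≤ (x + w) ^ (n + 1) := pow_le_pow_left₀ hx (by linarith) _
    have h2 := mul_le_mul_of_nonneg_right ih (add_nonneg hx hw)
    have h3 : (n + 2) * w ^ 2 * x ^ (n + 1) ≤ (n + 2) * w ^ 2 * (x + w) ^ (n + 1) :=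
      mul_le_mul_of_nonneg_left h1 (by positivity)
    have e1 : (x + w) ^ (n + 1 + 2) = (x + w) ^ (n + 2) * (x + w) := by ring
    have e2 : (x ^ (n + 2) + (n + 2) * w * x ^ (n + 1) +
        (n + 2) * (n + 1) / 2 * w ^ 2 * (x + w) ^ n) * (x + w) =
        x ^ (n + 3) + (n + 3) * w * x ^ (n + 2) + (n + 2) * w ^ 2 * x ^ (n + 1) +
        (n + 2) * (n + 1) / 2 * w ^ 2 * (x + w) ^ (n + 1) := by ring
    rw [e1]
    push_cast
    have e3 : ((n : ℝ) + 1 + 2) * (n + 1 + 1) / 2 * w ^ 2 * (x + w) ^ (n + 1) =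
        (n + 2) * w ^ 2 * (x + w) ^ (n + 1) + (n + 2) * (n + 1) / 2 * w ^ 2 * (x + w) ^ (n + 1) := by
      ring
    have e4 : ((n : ℝ) + 1 + 2) = n + 3 := by ring
    have e5 : x ^ (n + 1 + 2) = x ^ (n + 3) := by ring
    rw [e3, e4, e5]
    linarith

theorem le_add_pow_bernoulli {x w : ℝ} (hx : 0 ≤ x) (hw : 0 ≤ w) (n : ℕ) :
    x ^ (n + 1) + (n + 1) * w * x ^ n ≤ (x + w) ^ (n + 1) := by
  induction n with
  | zero => simp
  | succ n ih =>
    have h2 := mul_le_mul_of_nonneg_right ih (add_nonneg hx hw)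
    have h3 : 0 ≤ (n + 1) * w ^ 2 * x ^ n := by positivity
    rw [pow_succ (x + w)]
    push_cast
    refine le_trans ?_ h2
    rw [← sub_nonneg]
    refine h3.trans_eq ?_
    ring

variable {α : Type*} [DecidableEq α]

theorem pr_card_succ_insert {U : Finset α} {a : α} (ha : a ∉ U) (q : α → ℝ) (j : ℕ) :
    pr (insert a U) q (fun S => S.card = j + 1) =
      (1 - q a) * pr U q (fun S => S.card = j + 1) + q a * pr U q (fun S => S.card = j) := by
  rw [pr, bern_insert ha]
  congr 2
  refine bern_congr fun S hS => ?_
  rw [Finset.card_insert_of_notMem fun h => ha (hS h)]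
  simp

theorem pr_card_zero (U : Finset α) (q : α → ℝ) :
    pr U q (fun S => S.card = 0) = ∏ a ∈ U, (1 - q a) := by
  induction U using Finset.induction_on with
  | empty => simp [pr, bern_empty]
  | insert a U ha ih =>
    rw [pr, bern_insert ha, Finset.prod_insert ha, ← ih]
    have h : bern U q (fun S => @ite ℝ ((insert a S).card = 0) (Classical.propDecidable _) 1 0) =
        0 := (bern_congr fun S _ => by simp).trans (bern_const U q 0)
    rw [h, mul_zero, add_zero, pr]

/-- A lower bound of Poisson type for the distribution of the cardinality of a random subset. -/
theorem le_factorial_mul_pr_card {U : Finset α} {q w : α → ℝ} (hq1 : ∀ a ∈ U, q a ≤ 1)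
    (hw : ∀ a ∈ U, 0 ≤ w a) (hqw : ∀ a ∈ U, q a = (1 - q a) * w a) (j : ℕ) :
    (∏ a ∈ U, (1 - q a)) * ((∑ a ∈ U, w a) ^ j -
        j * (j - 1) / 2 * (∑ a ∈ U, w a ^ 2) * (∑ a ∈ U, w a) ^ (j - 2)) ≤
      j.factorial * pr U q (fun S => S.card = j) := by
  induction U using Finset.induction_on generalizing j with
  | empty =>
    rcases j with _ | j
    · simp [pr, bern_empty]
    · simp [pr, bern_empty]
  | insert a U ha ih =>
    simp only [Finset.mem_insert, forall_eq_or_imp] at hq1 hw hqw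
    have ih := ih hq1.2 hw.2 hqw.2
    have hR : 0 ≤ ∏ a ∈ U, (1 - q a) := Finset.prod_nonneg fun b hb => sub_nonneg.2 (hq1.2 b hb)
    have hl : 0 ≤ ∑ a ∈ U, w a := Finset.sum_nonneg hw.2
    have hσ : 0 ≤ ∑ a ∈ U, w a ^ 2 := Finset.sum_nonneg fun b _ => sq_nonneg _
    rcases j with _ | j
    · simp only [pr_card_zero]
      simp
    rw [pr_card_succ_insert ha, Finset.prod_insert ha, Finset.sum_insert ha, Finset.sum_insert ha]
    have h1 := ih (j + 1)
    have h2 := ih j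
    set R := ∏ a ∈ U, (1 - q a)
    set l := ∑ a ∈ U, w a
    set σ := ∑ a ∈ U, w a ^ 2
    have hwa := hw.1
    have hqa : 0 ≤ 1 - q a := sub_nonneg.2 hq1.1
    -- Up to the factor ∏(1 - q), the probability is the j-th elementary symmetric function of the
    -- odds `w`. Adjoining `a` creates a second-order Taylor term in `w a`, absorbed by the new
    -- summand `w a ^ 2` of the quadratic correction; Bernoulli's inequality handles the old part
    -- `σ`.
    have key : ((w a + l) ^ (j + 1) -
        ((j + 1 : ℕ) : ℝ) * (((j + 1 : ℕ) : ℝ) - 1) / 2 * (w a ^ 2 + σ) * (w a + l) ^ (j + 1 - 2)) ≤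
        (l ^ (j + 1) - ((j + 1 : ℕ) : ℝ) * (((j + 1 : ℕ) : ℝ) - 1) / 2 * σ * l ^ (j + 1 - 2)) +
        (j + 1) * w a * (l ^ j - j * (j - 1) / 2 * σ * l ^ (j - 2)) := by
      rcases j with _ | _ | i
      · simp; linarith
      · simp; nlinarith
      · have t1 := add_pow_le_taylor hl hwa (i + 1)
        have t2 := le_add_pow_bernoulli hl hwa i
        have t3 : 0 ≤ ((i : ℝ) + 3) * (i + 2) / 2 * σ := by positivity
        have t4 := mul_le_mul_of_nonneg_left t2 t3
        simp only [show i + 1 + 1 + 1 - 2 = i + 1 by omega, show i + 1 + 1 - 2 = i by omega]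
        rw [add_comm (w a) l]
        push_cast at t1 ⊢
        simp only [show i + 1 + 2 = i + 3 by omega, show i + 1 + 1 = i + 2 by omega] at t1 ⊢
        rw [← sub_nonneg] at t1 t4 ⊢
        refine (add_nonneg t1 t4).trans_eq ?_
        ring
    have hpr : ((j + 1).factorial : ℝ) * ((1 - q a) * pr U q (fun S => S.card = j + 1) +
        q a * pr U q (fun S => S.card = j)) =
        (1 - q a) * (((j + 1).factorial : ℝ) * pr U q (fun S => S.card = j + 1) +
        (j + 1) * w a * ((j.factorial : ℝ) * pr U q (fun S => S.card = j))) := by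
      rw [hqw.1, Nat.factorial_succ]
      have e := hqw.1
      push_cast
      generalize pr U q (fun S => S.card = j + 1) = P1
      generalize pr U q (fun S => S.card = j) = P0
      have e2 : (1 - (1 - q a) * w a) = 1 - q a := by rw [← e]
      rw [e2]
      ring
    rw [hpr, mul_assoc]
    refine mul_le_mul_of_nonneg_left ?_ hqa
    have h3 := mul_le_mul_of_nonneg_left key hR
    have h4 := mul_le_mul_of_nonneg_left h2 (show 0 ≤ (j + 1) * w a by positivity)
    refine h3.trans ?_
    rw [mul_add]
    refine add_le_add h1 (le_trans (le_of_eq ?_) h4)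
    ring

theorem factorial_le_stirling {n : ℕ} (hn : n ≠ 0) :
    (n.factorial : ℝ) ≤ Real.exp 1 * Real.sqrt n * (n / Real.exp 1) ^ n := by
  obtain ⟨m, rfl⟩ := Nat.exists_eq_succ_of_ne_zero hn
  have h := Stirling.stirlingSeq'_antitone (Nat.zero_le m)
  simp only [Function.comp_apply, Nat.succ_eq_add_one, zero_add] at h
  rw [Stirling.stirlingSeq_one, Stirling.stirlingSeq, div_le_iff₀ (by positivity)] at h
  refine h.trans_eq ?_
  rw [Real.sqrt_mul (by norm_num), Nat.succ_eq_add_one]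
  field_simp

/-- Stirling's upper bound for j! leaves the exponent -l + j - j log(j/l), and log(j/l) ≤ j/l - 1
turns this into at least -(j - l)²/l. -/
theorem exp_neg_sq_div_le_poisson {l : ℝ} (hl : 0 < l) {j : ℕ} (hj : j ≠ 0) :
    Real.exp (-(j - l) ^ 2 / l) / (Real.exp 1 * Real.sqrt j) ≤
      Real.exp (-l) * l ^ j / j.factorial := by
  have hj0 : (0 : ℝ) < j := by exact_mod_cast Nat.pos_of_ne_zero hj
  have h1 := factorial_le_stirling hj
  have h2 : Real.exp (-(j - l) ^ 2 / l) * ((j : ℝ) / Real.exp 1) ^ j ≤ Real.exp (-l) * l ^ j := by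
    have e1 : ((j : ℝ) / Real.exp 1) ^ j = Real.exp (j * Real.log j - j) := by
      rw [div_pow, ← Real.exp_nat_mul, Real.exp_sub, mul_comm (j : ℝ) (Real.log j), mul_one]
      rw [mul_comm (Real.log j), Real.exp_nat_mul, Real.exp_log hj0]
    have e2 : l ^ j = Real.exp (j * Real.log l) := by
      rw [Real.exp_nat_mul, Real.exp_log hl]
    rw [e1, e2, ← Real.exp_add, ← Real.exp_add, Real.exp_le_exp]
    have h3 : Real.log j - Real.log l ≤ j / l - 1 := by
      rw [← Real.log_div hj0.ne' hl.ne']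
      exact Real.log_le_sub_one_of_pos (by positivity)
    have h4 := mul_le_mul_of_nonneg_left h3 hj0.le
    have h5 : -(j - l) ^ 2 / l = -(j * (j / l)) + 2 * j - l := by field_simp; ring
    rw [h5]
    linarith
  rw [div_le_div_iff₀ (by positivity) (by exact_mod_cast j.factorial_pos)]
  calc Real.exp (-(j - l) ^ 2 / l) * j.factorial
      ≤ Real.exp (-(j - l) ^ 2 / l) * (Real.exp 1 * Real.sqrt j * (j / Real.exp 1) ^ j) := by gcongr
    _ = (Real.exp (-(j - l) ^ 2 / l) * (j / Real.exp 1) ^ j) * (Real.exp 1 * Real.sqrt j) := by ring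
    _ ≤ _ := by gcongr

end CardinalityDistribution

/-! ### Primes with doubled odds: local bounds and large deviations -/

section TiltedPrimes

theorem one_le_log_of_three_le {u : ℝ} (hu : 3 ≤ u) : 1 ≤ Real.log u := by
  rw [Real.le_log_iff_exp_le (by linarith)]
  linarith [Real.exp_one_lt_d9]

/-- The reason for discarding primes below 17: the quadratic correction in the Poisson-type bound
then costs at most half of the main term. -/
theorem sum_inv_sq_primesIn_le_one_div_sixteen {u : ℝ} (hu : 17 ≤ u) (v : ℝ) :
    ∑ p ∈ primesIn u v, 1 / (p : ℝ) ^ 2 ≤ 1 / 16 := by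
  refine (sum_inv_sq_primesIn_le (by linarith) v).trans ?_
  exact one_div_le_one_div_of_le (by norm_num) (by linarith)

theorem pos_of_mem_primesIn {u v : ℝ} : ∀ p ∈ primesIn u v, 0 < p :=
  fun _ hp => (mem_primesIn.1 hp).1.pos

/-- Mertens' second theorem with a bounded error. -/
theorem exists_abs_sum_inv_primesIn_sub_le_const : ∃ C : ℝ, 1 ≤ C ∧ ∀ u v : ℝ, 3 ≤ u → u ≤ v →
    |∑ p ∈ primesIn u v, 1 / (p : ℝ) - (Real.log (Real.log v) - Real.log (Real.log u))| ≤ C := by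
  obtain ⟨C, hC, h⟩ := exists_abs_sum_inv_primesIn_sub_le
  refine ⟨C, hC, fun u v hu huv => (h u v hu huv).trans ?_⟩
  exact div_le_self (by linarith) (one_le_log_of_three_le hu)

/-- The product is the mean of 2^ω over primes in [17, y), the normalising constant of the tilt.
Each factor is at least exp(1/(p+1) - 1/p²), and Mertens' theorem sums the exponents. -/
theorem exists_le_prod_one_add_inv_succ : ∃ c : ℝ, 0 < c ∧ ∀ y : ℝ, 17 ≤ y →
    c * Real.log y ≤ ∏ p ∈ primesIn 17 y, (1 + 1 / ((p : ℝ) + 1)) := by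
  obtain ⟨C, -, h⟩ := exists_abs_sum_inv_primesIn_sub_le_const
  refine ⟨Real.exp (-Real.log (Real.log 17) - C - 1), Real.exp_pos _, fun y hy => ?_⟩
  have hly : 0 < Real.log y := by linarith [one_le_log_of_three_le (by linarith : 3 ≤ y)]
  have h1 := (abs_le.1 (h 17 y (by norm_num) hy)).1
  have h2 := sum_inv_sq_primesIn_le_one_div_sixteen le_rfl y
  have h3 := sum_inv_sub_sum_inv_sq_le _ (pos_of_mem_primesIn (u := 17) (v := y))
  have h4 : Real.exp (∑ p ∈ primesIn 17 y, (1 / ((p : ℝ) + 1) - 1 / (p : ℝ) ^ 2)) ≤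
      ∏ p ∈ primesIn 17 y, (1 + 1 / ((p : ℝ) + 1)) := by
    rw [Real.exp_sum]
    refine Finset.prod_le_prod (fun p _ => (Real.exp_pos _).le) fun p hp => ?_
    have hp0 : (0 : ℝ) < p := by exact_mod_cast pos_of_mem_primesIn p hp
    rw [← Real.le_log_iff_exp_le (by positivity)]
    refine le_trans ?_ (Real.one_sub_inv_le_log_of_pos (by positivity))
    rw [← sub_nonneg]
    have e : 1 - (1 + 1 / ((p : ℝ) + 1))⁻¹ - (1 / ((p : ℝ) + 1) - 1 / (p : ℝ) ^ 2) =
        (3 * p + 2) / ((p + 1) * (p + 2) * p ^ 2) := by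
      field_simp
      ring
    rw [e]
    positivity
  refine le_trans ?_ h4
  rw [Finset.sum_sub_distrib]
  nth_rewrite 1 [← Real.exp_log hly]
  rw [← Real.exp_add, Real.exp_le_exp]
  linarith

theorem tilted_weight_nonneg (p : ℕ) : 0 ≤ 2 / ((p : ℝ) + 2) := by positivity

theorem tilted_weight_le_one (p : ℕ) : 2 / ((p : ℝ) + 2) ≤ 1 :=
  div_le_one_of_le₀ (by linarith [Nat.cast_nonneg (α := ℝ) p]) (by positivity)

/-- Local lower bound for the number of prime factors under the tilted measure. -/
theorem exists_pr_card_tilted_ge {α : ℝ} (hα : 0 < α) : ∃ c : ℝ, 0 < c ∧ ∀ᶠ T : ℝ in atTop,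
    ∀ t : ℝ, α * T ≤ t → t ≤ T → ∀ j : ℕ, |(j : ℝ) - 2 * t| ≤ 6 * Real.sqrt T →
      c / Real.sqrt T ≤ pr (primesIn 17 (Real.exp (Real.exp t))) (fun p => 2 / ((p : ℝ) + 2))
        (fun S => S.card = j) := by
  obtain ⟨C₀, hC₀, hM⟩ := exists_abs_sum_inv_primesIn_sub_le_const
  set C := 2 * C₀ + 2 * Real.log (Real.log 17) with hCdef
  have hl17 : 0 ≤ Real.log (Real.log 17) :=
    Real.log_nonneg (one_le_log_of_three_le (by norm_num))
  have hC : 0 ≤ C := by linarith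
  refine ⟨Real.exp (-(49 / α)) / (2 * (Real.exp 1 * 3)), by positivity, ?_⟩
  have hsq : Tendsto Real.sqrt atTop atTop := Real.tendsto_sqrt_atTop
  have hexp : ∀ᶠ T : ℝ in atTop, Real.log 17 ≤ Real.exp (α * T) :=
    (Real.tendsto_exp_atTop.comp (tendsto_id.const_mul_atTop hα)).eventually_ge_atTop _
  filter_upwards [eventually_ge_atTop 1, hsq.eventually_ge_atTop C, hsq.eventually_ge_atTop 7,
    hsq.eventually_ge_atTop (14 / α), hexp] with T hT1 hTC hT7 hT14 hT17 t ht htT j hj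
  have hT0 : 0 < T := by linarith
  set R := Real.sqrt T with hR
  have hR0 : 0 < R := by linarith
  have hRT : R * R = T := Real.mul_self_sqrt hT0.le
  have hαR : 14 * R ≤ α * T := by
    rw [div_le_iff₀ hα] at hT14
    have := mul_le_mul_of_nonneg_right hT14 hR0.le
    rw [← hRT]
    linarith
  have hRle : R ≤ T := by
    rw [← hRT]
    exact le_mul_of_one_le_right hR0.le (by linarith)
  have ht17 : Real.log 17 ≤ Real.exp t := hT17.trans (Real.exp_le_exp.2 ht)
  set y := Real.exp (Real.exp t) with hy
  have hy17 : 17 ≤ y := by rwa [hy, ← Real.log_le_iff_le_exp (by norm_num)]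
  have hm := hM 17 y (by norm_num) hy17
  rw [hy, Real.log_exp, Real.log_exp, ← hy, abs_le] at hm
  set l := ∑ p ∈ primesIn 17 y, 2 / (p : ℝ) with hl
  have hl2 : l = 2 * ∑ p ∈ primesIn 17 y, 1 / (p : ℝ) := by
    rw [hl, Finset.mul_sum]
    exact Finset.sum_congr rfl fun p _ => by ring
  have hlt : |l - 2 * t| ≤ C := by
    rw [abs_le]
    constructor <;> linarith [hm.1, hm.2]
  have hjl : |(j : ℝ) - l| ≤ 7 * R := by
    have := abs_sub_le (j : ℝ) (2 * t) l
    rw [abs_sub_comm (2 * t) l] at this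
    linarith
  have hlR : α * T ≤ l := by
    have := (abs_le.1 hlt).1
    linarith
  have hl0 : 0 < l := lt_of_lt_of_le (by positivity) hlR
  have hj' := abs_le.1 hjl
  have hjpos : (0 : ℝ) < j := by linarith
  have hj2l : (j : ℝ) ≤ 2 * l := by linarith
  have hjT : (j : ℝ) ≤ 9 * T := by
    have := (abs_le.1 hj).2
    linarith
  have hσ : ∑ p ∈ primesIn 17 y, (2 / (p : ℝ)) ^ 2 ≤ 1 / 4 := by
    have h1 := sum_inv_sq_primesIn_le_one_div_sixteen le_rfl y
    have h2 : ∑ p ∈ primesIn 17 y, (2 / (p : ℝ)) ^ 2 =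
        4 * ∑ p ∈ primesIn 17 y, 1 / (p : ℝ) ^ 2 := by
      rw [Finset.mul_sum]
      exact Finset.sum_congr rfl fun p _ => by ring
    linarith
  have hσ0 : 0 ≤ ∑ p ∈ primesIn 17 y, (2 / (p : ℝ)) ^ 2 := Finset.sum_nonneg fun _ _ => sq_nonneg _
  -- The weight 2/(p+2) has odds 2/p, so the Poisson parameter is `l`, which is 2t + O(1).
  have main := le_factorial_mul_pr_card (U := primesIn 17 y) (q := fun p => 2 / ((p : ℝ) + 2))
    (w := fun p => 2 / (p : ℝ)) (fun p _ => tilted_weight_le_one p) (fun p _ => by positivity)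
    (fun p hp => by
      have hp0 : (0 : ℝ) < p := by exact_mod_cast pos_of_mem_primesIn p hp
      field_simp
      ring) j
  rw [← hl] at main
  set P := pr (primesIn 17 y) (fun p => 2 / ((p : ℝ) + 2)) (fun S => S.card = j)
  have hprod : Real.exp (-l) ≤ ∏ p ∈ primesIn 17 y, (1 - 2 / ((p : ℝ) + 2)) := by
    rw [hl, ← Finset.sum_neg_distrib, Real.exp_sum]
    refine Finset.prod_le_prod (fun p _ => (Real.exp_pos _).le) fun p hp => ?_
    have hp0 : (0 : ℝ) < p := by exact_mod_cast pos_of_mem_primesIn p hp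
    have h1 : 1 - 2 / ((p : ℝ) + 2) = (1 + 2 / (p : ℝ))⁻¹ := by field_simp; ring
    rw [h1, Real.exp_neg]
    refine inv_anti₀ (by positivity) ?_
    have := Real.add_one_le_exp (2 / (p : ℝ))
    linarith
  -- From j ≤ 2l and σ ≤ 1/4 the correction is at most (2l)²/2 · 1/4 = l²/2 times `l ^ (j - 2)`. The
  -- case j < 2 is separate because of truncated subtraction; there the correction vanishes.
  have hquad : l ^ j / 2 ≤ l ^ j -
      j * (j - 1) / 2 * (∑ p ∈ primesIn 17 y, (2 / (p : ℝ)) ^ 2) * l ^ (j - 2) := by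
    rcases Nat.lt_or_ge j 2 with h2 | h2
    · have : (j : ℝ) * (j - 1) = 0 := by
        interval_cases j <;> simp
      rw [this]
      have := pow_pos hl0 j
      linarith
    · have e : l ^ j = l ^ 2 * l ^ (j - 2) := by rw [← pow_add]; congr 1; omega
      have h3 : (j : ℝ) * (j - 1) / 2 * (∑ p ∈ primesIn 17 y, (2 / (p : ℝ)) ^ 2) ≤ l ^ 2 / 2 := by
        calc _ ≤ (2 * l) * (2 * l) / 2 * (1 / 4) := by
              gcongr
              · have : (2 : ℝ) ≤ j := by exact_mod_cast h2
                linarith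
              · linarith
          _ = l ^ 2 / 2 := by ring
      have h4 := mul_le_mul_of_nonneg_right h3 (pow_nonneg hl0.le (j - 2))
      rw [e]
      linarith
  have hfac : (0 : ℝ) < j.factorial := by exact_mod_cast j.factorial_pos
  have h5 : Real.exp (-l) * (l ^ j / 2) ≤ j.factorial * P := by
    refine le_trans ?_ main
    exact mul_le_mul hprod hquad (by positivity) ((Real.exp_pos _).le.trans hprod)
  have h6 := exp_neg_sq_div_le_poisson hl0 (j := j) (by
    rintro rfl
    simp at hjpos)
  -- Both |j - l| ≤ 7√T and l ≥ αT enter here: this is the Gaussian factor a bounded number of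
  -- standard deviations from the mean.
  have h7 : Real.exp (-(49 / α)) ≤ Real.exp (-(j - l) ^ 2 / l) := by
    rw [Real.exp_le_exp, neg_div, neg_le_neg_iff, div_le_div_iff₀ hl0 hα]
    have h9 : ((j : ℝ) - l) ^ 2 ≤ 49 * T := by
      have : ((j : ℝ) - l) ^ 2 ≤ (7 * R) ^ 2 := sq_le_sq' (by linarith) (by linarith)
      rw [← hRT]
      linarith
    linarith [mul_le_mul_of_nonneg_right h9 hα.le]
  have h8 : Real.sqrt j ≤ 3 * R := by
    rw [Real.sqrt_le_left (by positivity), mul_pow, sq R, hRT]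
    linarith
  calc Real.exp (-(49 / α)) / (2 * (Real.exp 1 * 3)) / R
      = Real.exp (-(49 / α)) / (Real.exp 1 * (3 * R)) / 2 := by field_simp
    _ ≤ Real.exp (-(j - l) ^ 2 / l) / (Real.exp 1 * Real.sqrt j) / 2 := by gcongr
    _ ≤ (Real.exp (-l) * l ^ j / j.factorial) / 2 := by gcongr
    _ = Real.exp (-l) * (l ^ j / 2) / j.factorial := by ring
    _ ≤ P := by rw [div_le_iff₀ hfac]; linarith

/-- Rankin's bound for the size of the product of the small primes. -/
theorem pr_sum_log_tilted_le {y : ℝ} (hy : 17 ≤ y) (K : ℝ) :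
    pr (primesIn 17 y) (fun p => 2 / ((p : ℝ) + 2))
      (fun S => K * Real.log y ≤ ∑ p ∈ S, Real.log p) ≤ Real.exp 12 * Real.exp (-K) := by
  have hly : Real.log 4 ≤ Real.log y := Real.log_le_log (by norm_num) (by linarith)
  have hl4 : 0 < Real.log 4 := Real.log_pos (by norm_num)
  set L := Real.log y with hL
  have hL0 : 0 < L := by linarith
  have h1 := pr_le_bern_div (U := primesIn 17 y) (q := fun p => 2 / ((p : ℝ) + 2))
    (fun p _ => tilted_weight_nonneg p) (fun p _ => tilted_weight_le_one p)
    (P := fun S => K * L ≤ ∑ p ∈ S, Real.log p)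
    -- Rankin's weight p^(1/log y): each prime below y contributes a bounded factor, and ∑ log p / p
    -- ≤ 2 log y makes the whole mean at most e^12.
    (f := fun S => ∏ p ∈ S, Real.exp (Real.log p / L))
    (fun S _ => Finset.prod_nonneg fun p _ => (Real.exp_pos _).le) (Real.exp_pos K)
    (fun S _ h => by
      rw [← Real.exp_sum, Real.exp_le_exp, ← Finset.sum_div, le_div_iff₀ hL0]
      exact h)
  rw [bern_prod] at h1
  refine h1.trans ?_
  rw [Real.exp_neg, div_eq_mul_inv]
  refine mul_le_mul_of_nonneg_right ?_ (by positivity)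
  calc ∏ p ∈ primesIn 17 y, (1 - 2 / ((p : ℝ) + 2) + 2 / ((p : ℝ) + 2) * Real.exp (Real.log p / L))
      ≤ ∏ p ∈ primesIn 17 y, Real.exp (6 / L * (Real.log p / p)) := by
        refine Finset.prod_le_prod (fun p _ => ?_) fun p hp => ?_
        · have := tilted_weight_le_one p
          have h2 : 0 ≤ 2 / ((p : ℝ) + 2) * Real.exp (Real.log p / L) := by positivity
          linarith
        · have hp' := mem_primesIn.1 hp
          have hp0 : (0 : ℝ) < p := by exact_mod_cast hp'.1.pos
          set z := Real.log p / L with hz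
          have hz0 : 0 ≤ z := div_nonneg (Real.log_natCast_nonneg p) hL0.le
          have hz1 : z ≤ 1 := div_le_one_of_le₀ (Real.log_le_log hp0 hp'.2.2.le) hL0.le
          have hez : Real.exp z - 1 ≤ 3 * z := by
            have h2 : Real.exp z * (1 - z) ≤ 1 := by
              have h3 := Real.add_one_le_exp (-z)
              have h4 : Real.exp z * Real.exp (-z) = 1 := by rw [← Real.exp_add]; simp
              rw [← h4]
              exact mul_le_mul_of_nonneg_left (by linarith) (Real.exp_pos _).le
            have h3 : Real.exp z ≤ 3 := by
              have := Real.exp_le_exp.2 hz1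
              linarith [Real.exp_one_lt_d9]
            nlinarith
          have h5 : 2 / ((p : ℝ) + 2) ≤ 2 / p :=
            div_le_div_of_nonneg_left (by norm_num) hp0 (by linarith)
          have h6 : 2 / ((p : ℝ) + 2) * (Real.exp z - 1) ≤ 2 / p * (3 * z) := by
            refine mul_le_mul h5 hez ?_ (by positivity)
            linarith [Real.one_le_exp hz0]
          have h7 : 6 / L * (Real.log p / p) = 2 / p * (3 * z) := by rw [hz]; field_simp; ring
          rw [h7]
          have := Real.add_one_le_exp (2 / p * (3 * z))
          linarith
    _ = Real.exp (6 / L * ∑ p ∈ primesIn 17 y, Real.log p / p) := by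
        rw [← Real.exp_sum, Finset.mul_sum]
    _ ≤ Real.exp 12 := by
        rw [Real.exp_le_exp]
        have h2 := sum_log_div_primesIn_le (u := 17) (v := y) (by linarith)
        calc 6 / L * ∑ p ∈ primesIn 17 y, Real.log p / p ≤ 6 / L * (2 * L) := by
              gcongr
              linarith
          _ = 12 := by field_simp; norm_num

theorem sqrt_two_bounds : 1.414 ≤ Real.sqrt 2 ∧ Real.sqrt 2 ≤ 1.415 := by
  constructor
  · exact Real.le_sqrt_of_sq_le (by norm_num)
  · rw [Real.sqrt_le_left (by norm_num)]; norm_num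

theorem exp_half_log_two : Real.exp (Real.log 2 / 2) = Real.sqrt 2 := by
  rw [Real.sqrt_eq_rpow, Real.rpow_def_of_pos (by norm_num)]
  congr 1
  ring

/-- Large deviations: few prime factors under the tilted measure are unlikely. -/
theorem exists_pr_card_tilted_lower_tail_le : ∃ C : ℝ, 0 < C ∧ ∀ u v : ℝ, 17 ≤ u → u ≤ v →
    pr (primesIn u v) (fun p => 2 / ((p : ℝ) + 2)) (fun S => S.card * Real.log 2 ≤
      Real.log (Real.log v) - Real.log (Real.log u)) ≤
      C * Real.exp (-(Real.log (Real.log v) - Real.log (Real.log u)) / 20) := by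
  obtain ⟨C, hC, hM⟩ := exists_abs_sum_inv_primesIn_sub_le_const
  refine ⟨Real.exp (2 * C + 1), Real.exp_pos _, fun u v hu huv => ?_⟩
  have hm := (abs_le.1 (hM u v (by linarith) huv)).1
  have hlu := one_le_log_of_three_le (by linarith : 3 ≤ u)
  have hτ : 0 ≤ Real.log (Real.log v) - Real.log (Real.log u) :=
    sub_nonneg.2 (Real.log_le_log (by linarith) (Real.log_le_log (by linarith) huv))
  set τ := Real.log (Real.log v) - Real.log (Real.log u)
  obtain ⟨hs1, hs2⟩ := sqrt_two_bounds
  set s := Real.sqrt 2 with hs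
  have hs0 : 0 < s := by linarith
  -- Chernoff with base 2^(-1/2): the mean is about 2τ and the threshold τ/log 2, so the exponent is
  -- -2(1 - 2^(-1/2))τ + τ/2, about -0.086τ and hence below -τ/20 up to a constant.
  have h1 := pr_le_bern_div (U := primesIn u v) (q := fun p => 2 / ((p : ℝ) + 2))
    (fun p _ => tilted_weight_nonneg p) (fun p _ => tilted_weight_le_one p)
    (P := fun S => S.card * Real.log 2 ≤ τ)
    (f := fun S => ∏ p ∈ S, s⁻¹)
    (fun S _ => Finset.prod_nonneg fun p _ => by positivity) (Real.exp_pos (-τ / 2))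
    (fun S _ h => by
      rw [Finset.prod_const, hs, ← exp_half_log_two, ← Real.exp_neg, ← Real.exp_nat_mul,
        Real.exp_le_exp]
      linarith)
  rw [bern_prod] at h1
  refine h1.trans ?_
  rw [div_le_iff₀ (Real.exp_pos _), ← Real.exp_add, ← Real.exp_add]
  have h2 : ∑ p ∈ primesIn u v, (2 / (p : ℝ) - 4 / (p : ℝ) ^ 2) ≤
      ∑ p ∈ primesIn u v, 2 / ((p : ℝ) + 2) := by
    refine Finset.sum_le_sum fun p hp => ?_
    have hp0 : (0 : ℝ) < p := by exact_mod_cast pos_of_mem_primesIn p hp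
    rw [div_sub_div _ _ hp0.ne' (by positivity), div_le_div_iff₀ (by positivity) (by positivity)]
    nlinarith
  have h3 : ∑ p ∈ primesIn u v, (2 / (p : ℝ) - 4 / (p : ℝ) ^ 2) =
      2 * ∑ p ∈ primesIn u v, 1 / (p : ℝ) - 4 * ∑ p ∈ primesIn u v, 1 / (p : ℝ) ^ 2 := by
    rw [Finset.mul_sum, Finset.mul_sum, ← Finset.sum_sub_distrib]
    exact Finset.sum_congr rfl fun p _ => by ring
  have h4 := sum_inv_sq_primesIn_le_one_div_sixteen hu v
  have hsi : 1 - s⁻¹ ≤ 1 ∧ 0.29 ≤ 1 - s⁻¹ := by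
    have e1 : 0 < s⁻¹ := by positivity
    have e2 : s⁻¹ ≤ 0.71 := by
      rw [inv_le_comm₀ hs0 (by norm_num)]
      norm_num at hs1 ⊢
      linarith
    constructor <;> linarith
  calc ∏ p ∈ primesIn u v, (1 - 2 / ((p : ℝ) + 2) + 2 / ((p : ℝ) + 2) * s⁻¹)
      = ∏ p ∈ primesIn u v, (1 - (1 - s⁻¹) * (2 / ((p : ℝ) + 2))) :=
        Finset.prod_congr rfl fun p _ => by ring
    _ ≤ Real.exp (-∑ p ∈ primesIn u v, (1 - s⁻¹) * (2 / ((p : ℝ) + 2))) := by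
        refine prod_one_sub_le_exp _ _ fun p _ => ?_
        have := tilted_weight_nonneg p
        have := tilted_weight_le_one p
        nlinarith [hsi.1, hsi.2]
    _ ≤ Real.exp (2 * C + 1 + -τ / 20 + -τ / 2) := by
        rw [Real.exp_le_exp, ← Finset.mul_sum]
        set X := ∑ p ∈ primesIn u v, 2 / ((p : ℝ) + 2)
        have h5 : 2 * τ - 2 * C - 1 / 4 ≤ X := by linarith
        have h6 := mul_le_mul_of_nonneg_left h5 (by linarith [hsi.2] : 0 ≤ 1 - s⁻¹)
        have h7 : (1 - s⁻¹) * (2 * C + 1 / 4) ≤ 1 * (2 * C + 1 / 4) :=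
          mul_le_mul_of_nonneg_right hsi.1 (by linarith)
        have h8 : 0.29 * (2 * τ) ≤ (1 - s⁻¹) * (2 * τ) :=
          mul_le_mul_of_nonneg_right hsi.2 (by linarith)
        nlinarith

/-- Large deviations: many prime factors are unlikely. -/
theorem exists_pr_card_upper_tail_le : ∃ C : ℝ, 0 < C ∧ ∀ u v : ℝ, 17 ≤ u → u ≤ v →
    pr (primesIn u v) (fun p => 1 / ((p : ℝ) + 1)) (fun S =>
      Real.log (Real.log v) - Real.log (Real.log u) ≤ S.card * Real.log 2) ≤
      C * Real.exp (-(Real.log (Real.log v) - Real.log (Real.log u)) / 20) := by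
  obtain ⟨C, hC, hM⟩ := exists_abs_sum_inv_primesIn_sub_le_const
  refine ⟨Real.exp C, Real.exp_pos _, fun u v hu huv => ?_⟩
  have hm := (abs_le.1 (hM u v (by linarith) huv)).2
  have hlu := one_le_log_of_three_le (by linarith : 3 ≤ u)
  have hτ : 0 ≤ Real.log (Real.log v) - Real.log (Real.log u) :=
    sub_nonneg.2 (Real.log_le_log (by linarith) (Real.log_le_log (by linarith) huv))
  set τ := Real.log (Real.log v) - Real.log (Real.log u)
  obtain ⟨hs1, hs2⟩ := sqrt_two_bounds
  set s := Real.sqrt 2 with hs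
  -- Chernoff with base √2: the mean is about τ, below the threshold τ/log 2, and (√2 - 1)τ - τ/2 is
  -- again about -0.086τ.
  have h1 := pr_le_bern_div (U := primesIn u v) (q := fun p => 1 / ((p : ℝ) + 1))
    (fun p _ => by positivity) (fun p _ => inv_succ_le_one p)
    (P := fun S => τ ≤ S.card * Real.log 2)
    (f := fun S => ∏ p ∈ S, s)
    (fun S _ => Finset.prod_nonneg fun p _ => by positivity) (Real.exp_pos (τ / 2))
    (fun S _ h => by
      rw [Finset.prod_const, hs, ← exp_half_log_two, ← Real.exp_nat_mul, Real.exp_le_exp]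
      linarith)
  rw [bern_prod] at h1
  refine h1.trans ?_
  rw [div_le_iff₀ (Real.exp_pos _), ← Real.exp_add, ← Real.exp_add]
  have h2 := sum_inv_succ_le_sum_inv _ (pos_of_mem_primesIn (u := u) (v := v))
  calc ∏ p ∈ primesIn u v, (1 - 1 / ((p : ℝ) + 1) + 1 / ((p : ℝ) + 1) * s)
      ≤ ∏ p ∈ primesIn u v, Real.exp ((s - 1) * (1 / ((p : ℝ) + 1))) := by
        refine Finset.prod_le_prod (fun p _ => ?_) fun p _ => ?_
        · have := inv_succ_le_one p
          have : 0 ≤ 1 / ((p : ℝ) + 1) * s := by positivity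
          linarith
        · have := Real.add_one_le_exp ((s - 1) * (1 / ((p : ℝ) + 1)))
          linarith
    _ = Real.exp ((s - 1) * ∑ p ∈ primesIn u v, 1 / ((p : ℝ) + 1)) := by
        rw [← Real.exp_sum, Finset.mul_sum]
    _ ≤ Real.exp (C + -τ / 20 + τ / 2) := by
        rw [Real.exp_le_exp]
        set X := ∑ p ∈ primesIn u v, 1 / ((p : ℝ) + 1)
        have h5 : X ≤ τ + C := by linarith
        have h6 := mul_le_mul_of_nonneg_left h5 (by linarith : 0 ≤ s - 1)
        nlinarith

end TiltedPrimes

/-! ### From clusters of divisors to the Delta function -/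

section Divisors

/-- A set of divisors spread over a logarithmic window of length `R` forces a large value of
`hooleyDelta`. -/
theorem card_le_mul_hooleyDelta {n : ℕ} {D : Finset ℕ} (hD : D ⊆ n.divisors) {u R : ℝ}
    (hR : 0 ≤ R) (h : ∀ d ∈ D, u ≤ Real.log d ∧ Real.log d ≤ u + R) :
    (D.card : ℝ) ≤ (R + 2) * hooleyDelta n := by
  classical
  -- Windows are open on the left, so divisors with log d = u exactly need index 0 of their own;
  -- hence ⌈R⌉ + 1 pieces. Index i corresponds to the window starting at u - 1 + i.
  have hmaps : ∀ d ∈ D, ⌈Real.log d - u⌉₊ ∈ Finset.range (⌈R⌉₊ + 1) := by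
    intro d hd
    rw [Finset.mem_range, Nat.lt_succ_iff]
    exact Nat.ceil_mono (by linarith [(h d hd).2])
  have hfib : ∀ i ∈ Finset.range (⌈R⌉₊ + 1),
      (D.filter fun d : ℕ => ⌈Real.log d - u⌉₊ = i).card ≤ hooleyDelta n := by
    intro i _
    refine le_trans (Finset.card_le_card ?_)
      ((hooleyDelta_isGreatest n).2 ⟨u - 1 + i, rfl⟩)
    intro d hd
    obtain ⟨hdD, hi⟩ := Finset.mem_filter.1 hd
    have hd0 : (0 : ℝ) < d := by exact_mod_cast Nat.pos_of_mem_divisors (hD hdD)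
    rw [divisorsInWindow, Finset.mem_filter, ← Real.lt_log_iff_exp_lt hd0,
      ← Real.log_le_iff_le_exp hd0]
    refine ⟨hD hdD, ?_, ?_⟩
    · have h1 := (h d hdD).1
      have := Nat.ceil_lt_add_one (sub_nonneg.2 h1)
      rw [hi] at this
      linarith
    · have := Nat.le_ceil (Real.log d - u)
      rw [hi] at this
      linarith
  have h1 := Finset.card_le_mul_card_image_of_maps_to hmaps (hooleyDelta n) hfib
  rw [Finset.card_range] at h1
  have h2 : (D.card : ℝ) ≤ hooleyDelta n * ((⌈R⌉₊ : ℝ) + 1) := by exact_mod_cast h1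
  refine h2.trans ?_
  rw [mul_comm]
  refine mul_le_mul_of_nonneg_right ?_ (Nat.cast_nonneg _)
  linarith [Nat.ceil_lt_add_one hR]

theorem one_le_hooleyDelta {n : ℕ} (hn : n ≠ 0) : 1 ≤ hooleyDelta n := by
  have h := card_le_mul_hooleyDelta (n := n) (D := {1}) (by simpa using hn) (u := 0) le_rfl
    (by simp)
  by_contra h0
  have : hooleyDelta n = 0 := by omega
  rw [this] at h
  norm_num at h

theorem injOn_prod_primes {S : Finset ℕ} (hS : ∀ p ∈ S, p.Prime) {B B' : Finset ℕ} (hB : B ⊆ S)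
    (hB' : B' ⊆ S) (h : ∏ p ∈ B, p = ∏ p ∈ B', p) : B = B' := by
  rw [← Nat.primeFactors_prod fun p hp => hS p (hB hp),
    ← Nat.primeFactors_prod fun p hp => hS p (hB' hp), h]

theorem cardDistinctFactors_prod {S : Finset ℕ} (hS : ∀ p ∈ S, p.Prime) :
    ArithmeticFunction.cardDistinctFactors (∏ p ∈ S, p) = S.card := by
  rw [ArithmeticFunction.cardDistinctFactors_apply, ← List.card_toFinset]
  exact congrArg Finset.card (Nat.primeFactors_prod hS)

/-- A cluster of subproducts of `S₂` and all subproducts of `S₁` combine. -/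
theorem mul_two_pow_le_mul_hooleyDelta {S₁ S₂ : Finset ℕ} (hd : Disjoint S₁ S₂)
    (h1 : ∀ p ∈ S₁, p.Prime) (h2 : ∀ p ∈ S₂, p.Prime) {s M R : ℝ} (hs : 0 ≤ s)
    (hc : Cluster s M S₂) (hR : ∑ p ∈ S₁, Real.log p ≤ R) :
    M * 2 ^ S₁.card ≤ (R + s * S₂.card + 2) * hooleyDelta (∏ p ∈ S₁ ∪ S₂, p) := by
  classical
  obtain ⟨F, hF1, hF2, u, hF3⟩ := hc
  have hS : ∀ p ∈ S₁ ∪ S₂, p.Prime := fun p hp => (Finset.mem_union.1 hp).elim (h1 p) (h2 p)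
  have hR0 : 0 ≤ R := le_trans (Finset.sum_nonneg fun p _ => Real.log_natCast_nonneg p) hR
  have hsub : ∀ x ∈ S₁.powerset ×ˢ F, x.1 ∪ x.2 ⊆ S₁ ∪ S₂ := fun x hx => by
    rw [Finset.mem_product, Finset.mem_powerset] at hx
    exact Finset.union_subset_union hx.1 (hF2 _ hx.2)
  set D := (S₁.powerset ×ˢ F).image fun x => ∏ p ∈ x.1 ∪ x.2, p with hD
  have hcard : D.card = 2 ^ S₁.card * F.card := by
    rw [hD, Finset.card_image_of_injOn, Finset.card_product, Finset.card_powerset]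
    intro x hx x' hx' e
    have hu := injOn_prod_primes hS (hsub x hx) (hsub x' hx') e
    have aux : ∀ y ∈ S₁.powerset ×ˢ F, (y.1 ∪ y.2) ∩ S₁ = y.1 ∧ (y.1 ∪ y.2) ∩ S₂ = y.2 := by
      intro y hy
      rw [Finset.mem_product, Finset.mem_powerset] at hy
      have g2 := hF2 _ hy.2
      constructor
      · rw [Finset.union_inter_distrib_right, Finset.inter_eq_left.2 hy.1,
          Finset.disjoint_iff_inter_eq_empty.1 (hd.symm.mono_left g2), Finset.union_empty]
      · rw [Finset.union_inter_distrib_right, Finset.inter_eq_left.2 g2,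
          Finset.disjoint_iff_inter_eq_empty.1 (hd.mono_left hy.1), Finset.empty_union]
    refine Prod.ext ?_ ?_
    · rw [← (aux x hx).1, hu, (aux x' hx').1]
    · rw [← (aux x hx).2, hu, (aux x' hx').2]
  have hpos : ∏ p ∈ S₁ ∪ S₂, p ≠ 0 := Finset.prod_ne_zero_iff.2 fun p hp => (hS p hp).ne_zero
  have main := card_le_mul_hooleyDelta (n := ∏ p ∈ S₁ ∪ S₂, p) (D := D) (u := u)
    (R := R + s * S₂.card) ?_ (by positivity) ?_
  · refine le_trans ?_ main
    rw [hcard]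
    push_cast
    rw [mul_comm]
    exact mul_le_mul_of_nonneg_left hF1 (by positivity)
  · intro d hd'
    obtain ⟨x, hx, rfl⟩ := Finset.mem_image.1 hd'
    rw [Nat.mem_divisors]
    exact ⟨Finset.prod_dvd_prod_of_subset _ _ _ (hsub x hx), hpos⟩
  · intro d hd'
    obtain ⟨x, hx, rfl⟩ := Finset.mem_image.1 hd'
    have hlog : Real.log ((∏ p ∈ x.1 ∪ x.2, p : ℕ) : ℝ) =
        ∑ p ∈ x.1, Real.log p + ∑ p ∈ x.2, Real.log p := by
      have hx' := hx
      rw [Finset.mem_product, Finset.mem_powerset] at hx'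
      push_cast
      rw [Real.log_prod, Finset.sum_union (hd.mono hx'.1 (hF2 _ hx'.2))]
      intro p hp
      exact_mod_cast (hS p (hsub x hx hp)).ne_zero
    rw [Finset.mem_product, Finset.mem_powerset] at hx
    have e1 : 0 ≤ ∑ p ∈ x.1, Real.log p := Finset.sum_nonneg fun p _ => Real.log_natCast_nonneg p
    have e2 : ∑ p ∈ x.1, Real.log p ≤ ∑ p ∈ S₁, Real.log p :=
      Finset.sum_le_sum_of_subset_of_nonneg hx.1 fun p _ _ => Real.log_natCast_nonneg p
    have e3 := hF3 _ hx.2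
    rw [hlog]
    constructor <;> linarith [e3.1, e3.2]

end Divisors

/-! ### The measure tilted by 2^ω on the small primes -/

section TiltedMeasure

/-- `exp (exp t)`. -/
noncomputable def expexp (t : ℝ) : ℝ := Real.exp (Real.exp t)

theorem expexp_mono {t t' : ℝ} (h : t ≤ t') : expexp t ≤ expexp t' :=
  Real.exp_le_exp.2 (Real.exp_le_exp.2 h)

theorem log_expexp (t : ℝ) : Real.log (expexp t) = Real.exp t := Real.log_exp _

theorem log_log_expexp (t : ℝ) : Real.log (Real.log (expexp t)) = t := by
  rw [log_expexp, Real.log_exp]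

/-- The weights `1 / (p + 1)`, tilted by a factor `2` at the primes below `expexp t`. -/
noncomputable def tiltedWeight (t : ℝ) (p : ℕ) : ℝ :=
  if (p : ℝ) < expexp t then 2 / ((p : ℝ) + 2) else 1 / ((p : ℝ) + 1)

theorem tiltedWeight_nonneg (t : ℝ) (p : ℕ) : 0 ≤ tiltedWeight t p := by
  unfold tiltedWeight
  split_ifs <;> positivity

theorem tiltedWeight_le_one (t : ℝ) (p : ℕ) : tiltedWeight t p ≤ 1 := by
  unfold tiltedWeight
  split_ifs
  · exact tilted_weight_le_one p
  · exact inv_succ_le_one p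

theorem tiltedWeight_of_mem_low {t u v : ℝ} (hv : v ≤ expexp t) :
    ∀ p ∈ primesIn u v, tiltedWeight t p = 2 / ((p : ℝ) + 2) := by
  intro p hp
  rw [tiltedWeight, if_pos ((mem_primesIn.1 hp).2.2.trans_le hv)]

theorem tiltedWeight_of_mem_high {t u v : ℝ} (hu : expexp t ≤ u) :
    ∀ p ∈ primesIn u v, tiltedWeight t p = 1 / ((p : ℝ) + 1) := by
  intro p hp
  rw [tiltedWeight, if_neg (not_lt.2 (hu.trans (mem_primesIn.1 hp).2.1))]

theorem pr_inter {U W : Finset ℕ} (h : W ⊆ U) (q : ℕ → ℝ) (P : Finset ℕ → Prop) :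
    pr U q (fun S => P (S ∩ W)) = pr W q P :=
  bern_inter h q (fun S => @ite ℝ (P S) (Classical.propDecidable _) 1 0)

theorem pr_congr_weight {U : Finset ℕ} {q q' : ℕ → ℝ} (h : ∀ a ∈ U, q a = q' a)
    (P : Finset ℕ → Prop) : pr U q P = pr U q' P :=
  bern_congr_weight _ h

/-- Changing measure from the original weights to the tilted ones. -/
theorem exists_bern_two_pow_ge : ∃ c : ℝ, 0 < c ∧ ∀ t T : ℝ, 17 ≤ expexp t → t ≤ T →
    ∀ f : Finset ℕ → ℝ, (∀ S, 0 ≤ f S) →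
    c * Real.exp t * bern (primesIn 17 (expexp T)) (tiltedWeight t) f ≤
      bern (primesIn 17 (expexp T)) (fun p => 1 / ((p : ℝ) + 1))
        (fun S => 2 ^ (S ∩ primesIn 17 (expexp t)).card * f S) := by
  obtain ⟨c, hc, h⟩ := exists_le_prod_one_add_inv_succ
  refine ⟨c, hc, fun t T ht htT f hf => ?_⟩
  -- Tilting by 2 below the cut gives the normaliser 1 + 1/(p+1) = (p+2)/(p+1) and the new weight
  -- 2/(p+2); above the cut nothing changes.
  set g : ℕ → ℝ := fun p => if (p : ℝ) < expexp t then 2 else 1 with hg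
  have hsplit := primesIn_union ht (expexp_mono htT)
  have hgU : ∀ p ∈ primesIn 17 (expexp t), g p = 2 := fun p hp => by
    rw [hg]
    exact if_pos (mem_primesIn.1 hp).2.2
  have hgV : ∀ p ∈ primesIn (expexp t) (expexp T), g p = 1 := fun p hp => by
    rw [hg]
    exact if_neg (not_lt.2 (mem_primesIn.1 hp).2.1)
  have e0 : ∀ p : ℕ, 1 - 1 / ((p : ℝ) + 1) + 1 / ((p : ℝ) + 1) * g p ≠ 0 := by
    intro p
    simp only [hg]
    split_ifs
    · have : 1 - 1 / ((p : ℝ) + 1) + 1 / ((p : ℝ) + 1) * 2 = 1 + 1 / ((p : ℝ) + 1) := by ring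
      rw [this]; positivity
    · simp
  have e1 : ∀ S ⊆ primesIn 17 (expexp T), (2 : ℝ) ^ (S ∩ primesIn 17 (expexp t)).card * f S =
      (∏ p ∈ S, g p) * f S := by
    intro S hS
    congr 1
    have hS' : S = (S ∩ primesIn 17 (expexp t)) ∪ (S ∩ primesIn (expexp t) (expexp T)) := by
      rw [← Finset.inter_union_distrib_left, hsplit, Finset.inter_eq_left.2 hS]
    nth_rewrite 2 [hS']
    rw [Finset.prod_union ((disjoint_primesIn 17 le_rfl _).mono Finset.inter_subset_right
      Finset.inter_subset_right),
      Finset.prod_congr rfl fun p hp => hgU p (Finset.mem_inter.1 hp).2,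
      Finset.prod_congr rfl fun p hp => hgV p (Finset.mem_inter.1 hp).2]
    simp
  have e2 : ∏ p ∈ primesIn 17 (expexp T), (1 - 1 / ((p : ℝ) + 1) + 1 / ((p : ℝ) + 1) * g p) =
      ∏ p ∈ primesIn 17 (expexp t), (1 + 1 / ((p : ℝ) + 1)) := by
    rw [← hsplit, Finset.prod_union (disjoint_primesIn 17 le_rfl _)]
    have h1 : ∏ p ∈ primesIn (expexp t) (expexp T),
        (1 - 1 / ((p : ℝ) + 1) + 1 / ((p : ℝ) + 1) * g p) = 1 :=
      Finset.prod_eq_one fun p hp => by rw [hgV p hp]; ring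
    rw [h1, mul_one]
    exact Finset.prod_congr rfl fun p hp => by rw [hgU p hp]; ring
  rw [bern_congr e1, bern_tilt _ _ _ (fun p _ => e0 p), e2]
  have e3 : bern (primesIn 17 (expexp T)) (fun p => 1 / ((p : ℝ) + 1) * g p /
      (1 - 1 / ((p : ℝ) + 1) + 1 / ((p : ℝ) + 1) * g p)) f =
      bern (primesIn 17 (expexp T)) (tiltedWeight t) f := by
    refine bern_congr_weight f fun p _ => ?_
    simp only [tiltedWeight, hg]
    split_ifs
    · have e4 : 1 - 1 / ((p : ℝ) + 1) + 1 / ((p : ℝ) + 1) * 2 = (p + 2) / (p + 1) := by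
        field_simp
        ring
      rw [e4]
      field_simp
    · simp
  rw [e3]
  refine mul_le_mul_of_nonneg_right ?_ (bern_nonneg (fun p _ => tiltedWeight_nonneg t p)
    (fun p _ => tiltedWeight_le_one t p) fun S _ => hf S)
  have := h (expexp t) ht
  rwa [log_expexp] at this

/-- Under the tilted measure the product of the primes below `expexp t` is not too large. -/
theorem pr_tiltedWeight_sum_log_le {t T : ℝ} (ht : 17 ≤ expexp t) (htT : t ≤ T) (K : ℝ) :
    pr (primesIn 17 (expexp T)) (tiltedWeight t)
      (fun S => K * Real.exp t ≤ ∑ p ∈ S ∩ primesIn 17 (expexp t), Real.log p) ≤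
      Real.exp 12 * Real.exp (-K) := by
  rw [pr_inter (primesIn_subset le_rfl (expexp_mono htT)) _
    (fun S => K * Real.exp t ≤ ∑ p ∈ S, Real.log p),
    pr_congr_weight (tiltedWeight_of_mem_low le_rfl)]
  have := pr_sum_log_tilted_le ht K
  rwa [log_expexp] at this

theorem card_inter_primesIn_add {u v w : ℝ} (huv : u ≤ v) (hvw : v ≤ w) (S : Finset ℕ) :
    (S ∩ primesIn u w).card = (S ∩ primesIn u v).card + (S ∩ primesIn v w).card := by
  rw [← primesIn_union huv hvw, Finset.inter_union_distrib_left, Finset.card_union_of_disjoint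
    ((disjoint_primesIn u le_rfl w).mono Finset.inter_subset_right Finset.inter_subset_right)]

/-- Under the tilted measure at `t`, the quantity `2 ^ ω / log` is likely to be larger at `t` than
at `t'`. -/
theorem exists_pr_tiltedWeight_compare_le : ∃ C : ℝ, 0 < C ∧ ∀ t t' T : ℝ, 17 ≤ expexp t →
    17 ≤ expexp t' → t ≤ T → t' ≤ T →
    pr (primesIn 17 (expexp T)) (tiltedWeight t) (fun S =>
      (S ∩ primesIn 17 (expexp t)).card * Real.log 2 - t ≤
        (S ∩ primesIn 17 (expexp t')).card * Real.log 2 - t') ≤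
      C * Real.exp (-|t - t'| / 20) := by
  obtain ⟨C₁, hC₁, h₁⟩ := exists_pr_card_tilted_lower_tail_le
  obtain ⟨C₂, hC₂, h₂⟩ := exists_pr_card_upper_tail_le
  refine ⟨max C₁ C₂, lt_max_of_lt_left hC₁, fun t t' T ht ht' htT htT' => ?_⟩
  -- The two scores differ only through the primes between the cuts. Below t they are tilted, with
  -- mean count about 2|t - t'|, and must be too few; above t they are untilted, with mean about |t
  -- - t'|, and must be too many. The threshold |t - t'|/log 2 lies strictly between these means.
  rcases le_total t' t with h | h
  · have hs : ∀ S : Finset ℕ, (S ∩ primesIn 17 (expexp t)).card * Real.log 2 - t ≤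
        (S ∩ primesIn 17 (expexp t')).card * Real.log 2 - t' →
        (S ∩ primesIn (expexp t') (expexp t)).card * Real.log 2 ≤ t - t' := by
      intro S hS
      rw [card_inter_primesIn_add ht' (expexp_mono h) S] at hS
      push_cast at hS
      linarith
    refine (pr_mono (fun p _ => tiltedWeight_nonneg t p) (fun p _ => tiltedWeight_le_one t p)
      fun S _ => hs S).trans ?_
    rw [pr_inter (primesIn_subset ht' (expexp_mono htT)) _
      (fun S => S.card * Real.log 2 ≤ t - t'), pr_congr_weight (tiltedWeight_of_mem_low le_rfl)]
    have := h₁ (expexp t') (expexp t) ht' (expexp_mono h)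
    rw [log_log_expexp, log_log_expexp] at this
    refine this.trans ?_
    rw [abs_of_nonneg (by linarith)]
    exact mul_le_mul_of_nonneg_right (le_max_left _ _) (Real.exp_pos _).le
  · have hs : ∀ S : Finset ℕ, (S ∩ primesIn 17 (expexp t)).card * Real.log 2 - t ≤
        (S ∩ primesIn 17 (expexp t')).card * Real.log 2 - t' →
        t' - t ≤ (S ∩ primesIn (expexp t) (expexp t')).card * Real.log 2 := by
      intro S hS
      rw [card_inter_primesIn_add ht (expexp_mono h) S] at hS
      push_cast at hS
      linarith
    refine (pr_mono (fun p _ => tiltedWeight_nonneg t p) (fun p _ => tiltedWeight_le_one t p)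
      fun S _ => hs S).trans ?_
    rw [pr_inter (primesIn_subset ht (expexp_mono htT')) _
      (fun S => t' - t ≤ S.card * Real.log 2), pr_congr_weight (tiltedWeight_of_mem_high le_rfl)]
    have := h₂ (expexp t) (expexp t') ht (expexp_mono h)
    rw [log_log_expexp, log_log_expexp, neg_sub] at this
    refine this.trans ?_
    rw [abs_of_nonpos (by linarith), neg_neg]
    exact mul_le_mul_of_nonneg_right (le_max_right _ _) (Real.exp_pos _).le

/-- Chebyshev's inequality for the number of large primes. -/
theorem eventually_pr_card_high_le : ∀ᶠ T : ℝ in atTop, ∀ t : ℝ, 17 ≤ expexp t → 0 ≤ t → t ≤ T →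
    pr (primesIn (expexp t) (expexp T)) (fun p => 1 / ((p : ℝ) + 1))
      (fun S => 5 * Real.sqrt T < |(S.card : ℝ) - (T - t)|) ≤ 1 / 8 := by
  obtain ⟨C, hC, hM⟩ := exists_abs_sum_inv_primesIn_sub_le_const
  filter_upwards [Real.tendsto_sqrt_atTop.eventually_ge_atTop (C + 1)] with T hT t ht ht0 htT
  set U := primesIn (expexp t) (expexp T) with hU
  have hm := abs_le.1 (hM (expexp t) (expexp T) (by linarith) (expexp_mono htT))
  rw [log_log_expexp, log_log_expexp] at hm
  have h1 := sum_inv_succ_le_sum_inv _ (pos_of_mem_primesIn (u := expexp t) (v := expexp T))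
  have h2 := sum_inv_sub_sum_inv_sq_le _ (pos_of_mem_primesIn (u := expexp t) (v := expexp T))
  have h3 := sum_inv_sq_primesIn_le_one_div_sixteen ht (expexp T)
  rw [← hU] at *
  set μ := ∑ p ∈ U, 1 / ((p : ℝ) + 1)
  have hμ : |μ - (T - t)| ≤ C + 1 := by
    rw [abs_le]
    constructor <;> linarith [hm.1, hm.2]
  have hT0 : 0 < T := by
    by_contra h
    rw [Real.sqrt_eq_zero_of_nonpos (not_lt.1 h)] at hT
    linarith
  set R := Real.sqrt T
  have hRT : R ^ 2 = T := Real.sq_sqrt hT0.le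
  have hvar : ∑ p ∈ U, 1 / ((p : ℝ) + 1) * (1 - 1 / ((p : ℝ) + 1)) ≤ 2 * T := by
    calc ∑ p ∈ U, 1 / ((p : ℝ) + 1) * (1 - 1 / ((p : ℝ) + 1)) ≤ μ := by
          refine Finset.sum_le_sum fun p _ => ?_
          have h0 : 0 ≤ 1 / ((p : ℝ) + 1) := by positivity
          exact mul_le_of_le_one_right h0 (by linarith)
      _ ≤ 2 * T := by
          have := (abs_le.1 hμ).2
          have : C + 1 ≤ T := by rw [← hRT]; nlinarith
          linarith
  -- The mean μ is within C + 1 ≤ √T of T - t, so a deviation of 5√T from T - t is one of 4√T from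
  -- μ. With variance at most 2T this has probability at most 2/16.
  have hch := pr_le_bern_div (U := U) (q := fun p => 1 / ((p : ℝ) + 1))
    (P := fun S => 5 * R < |(S.card : ℝ) - (T - t)|) (fun p _ => by positivity)
    (fun p _ => inv_succ_le_one p) (f := fun S => ((S.card : ℝ) - μ) ^ 2)
    (fun S _ => sq_nonneg _) (t := 16 * T) (by linarith) (by
      intro S _ hS
      have h4 := abs_sub_le (S.card : ℝ) μ (T - t)
      have h5 : 4 * R ≤ |(S.card : ℝ) - μ| := by linarith
      rw [← sq_abs, ← hRT]
      have := pow_le_pow_left₀ (by linarith) h5 2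
      linarith)
  rw [bern_card_sub_sq] at hch
  refine hch.trans ?_
  rw [div_le_div_iff₀ (by linarith) (by norm_num)]
  linarith

/-- The main local lower bound under the tilted measure. -/
theorem exists_pr_tiltedWeight_ge {α : ℝ} (hα : 0 < α) : ∃ c : ℝ, 0 < c ∧ ∀ᶠ T : ℝ in atTop,
    ∀ (t : ℝ) (P : Finset ℕ → Prop) (r : ℕ), α * T ≤ t → t ≤ T → |(r : ℝ) - T - t| ≤ Real.sqrt T →
      3 / 4 ≤ pr (primesIn (expexp t) (expexp T)) (fun p => 1 / ((p : ℝ) + 1)) P →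
      c / Real.sqrt T ≤ pr (primesIn 17 (expexp T)) (tiltedWeight t) (fun S => S.card = r ∧
        P (S ∩ primesIn (expexp t) (expexp T)) ∧
        ((S ∩ primesIn (expexp t) (expexp T)).card : ℝ) ≤ 2 * T) := by
  classical
  obtain ⟨c, hc, hloc⟩ := exists_pr_card_tilted_ge hα
  refine ⟨c / 2, by positivity, ?_⟩
  have hexp : ∀ᶠ T : ℝ in atTop, Real.log 17 ≤ Real.exp (α * T) :=
    (Real.tendsto_exp_atTop.comp (tendsto_id.const_mul_atTop hα)).eventually_ge_atTop _
  filter_upwards [hloc, eventually_pr_card_high_le, hexp, eventually_gt_atTop 0,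
    Real.tendsto_sqrt_atTop.eventually_ge_atTop 5,
    Real.tendsto_sqrt_atTop.eventually_ge_atTop (6 / α)]
    with T hloc hch hT17 hT0 hR5 hR6 t P r ht htT hr hP
  set R := Real.sqrt T with hR
  have hRT : R * R = T := Real.mul_self_sqrt hT0.le
  have ht0 : 0 ≤ t := le_trans (by positivity) ht
  have h17 : 17 ≤ expexp t := by
    rw [expexp, ← Real.log_le_iff_le_exp (by norm_num)]
    exact hT17.trans (Real.exp_le_exp.2 ht)
  have hαR : 6 * R ≤ t := by
    rw [div_le_iff₀ hα] at hR6
    have := mul_le_mul_of_nonneg_right hR6 (by linarith : 0 ≤ R)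
    refine le_trans (le_trans this (le_of_eq ?_)) ht
    rw [← hRT]
    ring
  have hRT5 : 5 * R ≤ T := by
    rw [← hRT]
    exact mul_le_mul_of_nonneg_right hR5 (by linarith)
  set U := primesIn 17 (expexp t) with hU
  set V := primesIn (expexp t) (expexp T) with hV
  have hd : Disjoint V U := (disjoint_primesIn 17 le_rfl _).symm
  have hVU : V ∪ U = primesIn 17 (expexp T) := by
    rw [Finset.union_comm, hU, hV, primesIn_union h17 (expexp_mono htT)]
  -- The large primes are fixed first, subject to `P` and a typical count. The small primes are
  -- independent of them and supply the exact total `r`.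
  set G : Finset ℕ → Prop := fun S => P S ∧ ¬ 5 * R < |(S.card : ℝ) - (T - t)| with hG
  have hw0 : ∀ p ∈ V, 0 ≤ 1 / ((p : ℝ) + 1) := fun p _ => by positivity
  have hw1 : ∀ p ∈ V, 1 / ((p : ℝ) + 1) ≤ 1 := fun p _ => inv_succ_le_one p
  have hGpr : 5 / 8 ≤ pr V (fun p => 1 / ((p : ℝ) + 1)) G := by
    have h1 := pr_sub_le_pr_and_not hw0 hw1 P (fun S => 5 * R < |(S.card : ℝ) - (T - t)|)
    have h2 := hch t h17 ht0 htT
    linarith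
  rw [← hVU, pr, bern_union hd]
  calc c / 2 / R ≤ c / R * pr V (fun p => 1 / ((p : ℝ) + 1)) G := by
        have : 0 ≤ c / R := by positivity
        have h3 := mul_le_mul_of_nonneg_left hGpr this
        have e : c / 2 / R = c / R * (1 / 2) := by ring
        rw [e]
        nlinarith
    _ = bern V (tiltedWeight t)
          (fun S => c / R * @ite ℝ (G S) (Classical.propDecidable _) 1 0) := by
        rw [bern_const_mul]
        congr 1
        exact (pr_congr_weight (tiltedWeight_of_mem_high le_rfl) G).symm
    _ ≤ _ := by
        refine bern_mono (fun p _ => tiltedWeight_nonneg t p) (fun p _ => tiltedWeight_le_one t p)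
          fun S₂ hS₂ => ?_
        have hinter : ∀ S₁ ⊆ U, (S₂ ∪ S₁) ∩ V = S₂ := fun S₁ hS₁ => by
          rw [Finset.union_inter_distrib_right, Finset.inter_eq_left.2 hS₂,
            Finset.disjoint_iff_inter_eq_empty.1 (hd.symm.mono_left hS₁), Finset.union_empty]
        by_cases hGS : G S₂
        · rw [if_pos hGS, mul_one]
          obtain ⟨hPS, hcard⟩ := hGS
          rw [not_lt, abs_le] at hcard
          have hr' := abs_le.1 hr
          have hle : S₂.card ≤ r := by
            have : (S₂.card : ℝ) ≤ r := by linarith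
            exact_mod_cast this
          -- The required count r - |S₂| differs from 2t by (r - T - t) - (|S₂| - (T - t)), at most
          -- √T + 5√T in absolute value.
          have h4 := hloc t ht htT (r - S₂.card) (by
            rw [Nat.cast_sub hle, abs_le]
            constructor <;> linarith)
          refine h4.trans ?_
          change pr U _ _ ≤ _
          rw [← pr_congr_weight (tiltedWeight_of_mem_low le_rfl), pr]
          refine bern_mono (fun p _ => tiltedWeight_nonneg t p)
            (fun p _ => tiltedWeight_le_one t p) fun S₁ hS₁ => ?_
          by_cases hc1 : S₁.card = r - S₂.card
          · rw [if_pos hc1, if_pos]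
            rw [hinter S₁ hS₁, Finset.card_union_of_disjoint (hd.mono hS₂ hS₁)]
            exact ⟨by omega, hPS, by linarith⟩
          · rw [if_neg hc1]
            split_ifs <;> norm_num
        · rw [if_neg hGS, mul_zero]
          exact bern_nonneg (fun p _ => tiltedWeight_nonneg t p)
            (fun p _ => tiltedWeight_le_one t p) fun S₁ _ => by split_ifs <;> norm_num

end TiltedMeasure

/-! ### Summation over a grid of cut points -/

section GridSum

open Classical in
theorem sum_ite_le_of_unique {ι : Type*} {s : Finset ι} {H : ι → Prop} {f : ι → ℝ} {b : ℝ}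
    (hb : 0 ≤ b) (huniq : ∀ i ∈ s, ∀ j ∈ s, H i → H j → i = j) (hf : ∀ i ∈ s, H i → f i ≤ b) :
    ∑ i ∈ s, (if H i then f i else 0) ≤ b := by
  by_cases h : ∃ i ∈ s, H i
  · obtain ⟨i, hi, hHi⟩ := h
    rw [Finset.sum_eq_single_of_mem i hi, if_pos hHi]
    · exact hf i hi hHi
    · intro j hj hji
      rw [if_neg]
      exact fun hHj => hji (huniq j hj i hi hHj hHi)
  · rw [Finset.sum_eq_zero]
    · exact hb
    · intro i hi
      rw [if_neg fun hH => h ⟨i, hi, hH⟩]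

/-- The random integer is good at `t`: it has exactly `r` prime factors, its large prime factors
form a cluster, and its small prime factors are not too large. -/
def GoodAt (κ T t : ℝ) (r : ℕ) (S : Finset ℕ) : Prop :=
  (S.card = r ∧ Cluster (Real.exp t / (2 * T)) (T ^ κ) (S ∩ primesIn (expexp t) (expexp T)) ∧
    ((S ∩ primesIn (expexp t) (expexp T)).card : ℝ) ≤ 2 * T) ∧
  ¬ Real.log T * Real.exp t ≤ ∑ p ∈ S ∩ primesIn 17 (expexp t), Real.log p

/-- The logarithm of `2 ^ ω(n) / log y`, where `n` is the part of the integer composed of primes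
below `y = expexp t`. -/
noncomputable def score (t : ℝ) (S : Finset ℕ) : ℝ :=
  (S ∩ primesIn 17 (expexp t)).card * Real.log 2 - t

/-- All error lengths are measured in e^t: the small part contributes log T · e^t, and the cluster
width is at most e^t since there are at most 2T large primes. The whole window, with its extra 2,
fits in 3 log T · e^t. -/
theorem GoodAt.le_hooleyDelta {κ T t : ℝ} {r : ℕ} {S : Finset ℕ} (h : GoodAt κ T t r S)
    (hT : 2 ≤ Real.log T) (hT0 : 0 < T) (ht0 : 0 ≤ t) (ht : 17 ≤ expexp t) (htT : t ≤ T)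
    (hS : S ⊆ primesIn 17 (expexp T)) :
    T ^ κ / (3 * Real.log T * Real.exp t) * 2 ^ (S ∩ primesIn 17 (expexp t)).card ≤
      hooleyDelta (∏ p ∈ S, p) := by
  obtain ⟨⟨-, hc, hcard⟩, hlog⟩ := h
  have hunion : (S ∩ primesIn 17 (expexp t)) ∪ (S ∩ primesIn (expexp t) (expexp T)) = S := by
    rw [← Finset.inter_union_distrib_left, primesIn_union ht (expexp_mono htT),
      Finset.inter_eq_left.2 hS]
  have h1 := mul_two_pow_le_mul_hooleyDelta (S₁ := S ∩ primesIn 17 (expexp t))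
    ((disjoint_primesIn 17 le_rfl (expexp T)).mono Finset.inter_subset_right
      Finset.inter_subset_right)
    (fun p hp => (mem_primesIn.1 (Finset.mem_inter.1 hp).2).1)
    (fun p hp => (mem_primesIn.1 (Finset.mem_inter.1 hp).2).1) (by positivity) hc (not_le.1 hlog).le
  rw [hunion] at h1
  have he : 1 ≤ Real.exp t := Real.one_le_exp ht0
  have h2 : Real.exp t / (2 * T) * (S ∩ primesIn (expexp t) (expexp T)).card ≤ Real.exp t := by
    calc _ ≤ Real.exp t / (2 * T) * (2 * T) := by gcongr
      _ = Real.exp t := by field_simp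
  rw [div_mul_eq_mul_div, div_le_iff₀ (by positivity), mul_comm _ (3 * Real.log T * Real.exp t)]
  refine h1.trans (mul_le_mul_of_nonneg_right ?_ (Nat.cast_nonneg _))
  nlinarith

/-- The mean of `hooleyDelta` over integers with `r` prime factors, from the clusters. -/
theorem exists_bern_hooleyDelta_ge {ε κ : ℝ} (hε : 0 < ε)
    (hcl : ∀ α : ℝ, 0 < α → ∀ᶠ T : ℝ in atTop, ∀ t : ℝ, α * T ≤ t → α * T ≤ T - t →
      3 / 4 ≤ pr (primesIn (expexp t) (expexp T)) (fun p => 1 / ((p : ℝ) + 1))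
        (Cluster (Real.exp t / (2 * T)) (T ^ κ))) :
    ∃ c : ℝ, 0 < c ∧ ∀ᶠ T : ℝ in atTop, ∀ r : ℕ, (1 + ε) * T ≤ r → (r : ℝ) ≤ (2 - ε) * T →
      c * (T ^ κ / Real.log T ^ 2) ≤
        bern (primesIn 17 (expexp T)) (fun p => 1 / ((p : ℝ) + 1))
          (fun S => if S.card = r then (hooleyDelta (∏ p ∈ S, p) : ℝ) else 0) := by
  classical
  set α := ε / 2 with hαdef
  have hα : 0 < α := by positivity
  obtain ⟨c₁, hc₁, hmain⟩ := exists_pr_tiltedWeight_ge hα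
  obtain ⟨c₂, hc₂, htilt⟩ := exists_bern_two_pow_ge
  obtain ⟨C, hC, hcomp⟩ := exists_pr_tiltedWeight_compare_le
  refine ⟨c₂ * c₁ / 480, by positivity, ?_⟩
  have hexp : ∀ᶠ T : ℝ in atTop, Real.log 17 ≤ Real.exp (α * T) :=
    (Real.tendsto_exp_atTop.comp (tendsto_id.const_mul_atTop hα)).eventually_ge_atTop _
  have hlog : ∀ᶠ T : ℝ in atTop, 40 * Real.log T ≤ Real.sqrt T := by
    have h1 := (isLittleO_log_rpow_atTop (show (0 : ℝ) < 1 / 2 by norm_num)).bound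
      (show (0 : ℝ) < 1 / 40 by norm_num)
    filter_upwards [h1, eventually_ge_atTop 1] with T hT hT1
    rw [Real.norm_of_nonneg (Real.log_nonneg hT1), Real.norm_of_nonneg (by positivity),
      ← Real.sqrt_eq_rpow] at hT
    linarith
  filter_upwards [hmain, hcl α hα, hexp, hlog, eventually_ge_atTop 1,
    Real.tendsto_log_atTop.eventually_ge_atTop 2,
    Real.tendsto_sqrt_atTop.eventually_ge_atTop (1 / α),
    Real.tendsto_sqrt_atTop.eventually_ge_atTop 1,
    Real.tendsto_sqrt_atTop.eventually_ge_atTop (2 * (Real.exp 12 + C) / c₁)]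
    with T hmain hcl hT17 hlog hT1 hlT2 hRα hR1 hRC r hr1 hr2
  have hT0 : 0 < T := by linarith
  set R := Real.sqrt T with hR
  have hR0 : 0 < R := by linarith
  have hRT : R * R = T := Real.mul_self_sqrt hT0.le
  have hRαT : R ≤ α * T := by
    rw [div_le_iff₀ hα] at hRα
    have := mul_le_mul_of_nonneg_right hRα hR0.le
    rw [← hRT]
    linarith
  have hRleT : R ≤ T := by
    rw [← hRT]
    exact le_mul_of_one_le_right hR0.le hR1
  set L := Real.log T with hL
  -- Spacing 40 log T turns exp(-ℓ/20) into T^(-2), so the union bound over at most T grid points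
  -- costs only C/T.
  set ℓ := 40 * L with hℓ
  have hℓ0 : 0 < ℓ := by linarith
  set N := ⌊R / ℓ⌋₊ with hN
  have hN1 : (N : ℝ) * ℓ ≤ R := by
    rw [← le_div_iff₀ hℓ0]
    exact Nat.floor_le (by positivity)
  have hN2 : R ≤ 2 * N * ℓ := by
    have h1 : 1 ≤ R / ℓ := by rwa [one_le_div hℓ0]
    have h2 : R / ℓ < N + 1 := Nat.lt_floor_add_one _
    have h3 : (1 : ℝ) ≤ N := by exact_mod_cast (Nat.one_le_floor_iff _).2 h1
    rw [div_lt_iff₀ hℓ0] at h2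
    nlinarith
  have hNT : (N : ℝ) ≤ T := by
    have : (N : ℝ) ≤ N * ℓ := le_mul_of_one_le_right (Nat.cast_nonneg _) (by linarith)
    linarith
  -- The mean T + t_i of ω under the tilt is r + iℓ, within √T of r. The hypotheses place r - T
  -- between 2αT and (1 - 2α)T, and the shift by at most √T ≤ αT keeps t_i at distance αT from both
  -- 0 and T.
  set t : ℕ → ℝ := fun i => r - T + i * ℓ with htdef
  have hti : ∀ i ∈ Finset.range N, (i : ℝ) * ℓ ≤ R := fun i hi => by
    have : (i : ℝ) ≤ N := by exact_mod_cast (Finset.mem_range.1 hi).le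
    exact (mul_le_mul_of_nonneg_right this hℓ0.le).trans hN1
  have hi0 : ∀ i : ℕ, 0 ≤ (i : ℝ) * ℓ := fun i => by positivity
  have hαT0 : 0 ≤ α * T := by positivity
  have hαε : ε * T = 2 * (α * T) := by rw [hαdef]; ring
  have ht1 : ∀ i ∈ Finset.range N, α * T ≤ t i := fun i _ => by
    have := hi0 i
    simp only [htdef]
    linarith
  have ht2 : ∀ i ∈ Finset.range N, α * T ≤ T - t i := fun i hi => by
    have := hti i hi
    simp only [htdef]
    linarith
  have ht17 : ∀ i ∈ Finset.range N, 17 ≤ expexp (t i) := fun i hi => by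
    rw [expexp, ← Real.log_le_iff_le_exp (by norm_num)]
    exact hT17.trans (Real.exp_le_exp.2 (ht1 i hi))
  have htT : ∀ i ∈ Finset.range N, t i ≤ T := fun i hi => by linarith [ht2 i hi]
  have hsep : ∀ i j : ℕ, i ≠ j → ℓ ≤ |t i - t j| := fun i j hij => by
    have e : t i - t j = ((i : ℤ) - (j : ℤ) : ℤ) * ℓ := by simp only [htdef]; push_cast; ring
    rw [e, abs_mul, abs_of_pos hℓ0]
    refine le_mul_of_one_le_left hℓ0.le ?_
    rw [← Int.cast_abs]
    have : (1 : ℤ) ≤ |(i : ℤ) - j| := Int.one_le_abs (by omega)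
    exact_mod_cast this
  set U := primesIn 17 (expexp T) with hU
  -- Demanding a strict maximum of the score at t_i makes the events `H i` mutually exclusive.
  set H : ℕ → Finset ℕ → Prop := fun i S => GoodAt κ T (t i) r S ∧
    ¬ ∃ j ∈ (Finset.range N).erase i, score (t i) S ≤ score (t j) S with hH
  have hw0 : ∀ p ∈ U, 0 ≤ 1 / ((p : ℝ) + 1) := fun p _ => by positivity
  have hw1 : ∀ p ∈ U, 1 / ((p : ℝ) + 1) ≤ 1 := fun p _ => inv_succ_le_one p
  have hHpr : ∀ i ∈ Finset.range N, c₁ / (2 * R) ≤ pr U (tiltedWeight (t i)) (H i) := by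
    intro i hi
    have hq0 : ∀ p ∈ U, 0 ≤ tiltedWeight (t i) p := fun p _ => tiltedWeight_nonneg _ p
    have hq1 : ∀ p ∈ U, tiltedWeight (t i) p ≤ 1 := fun p _ => tiltedWeight_le_one _ p
    have a1 := hmain (t i) _ r (ht1 i hi) (htT i hi) (by
      simp only [htdef]
      rw [show (r : ℝ) - T - (r - T + i * ℓ) = -(i * ℓ) by ring, abs_neg, abs_of_nonneg (hi0 i)]
      exact hti i hi) (hcl (t i) (ht1 i hi) (ht2 i hi))
    have a2 := pr_tiltedWeight_sum_log_le (ht17 i hi) (htT i hi) L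
    have a3 : pr U (tiltedWeight (t i)) (fun S => ∃ j ∈ (Finset.range N).erase i,
        score (t i) S ≤ score (t j) S) ≤ C / T := by
      refine (pr_exists_le _ hq0 hq1 _).trans ?_
      calc _ ≤ ∑ j ∈ (Finset.range N).erase i, C * Real.exp (-(2 * L)) := by
            refine Finset.sum_le_sum fun j hj => ?_
            obtain ⟨hji, hj⟩ := Finset.mem_erase.1 hj
            refine (hcomp (t i) (t j) T (ht17 i hi) (ht17 j hj) (htT i hi) (htT j hj)).trans ?_
            refine mul_le_mul_of_nonneg_left (Real.exp_le_exp.2 ?_) hC.le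
            have := hsep i j (Ne.symm hji)
            linarith
        _ = ((Finset.range N).erase i).card * (C * Real.exp (-(2 * L))) := by
            rw [Finset.sum_const, nsmul_eq_mul]
        _ ≤ T * (C * Real.exp (-(2 * L))) := by
            refine mul_le_mul_of_nonneg_right (le_trans ?_ hNT) (by positivity)
            have := Finset.card_erase_le (s := Finset.range N) (a := i)
            rw [Finset.card_range] at this
            exact_mod_cast this
        _ = C / T := by
            rw [Real.exp_neg, show 2 * L = L + L by ring, Real.exp_add, hL, Real.exp_log hT0]
            field_simp
    have a4 := pr_or_le hq0 hq1
      (fun S => L * Real.exp (t i) ≤ ∑ p ∈ S ∩ primesIn 17 (expexp (t i)), Real.log p)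
      (fun S => ∃ j ∈ (Finset.range N).erase i, score (t i) S ≤ score (t j) S)
    have a5 := (pr_sub_le_pr_and_not hq0 hq1 _ _).trans (pr_mono hq0 hq1 (Q := H i) (by
      rintro S - ⟨hS1, hS2⟩
      rw [not_or] at hS2
      exact ⟨⟨hS1, hS2.1⟩, hS2.2⟩))
    have a6 : Real.exp 12 * Real.exp (-L) = Real.exp 12 / T := by
      rw [Real.exp_neg, hL, Real.exp_log hT0]
      rfl
    rw [a6] at a2
    -- Both exceptional probabilities are O(1/T), negligible against the main probability of order
    -- 1/√T.
    have a7 : Real.exp 12 / T + C / T ≤ c₁ / (2 * R) := by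
      rw [← add_div, div_le_div_iff₀ hT0 (by positivity), ← hRT]
      rw [div_le_iff₀ hc₁] at hRC
      have := mul_le_mul_of_nonneg_right hRC hR0.le
      linarith
    have a8 : c₁ / R = c₁ / (2 * R) + c₁ / (2 * R) := by field_simp; norm_num
    refine le_trans ?_ a5
    linarith
  set a : ℕ → ℝ := fun i => T ^ κ / (3 * L * Real.exp (t i)) with ha
  have hTκ : 0 < T ^ κ := Real.rpow_pos_of_pos hT0 κ
  have ha0 : ∀ i, 0 ≤ a i := fun i => by
    simp only [ha]
    have : 0 < L := by linarith
    positivity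
  -- The grid has N ≥ √T/(80 log T) points, each contributing T^κ/(3 log T) times c₂c₁/(2√T); the
  -- factors e^(t_i) cancel, and 480 = 3 · 2 · 80.
  calc c₂ * c₁ / 480 * (T ^ κ / L ^ 2)
      ≤ ∑ i ∈ Finset.range N, T ^ κ / (3 * L) * (c₂ * (c₁ / (2 * R))) := by
        rw [Finset.sum_const, Finset.card_range, nsmul_eq_mul]
        have hL0 : 0 < L := by linarith
        have e1 : (1 : ℝ) / (80 * L) ≤ N / R := by
          rw [div_le_div_iff₀ (by positivity) hR0]
          linarith
        calc c₂ * c₁ / 480 * (T ^ κ / L ^ 2) = T ^ κ / (3 * L) * (c₂ * c₁ / 2) * (1 / (80 * L)) := by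
              field_simp
              norm_num
          _ ≤ T ^ κ / (3 * L) * (c₂ * c₁ / 2) * (N / R) := by gcongr
          _ = _ := by field_simp
    _ ≤ ∑ i ∈ Finset.range N, a i * (c₂ * Real.exp (t i) * pr U (tiltedWeight (t i)) (H i)) := by
        refine Finset.sum_le_sum fun i hi => ?_
        have hL0 : 0 < L := by linarith
        calc T ^ κ / (3 * L) * (c₂ * (c₁ / (2 * R)))
            ≤ T ^ κ / (3 * L) * (c₂ * pr U (tiltedWeight (t i)) (H i)) := by
              have := hHpr i hi
              gcongr
          _ = _ := by
              simp only [ha]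
              have := Real.exp_pos (t i)
              field_simp
    _ ≤ ∑ i ∈ Finset.range N, a i * bern U (fun p => 1 / ((p : ℝ) + 1)) (fun S =>
          2 ^ (S ∩ primesIn 17 (expexp (t i))).card * (if H i S then 1 else 0)) := by
        refine Finset.sum_le_sum fun i hi => mul_le_mul_of_nonneg_left ?_ (ha0 i)
        refine le_trans (le_of_eq ?_) (htilt (t i) T (ht17 i hi) (htT i hi)
          (fun S => if H i S then 1 else 0) (fun S => by split_ifs <;> norm_num))
        congr 1
        exact bern_congr fun S _ => by congr
    _ = bern U (fun p => 1 / ((p : ℝ) + 1)) (fun S => ∑ i ∈ Finset.range N,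
          if H i S then a i * 2 ^ (S ∩ primesIn 17 (expexp (t i))).card else 0) := by
        rw [bern_sum]
        refine Finset.sum_congr rfl fun i _ => ?_
        rw [← bern_const_mul]
        refine bern_congr fun S _ => ?_
        split_ifs <;> ring
    _ ≤ _ := by
        refine bern_mono hw0 hw1 fun S hS => ?_
        have hnn : (0 : ℝ) ≤ if S.card = r then (hooleyDelta (∏ p ∈ S, p) : ℝ) else 0 := by
          split_ifs <;> positivity
        refine le_trans (le_of_eq ?_) (sum_ite_le_of_unique (s := Finset.range N)
          (H := fun i => H i S)
          (f := fun i => a i * 2 ^ (S ∩ primesIn 17 (expexp (t i))).card) hnn ?_ ?_)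
        · exact Finset.sum_congr rfl fun i _ => by congr
        · intro i hi j hj hHi hHj
          by_contra hij
          have b1 : ¬ score (t i) S ≤ score (t j) S := fun h =>
            hHi.2 ⟨j, Finset.mem_erase.2 ⟨Ne.symm hij, hj⟩, h⟩
          have b2 : ¬ score (t j) S ≤ score (t i) S := fun h =>
            hHj.2 ⟨i, Finset.mem_erase.2 ⟨hij, hi⟩, h⟩
          exact b2 (not_le.1 b1).le
        · intro i hi hHi
          rw [if_pos hHi.1.1.1]
          exact hHi.1.le_hooleyDelta hlT2 hT0 (hαT0.trans (ht1 i hi)) (ht17 i hi) (htT i hi) hS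

end GridSum

/-! ### Reaching the exponent η_* -/

section Exponent

/-- If some c < 0 is admissible then so is 0: for D > 1 the windows [D^c, D] and [1, D] contain the
same positive integers. With no admissible c the real supremum defaults to 0. -/
theorem beta_nonneg (k : ℕ) : 0 ≤ beta k := by
  rw [beta]
  set X := {c : ℝ | c < 1 ∧
    Tendsto (fun D : ℝ => randomSetLaw
      {A : Set ℕ | k ≤ subsumMultiplicity (A ∩ {a : ℕ | D ^ c ≤ (a : ℝ) ∧ (a : ℝ) ≤ D})})
      atTop (𝓝 1)} with hX
  have hbdd : BddAbove X := ⟨1, fun c hc => hc.1.le⟩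
  rcases X.eq_empty_or_nonempty with h | ⟨c, hc⟩
  · rw [h, Real.sSup_empty]
  · rcases le_or_gt 0 c with h0 | h0
    · exact h0.trans (le_csSup hbdd hc)
    · refine le_csSup hbdd ⟨one_pos, hc.2.congr' ?_⟩
      filter_upwards [eventually_gt_atTop 1] with D hD
      have hD0 : 0 < D := by linarith
      have hset : {a : ℕ | D ^ c ≤ (a : ℝ) ∧ (a : ℝ) ≤ D} =
          {a : ℕ | D ^ (0 : ℝ) ≤ (a : ℝ) ∧ (a : ℝ) ≤ D} := by
        ext a
        simp only [Set.mem_ofPred_eq, Real.rpow_zero]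
        refine and_congr_left fun _ => ⟨fun h => ?_, fun h => ?_⟩
        · have : (0 : ℝ) < a := lt_of_lt_of_le (Real.rpow_pos_of_pos hD0 c) h
          exact_mod_cast (by exact_mod_cast this : 0 < a)
        · exact (Real.rpow_le_one_of_one_le_of_nonpos hD.le h0.le).trans h
      rw [hset]

/-- Clusters of size `T ^ κ` exist for `κ` arbitrarily close to `etaStar`. -/
theorem exists_cluster_exponent {ε : ℝ} (hε : 0 < ε) : ∃ κ : ℝ, etaStar - ε ≤ κ ∧
    ∀ α : ℝ, 0 < α → ∀ᶠ T : ℝ in atTop, ∀ t : ℝ, α * T ≤ t → α * T ≤ T - t →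
      3 / 4 ≤ pr (primesIn (expexp t) (expexp T)) (fun p => 1 / ((p : ℝ) + 1))
        (Cluster (Real.exp t / (2 * T)) (T ^ κ)) := by
  -- For a nonpositive target κ = 0 suffices, and a cluster of size one always exists.
  rcases le_or_gt (etaStar - ε) 0 with hη | hη
  · refine ⟨0, hη, fun α _ => ?_⟩
    filter_upwards [eventually_gt_atTop 0] with T hT t _ _
    have h1 : pr (primesIn (expexp t) (expexp T)) (fun p => 1 / ((p : ℝ) + 1))
        (Cluster (Real.exp t / (2 * T)) (T ^ (0 : ℝ))) = 1 := by
      rw [Real.rpow_zero]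
      refine (bern_congr fun S _ => ?_).trans (bern_one _ _)
      rw [if_pos (cluster_one (by positivity) S)]
    rw [h1]
    norm_num
  · set a' := etaStar - ε / 2 with ha'
    have ha'0 : 0 < a' := by linarith
    -- The real liminf is a supremum of eventual lower bounds, which is 0 for the empty set;
    -- positivity of `a'` excludes that default.
    have hlt : a' < sSup {a : ℝ | ∀ᶠ k : ℕ in atTop, a ≤ Real.log k / Real.log (1 / beta k)} := by
      rw [← liminf_eq]
      change a' < etaStar
      linarith
    have hne : {a : ℝ | ∀ᶠ k : ℕ in atTop, a ≤ Real.log k / Real.log (1 / beta k)}.Nonempty := by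
      by_contra h
      rw [Set.not_nonempty_iff_eq_empty.1 h, Real.sSup_empty] at hlt
      linarith
    obtain ⟨a, ha, haa⟩ := exists_lt_of_lt_csSup hne hlt
    obtain ⟨k, hk, hk2⟩ := (ha.and (eventually_ge_atTop 2)).exists
    have hlk : 0 < Real.log k := Real.log_pos (by exact_mod_cast hk2)
    have ha0 : 0 < a := ha'0.trans haa
    have hu : 0 < Real.log k / Real.log (1 / beta k) := lt_of_lt_of_le ha0 hk
    have hlb : 0 < Real.log (1 / beta k) := (div_pos_iff_of_pos_left hlk).1 hu
    -- If `beta k` were 0, then log(1/0) would be 0 by the conventions for division and logarithm,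
    -- against `hlb`.
    have hβ0 : 0 < beta k := by
      refine lt_of_le_of_ne (beta_nonneg k) fun h => ?_
      rw [← h] at hlb
      simp at hlb
    -- Chosen so that log k / log(1/c') equals `a'` exactly. The lower bound `a > a'` for the
    -- quotient at k is what places `c'` below `beta k`.
    set c' := Real.exp (-(Real.log k / a')) with hc'
    have hc'β : c' < beta k := by
      rw [hc', ← Real.lt_log_iff_exp_lt hβ0]
      rw [one_div, Real.log_inv] at hlb hk
      rw [le_div_iff₀ hlb] at hk
      have h1 : Real.log k / a < Real.log k / a' := div_lt_div_of_pos_left hlk ha'0 haa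
      have h2 : -Real.log (beta k) ≤ Real.log k / a := by
        rw [le_div_iff₀ ha0]
        linarith
      linarith
    have hXne : {c : ℝ | c < 1 ∧
        Tendsto (fun D : ℝ => randomSetLaw
          {A : Set ℕ | k ≤ subsumMultiplicity (A ∩ {a : ℕ | D ^ c ≤ (a : ℝ) ∧ (a : ℝ) ≤ D})})
          atTop (𝓝 1)}.Nonempty := by
      by_contra h
      have : beta k = 0 := by rw [beta, Set.not_nonempty_iff_eq_empty.1 h, Real.sSup_empty]
      linarith
    obtain ⟨c, ⟨hc1, hc⟩, hcc⟩ := exists_lt_of_lt_csSup hXne hc'β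
    have hκ0 : Real.log k / Real.log (1 / c') = a' := by
      rw [one_div, Real.log_inv, hc', Real.log_exp, neg_neg, div_div_cancel₀ hlk.ne']
    -- The relative loss ε' costs a' ε' ≤ ε/2 in the exponent, the other half of ε having gone into
    -- `a'`.
    set ε' := min (1 / 2) (ε / (2 * a')) with hε'
    have hε'0 : 0 < ε' := lt_min (by norm_num) (by positivity)
    have hε'1 : ε' < 1 := lt_of_le_of_lt (min_le_left _ _) (by norm_num)
    refine ⟨a' * (1 - ε'), ?_, fun α hα => ?_⟩
    · have h1 : ε' ≤ ε / (2 * a') := min_le_right _ _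
      rw [le_div_iff₀ (by positivity)] at h1
      linarith
    · have := exists_pr_cluster_ge hk2 (Real.exp_pos _) hcc hc1 hc hα hε'0 hε'1
      rwa [hκ0] at this

end Exponent

/-! ### Small primes, bounded ranges and the final estimates -/

section Conclusion

/-- The contribution of a single outcome. It is applied to the empty set of primes below 17 and to
one explicit set when T is bounded. -/
theorem bern_empty_le {U : Finset ℕ} {q : ℕ → ℝ} (h0 : ∀ a ∈ U, 0 ≤ q a) (h1 : ∀ a ∈ U, q a ≤ 1)
    {f : Finset ℕ → ℝ} (hf : ∀ S ⊆ U, 0 ≤ f S) {S : Finset ℕ} (hS : S ⊆ U) :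
    ((∏ a ∈ S, q a) * ∏ a ∈ U \ S, (1 - q a)) * f S ≤ bern U q f := by
  refine Finset.single_le_sum (f := fun S => ((∏ a ∈ S, q a) * ∏ a ∈ U \ S, (1 - q a)) * f S)
    (fun R hR => ?_) (Finset.mem_powerset.2 hS)
  have hR := Finset.mem_powerset.1 hR
  exact mul_nonneg (mul_nonneg (Finset.prod_nonneg fun a ha => h0 a (hR ha))
    (Finset.prod_nonneg fun a ha => sub_nonneg.2 (h1 a (Finset.sdiff_subset ha)))) (hf R hR)

/-- Discarding the primes below `17` costs at most a constant factor. -/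
theorem exists_bern_primesIn_zero_ge : ∃ c : ℝ, 0 < c ∧ ∀ x : ℝ, 17 ≤ x →
    ∀ f : Finset ℕ → ℝ, (∀ S, 0 ≤ f S) →
    c * bern (primesIn 17 x) (fun p => 1 / ((p : ℝ) + 1)) f ≤
      bern (primesIn 0 x) (fun p => 1 / ((p : ℝ) + 1)) f := by
  refine ⟨∏ p ∈ primesIn 0 17, (1 - 1 / ((p : ℝ) + 1)), ?_, fun x hx f hf => ?_⟩
  · refine Finset.prod_pos fun p hp => ?_
    have hp0 : (0 : ℝ) < p := by exact_mod_cast pos_of_mem_primesIn p hp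
    have : 1 - 1 / ((p : ℝ) + 1) = p / (p + 1) := by field_simp; ring
    rw [this]
    positivity
  · rw [← primesIn_union (show (0 : ℝ) ≤ 17 by norm_num) hx,
      bern_union (disjoint_primesIn 0 le_rfl x)]
    have := bern_empty_le (U := primesIn 0 17) (q := fun p => 1 / ((p : ℝ) + 1))
      (f := fun S => bern (primesIn 17 x) (fun p => 1 / ((p : ℝ) + 1)) fun S' => f (S ∪ S'))
      (fun p _ => by positivity) (fun p _ => inv_succ_le_one p)
      (fun S _ => bern_nonneg (fun p _ => by positivity) (fun p _ => inv_succ_le_one p)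
        fun S' _ => hf _) (Finset.empty_subset _)
    simpa using this

theorem prod_ne_zero_of_subset_primesIn {u v : ℝ} {S : Finset ℕ} (hS : S ⊆ primesIn u v) :
    ∏ p ∈ S, p ≠ 0 :=
  Finset.prod_ne_zero_iff.2 fun _ hp => (mem_primesIn.1 (hS hp)).1.ne_zero

/-- The mean of `hooleyDelta (∏ p ∈ S, p)` over the random sets `S` of primes below `expexp T` with
`r` elements. -/
noncomputable def meanDelta (T : ℝ) (r : ℕ) : ℝ :=
  bern (primesIn 0 (expexp T)) (fun p => 1 / ((p : ℝ) + 1))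
    (fun S => if S.card = r then (hooleyDelta (∏ p ∈ S, p) : ℝ) else 0)

/-- Half of ε is spent on approaching η_*, the other half on absorbing (log T)². -/
theorem exists_eventually_meanDelta_ge {ε : ℝ} (hε : 0 < ε) : ∃ c : ℝ, 0 < c ∧
    ∀ᶠ T : ℝ in atTop, ∀ r : ℕ, (1 + ε) * T ≤ r → (r : ℝ) ≤ (2 - ε) * T →
      c * T ^ (etaStar - ε) ≤ meanDelta T r := by
  obtain ⟨κ, hκ, hcl⟩ := exists_cluster_exponent (show 0 < ε / 2 by linarith)
  obtain ⟨c, hc, hmain⟩ := exists_bern_hooleyDelta_ge hε hcl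
  obtain ⟨c₀, hc₀, hsmall⟩ := exists_bern_primesIn_zero_ge
  refine ⟨c₀ * c, by positivity, ?_⟩
  have hlog := (isLittleO_log_rpow_atTop (show 0 < ε / 4 by linarith)).bound one_pos
  filter_upwards [hmain, hlog, eventually_gt_atTop 1, eventually_ge_atTop (Real.log (Real.log 17))]
    with T hmain hlog hT1 hT17 r hr1 hr2
  have hT0 : 0 < T := by linarith
  have hlT : 0 < Real.log T := Real.log_pos hT1
  rw [one_mul, Real.norm_of_nonneg hlT.le, Real.norm_of_nonneg (by positivity)] at hlog
  have h17 : 17 ≤ expexp T := by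
    rw [expexp, ← Real.log_le_iff_le_exp (by norm_num), ← Real.log_le_iff_le_exp]
    · exact hT17
    · linarith [one_le_log_of_three_le (by norm_num : (3 : ℝ) ≤ 17)]
  have h1 : T ^ (etaStar - ε) ≤ T ^ κ / Real.log T ^ 2 := by
    rw [le_div_iff₀ (by positivity)]
    calc T ^ (etaStar - ε) * Real.log T ^ 2 ≤ T ^ (etaStar - ε) * (T ^ (ε / 4)) ^ 2 := by gcongr
      _ = T ^ (etaStar - ε / 2) := by
          rw [← Real.rpow_natCast, ← Real.rpow_mul hT0.le, ← Real.rpow_add hT0]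
          congr 1
          push_cast
          ring
      _ ≤ T ^ κ := Real.rpow_le_rpow_of_exponent_le hT1.le hκ
  calc c₀ * c * T ^ (etaStar - ε) ≤ c₀ * c * (T ^ κ / Real.log T ^ 2) := by gcongr
    _ = c₀ * (c * (T ^ κ / Real.log T ^ 2)) := by ring
    _ ≤ c₀ * bern (primesIn 17 (expexp T)) (fun p => 1 / ((p : ℝ) + 1))
          (fun S => if S.card = r then (hooleyDelta (∏ p ∈ S, p) : ℝ) else 0) :=
        mul_le_mul_of_nonneg_left (hmain r hr1 hr2) hc₀.le
    _ ≤ meanDelta T r := hsmall _ h17 _ fun S => by split_ifs <;> positivity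

/-- Bertrand's postulate supplies a new prime at each doubling. -/
theorem le_card_primesLE_two_pow (m : ℕ) : m ≤ (Nat.primesLE (2 ^ m)).card := by
  induction m with
  | zero => exact Nat.zero_le _
  | succ m ih =>
    obtain ⟨p, hp, h1, h2⟩ := Nat.exists_prime_lt_and_le_two_mul (2 ^ m) (by positivity)
    have hnot : p ∉ Nat.primesLE (2 ^ m) := fun h => by
      rw [Nat.mem_primesLE] at h
      omega
    have hsub : insert p (Nat.primesLE (2 ^ m)) ⊆ Nat.primesLE (2 ^ (m + 1)) := by
      intro q hq
      rw [Finset.mem_insert] at hq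
      rw [Nat.mem_primesLE, pow_succ]
      rcases hq with rfl | hq
      · exact ⟨by omega, hp⟩
      · rw [Nat.mem_primesLE] at hq
        exact ⟨by omega, hq.2⟩
    have := Finset.card_le_card hsub
    rw [Finset.card_insert_of_notMem hnot] at this
    omega

/-- For bounded T one set of r primes suffices: its probability is bounded below by a constant
depending on T₀ only, and Δ ≥ 1. -/
theorem exists_meanDelta_ge_of_le (T₀ : ℝ) : ∃ c : ℝ, 0 < c ∧ ∀ T : ℝ, 1 ≤ T → T ≤ T₀ → ∀ r : ℕ,
    (r : ℝ) ≤ 2 * T → c ≤ meanDelta T r := by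
  refine ⟨∏ p ∈ primesIn 0 (expexp T₀), 1 / ((p : ℝ) + 1),
    Finset.prod_pos fun p _ => by positivity, fun T hT1 hT₀ r hr => ?_⟩
  set U := primesIn 0 (expexp T) with hU
  have hcard : r ≤ U.card := by
    refine (le_card_primesLE_two_pow r).trans (Finset.card_le_card fun p hp => ?_)
    rw [Nat.mem_primesLE] at hp
    rw [hU, mem_primesIn]
    refine ⟨hp.2, Nat.cast_nonneg p, ?_⟩
    have h1 : (p : ℝ) ≤ (2 : ℝ) ^ r := by exact_mod_cast hp.1
    refine lt_of_le_of_lt h1 ?_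
    rw [expexp, ← Real.log_lt_iff_lt_exp (by positivity), Real.log_pow]
    -- There are r primes up to 2^r, and these lie below exp(exp T) because r log 2 ≤ 2T log 2 < eT
    -- ≤ e^T.
    have h2 : T * Real.exp 1 ≤ Real.exp T := by
      have h3 := Real.add_one_le_exp (T - 1)
      have h4 : Real.exp T = Real.exp (T - 1) * Real.exp 1 := by rw [← Real.exp_add]; ring_nf
      rw [h4]
      exact mul_le_mul_of_nonneg_right (by linarith) (Real.exp_pos 1).le
    have h3 := Real.exp_one_gt_d9
    have h4 := Real.log_two_lt_d9
    have h5 : 0 < Real.log 2 := Real.log_pos (by norm_num)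
    nlinarith
  obtain ⟨S, hS, hSr⟩ := Finset.exists_subset_card_eq hcard
  have h1 := bern_empty_le (U := U) (q := fun p => 1 / ((p : ℝ) + 1))
    (f := fun S => if S.card = r then (hooleyDelta (∏ p ∈ S, p) : ℝ) else 0)
    (fun p _ => by positivity) (fun p _ => inv_succ_le_one p)
    (fun S _ => by split_ifs <;> positivity) hS
  refine le_trans ?_ h1
  rw [if_pos hSr]
  have hΔ : (1 : ℝ) ≤ hooleyDelta (∏ p ∈ S, p) := by
    exact_mod_cast one_le_hooleyDelta (prod_ne_zero_of_subset_primesIn hS)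
  have hsub : U ⊆ primesIn 0 (expexp T₀) := primesIn_subset le_rfl (expexp_mono hT₀)
  calc ∏ p ∈ primesIn 0 (expexp T₀), 1 / ((p : ℝ) + 1) ≤ ∏ p ∈ U, 1 / ((p : ℝ) + 1) := by
        rw [← Finset.prod_sdiff hsub]
        exact mul_le_of_le_one_left (Finset.prod_nonneg fun p _ => by positivity)
          (Finset.prod_le_one (fun p _ => by positivity) fun p _ => inv_succ_le_one p)
    _ = (∏ p ∈ S, 1 / ((p : ℝ) + 1)) * ∏ p ∈ U \ S, 1 / ((p : ℝ) + 1) := by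
        rw [mul_comm, Finset.prod_sdiff hS]
    _ ≤ (∏ p ∈ S, 1 / ((p : ℝ) + 1)) * ∏ p ∈ U \ S, (1 - 1 / ((p : ℝ) + 1)) := by
        refine mul_le_mul_of_nonneg_left (Finset.prod_le_prod (fun p _ => by positivity)
          fun p hp => ?_) (Finset.prod_nonneg fun p _ => by positivity)
        have hp1 : (1 : ℝ) ≤ p := by
          exact_mod_cast pos_of_mem_primesIn p (Finset.sdiff_subset hp)
        rw [le_sub_iff_add_le, ← add_div, div_le_one (by linarith)]
        linarith
    _ ≤ _ := le_mul_of_one_le_right (mul_nonneg (Finset.prod_nonneg fun p _ => by positivity)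
        (Finset.prod_nonneg fun p _ => sub_nonneg.2 (inv_succ_le_one p))) hΔ

theorem rpow_le_rpow_abs {T T₀ e : ℝ} (h1 : 1 ≤ T) (h : T ≤ T₀) : T ^ e ≤ T₀ ^ |e| :=
  (Real.rpow_le_rpow_of_exponent_le h1 (le_abs_self e)).trans
    (Real.rpow_le_rpow (by linarith) h (abs_nonneg e))

theorem exists_meanDelta_ge {ε : ℝ} (hε : 0 < ε) : ∃ c : ℝ, 0 < c ∧ ∀ T : ℝ, 1 ≤ T → ∀ r : ℕ,
    (1 + ε) * T ≤ r → (r : ℝ) ≤ (2 - ε) * T → c * T ^ (etaStar - ε) ≤ meanDelta T r := by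
  obtain ⟨c, hc, h⟩ := exists_eventually_meanDelta_ge hε
  obtain ⟨T₀, hT₀⟩ := eventually_atTop.1 (h.and (eventually_ge_atTop 1))
  have hT₀1 : 1 ≤ T₀ := (hT₀ T₀ le_rfl).2
  obtain ⟨c', hc', h'⟩ := exists_meanDelta_ge_of_le T₀
  have hp : 0 < T₀ ^ |etaStar - ε| := Real.rpow_pos_of_pos (by linarith) _
  refine ⟨min c (c' / T₀ ^ |etaStar - ε|), lt_min hc (by positivity), fun T hT r hr1 hr2 => ?_⟩
  have hTp : 0 < T ^ (etaStar - ε) := Real.rpow_pos_of_pos (by linarith) _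
  rcases le_total T₀ T with hT' | hT'
  · exact (mul_le_mul_of_nonneg_right (min_le_left _ _) hTp.le).trans ((hT₀ T hT').1 r hr1 hr2)
  · calc _ ≤ c' / T₀ ^ |etaStar - ε| * T₀ ^ |etaStar - ε| :=
          mul_le_mul (min_le_right _ _) (rpow_le_rpow_abs hT hT') hTp.le (by positivity)
      _ = c' := by field_simp
      _ ≤ meanDelta T r := h' T hT hT' r (by nlinarith)

theorem one_le_Log2 (x : ℝ) : 1 ≤ Log2 x := le_max_left _ _

/-- Neither truncation in the iterated logarithm is active once the value exceeds 1. -/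
theorem eq_expexp_of_one_lt_Log2 {x : ℝ} (hx : 0 < x) (h : 1 < Log2 x) : x = expexp (Log2 x) := by
  have h1 : Log2 x = Real.log (Log x) := by
    rw [Log2, Log, max_eq_right_iff]
    by_contra h2
    rw [Log2, Log, max_eq_left (not_le.1 h2).le] at h
    exact lt_irrefl _ h
  have hL1 : 1 ≤ Log x := le_max_left _ _
  have h2 : Log x = Real.log x := by
    rw [Log, max_eq_right_iff]
    by_contra h3
    have : Log x = 1 := by rw [Log, max_eq_left (not_le.1 h3).le]
    rw [h1, this, Real.log_one] at h
    linarith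
  rw [h1, expexp, Real.exp_log (by linarith), h2, Real.exp_log hx]

theorem exists_integral_cardDistinctFactors_ge {ε : ℝ} (hε : 0 < ε) : ∃ C : ℝ, 0 < C ∧
    ∀ x : ℝ, 0 < x → ∀ r : ℤ, (1 + ε) * Log2 x ≤ (r : ℝ) → (r : ℝ) ≤ (2 - ε) * Log2 x →
      C * Log2 x ^ (etaStar - ε) ≤
        ∫ n : Nat.Primes → ℕ,
          (if (ArithmeticFunction.cardDistinctFactors (randomInt x n) : ℤ) = r then
            (hooleyDelta (randomInt x n) : ℝ) else 0) ∂sampleLaw := by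
  obtain ⟨C, hC, h⟩ := exists_meanDelta_ge hε
  refine ⟨C, hC, fun x hx r hr1 hr2 => ?_⟩
  have hT1 := one_le_Log2 x
  have hr0 : 0 ≤ r := by
    have : (0 : ℝ) ≤ r := by nlinarith
    exact_mod_cast this
  lift r to ℕ using hr0
  rw [Int.cast_natCast] at hr1 hr2
  -- When `Log2 x = 1` the range [1 + ε, 2 - ε] contains no integer, so the claim is vacuous.
  have hT : 1 < Log2 x := by
    refine lt_of_le_of_ne hT1 fun he => ?_
    rw [← he] at hr1 hr2
    have h1 : 1 < r := by
      have : (1 : ℝ) < r := by linarith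
      exact_mod_cast this
    have h2 : r < 2 := by
      have : (r : ℝ) < 2 := by linarith
      exact_mod_cast this
    omega
  refine (h (Log2 x) hT1 r hr1 hr2).trans_eq ?_
  rw [meanDelta, ← eq_expexp_of_one_lt_Log2 hx hT]
  refine Eq.trans ?_ (integral_sampleLaw_randomInt x (fun n =>
    if (ArithmeticFunction.cardDistinctFactors n : ℤ) = r then (hooleyDelta n : ℝ) else 0)).symm
  refine bern_congr fun S hS => ?_
  rw [cardDistinctFactors_prod fun p hp => (mem_primesIn.1 (hS hp)).1]
  simp only [Nat.cast_inj]

theorem exists_integral_hooleyDelta_ge {ε : ℝ} (hε : 0 < ε) : ∃ C : ℝ, 0 < C ∧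
    ∀ x : ℝ, 0 < x → C * Log2 x ^ (1 + etaStar - ε) ≤
      ∫ n : Nat.Primes → ℕ, (hooleyDelta (randomInt x n) : ℝ) ∂sampleLaw := by
  -- With ε₁ ≤ 1/4 the fixed interval [5T/4, 7T/4] lies in the admissible range of r.
  set ε₁ := min ε (1 / 4) with hε₁
  have hε₁0 : 0 < ε₁ := lt_min hε (by norm_num)
  have hε₁1 : ε₁ ≤ ε := min_le_left _ _
  have hε₁2 : ε₁ ≤ 1 / 4 := min_le_right _ _
  obtain ⟨c, hc, h⟩ := exists_meanDelta_ge hε₁0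
  set e := 1 + etaStar - ε with he
  refine ⟨min (c / 4) (1 / 4 ^ |e|), lt_min (by positivity) (by positivity), fun x hx => ?_⟩
  rw [integral_sampleLaw_randomInt x (fun n => (hooleyDelta n : ℝ))]
  have hT1 := one_le_Log2 x
  set T := Log2 x with hT
  have hT0 : 0 < T := by linarith
  have hTp : 0 < T ^ e := Real.rpow_pos_of_pos hT0 _
  have hw0 : ∀ p ∈ primesIn 0 x, 0 ≤ 1 / ((p : ℝ) + 1) := fun p _ => by positivity
  have hw1 : ∀ p ∈ primesIn 0 x, 1 / ((p : ℝ) + 1) ≤ 1 := fun p _ => inv_succ_le_one p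
  -- For T ≤ 4 the bound Δ ≥ 1 suffices. For T ≥ 4 the interval holds at least T/2 - 1 ≥ T/4
  -- integers, which yields the extra factor T.
  rcases le_total T 4 with hT4 | hT4
  · calc min (c / 4) (1 / 4 ^ |e|) * T ^ e ≤ 1 / 4 ^ |e| * 4 ^ |e| :=
          mul_le_mul (min_le_right _ _) (rpow_le_rpow_abs hT1 hT4) hTp.le (by positivity)
      _ = 1 := by field_simp
      _ = bern (primesIn 0 x) (fun p => 1 / ((p : ℝ) + 1)) (fun _ => 1) := (bern_one _ _).symm
      _ ≤ _ := bern_mono hw0 hw1 fun S hS => by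
          exact_mod_cast one_le_hooleyDelta (prod_ne_zero_of_subset_primesIn hS)
  · have hxT : x = expexp T := eq_expexp_of_one_lt_Log2 hx (by linarith)
    set I := Finset.Icc ⌈5 / 4 * T⌉₊ ⌊7 / 4 * T⌋₊ with hI
    have hcard : T / 4 ≤ I.card := by
      rw [hI, Nat.card_Icc]
      have h1 := Nat.ceil_lt_add_one (show 0 ≤ 5 / 4 * T by positivity)
      have h2 := Nat.lt_floor_add_one (7 / 4 * T)
      have h3 : ⌈5 / 4 * T⌉₊ ≤ ⌊7 / 4 * T⌋₊ + 1 := by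
        have : (⌈5 / 4 * T⌉₊ : ℝ) ≤ (⌊7 / 4 * T⌋₊ : ℝ) + 1 := by linarith
        exact_mod_cast this
      rw [Nat.cast_sub h3]
      push_cast
      linarith
    have hexp : T ^ e ≤ T * T ^ (etaStar - ε₁) := by
      calc T ^ e ≤ T ^ (1 + (etaStar - ε₁)) :=
            Real.rpow_le_rpow_of_exponent_le hT1 (by linarith)
        _ = _ := by rw [Real.rpow_add hT0, Real.rpow_one]
    calc min (c / 4) (1 / 4 ^ |e|) * T ^ e ≤ c / 4 * (T * T ^ (etaStar - ε₁)) :=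
          mul_le_mul (min_le_left _ _) hexp hTp.le (by positivity)
      _ = T / 4 * (c * T ^ (etaStar - ε₁)) := by ring
      _ ≤ I.card * (c * T ^ (etaStar - ε₁)) := by
          have := Real.rpow_pos_of_pos hT0 (etaStar - ε₁)
          gcongr
      _ = ∑ r ∈ I, c * T ^ (etaStar - ε₁) := by rw [Finset.sum_const, nsmul_eq_mul]
      _ ≤ ∑ r ∈ I, meanDelta T r := by
          refine Finset.sum_le_sum fun r hr => ?_
          rw [hI, Finset.mem_Icc, Nat.ceil_le, Nat.le_floor_iff (by positivity)] at hr
          refine h T hT1 r ?_ ?_ <;> nlinarith [hr.1, hr.2]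
      _ = bern (primesIn 0 x) (fun p => 1 / ((p : ℝ) + 1)) (fun S =>
            ∑ r ∈ I, if S.card = r then (hooleyDelta (∏ p ∈ S, p) : ℝ) else 0) := by
          rw [bern_sum, hxT]
          rfl
      _ ≤ _ := by
          refine bern_mono hw0 hw1 fun S _ => ?_
          rw [Finset.sum_ite_eq]
          split_ifs
          · exact le_rfl
          · exact Nat.cast_nonneg _

end Conclusion

end ErdosHooley

theorem mainTheorem2 :
    (∀ ε : ℝ, 0 < ε → ∃ C : ℝ, 0 < C ∧ ∀ x : ℝ, 0 < x → ∀ r : ℤ,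
      (1 + ε) * ErdosHooley.Log2 x ≤ (r : ℝ) → (r : ℝ) ≤ (2 - ε) * ErdosHooley.Log2 x →
      C * ErdosHooley.Log2 x ^ (ErdosHooley.etaStar - ε) ≤
        ∫ n : Nat.Primes → ℕ,
          (if (ArithmeticFunction.cardDistinctFactors (ErdosHooley.randomInt x n) : ℤ) = r then
            (ErdosHooley.hooleyDelta (ErdosHooley.randomInt x n) : ℝ) else 0)
          ∂ErdosHooley.sampleLaw) ∧
    (∀ ε : ℝ, 0 < ε → ∃ C : ℝ, 0 < C ∧ ∀ x : ℝ, 0 < x →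
      C * ErdosHooley.Log2 x ^ (1 + ErdosHooley.etaStar - ε) ≤
        ∫ n : Nat.Primes → ℕ, (ErdosHooley.hooleyDelta (ErdosHooley.randomInt x n) : ℝ)
          ∂ErdosHooley.sampleLaw) :=
  ⟨fun _ hε => ErdosHooley.exists_integral_cardDistinctFactors_ge hε,
    fun _ hε => ErdosHooley.exists_integral_hooleyDelta_ge hε⟩
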